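/- Let $k$ be a commutative ring with $1$; algebras are unital associative $k$-algebras. For an algebra $A$ write $A^e=A\otimes_k A^{\mathrm{op}}$; left $A^e$-modules are the $A$-$A$-bimodules (with central $k$-action). For an algebra automorphism $\nu$ of $A$, let $A^\nu$ be the bimodule $A$ with $a\cdot m\cdot b=a\,m\,\nu(b)$. For $d\ge 0$, the algebra $A$ is called *$\nu$-twisted Calabi–Yau of dimension $d$* (and $\nu$ a *Nakayama automorphism* of $A$) if 1. $A$ has, as an $A^e$-module, a resolution of finite length by finitely generated projective $A^e$-modules, and 2. $\mathrm{Ext}^i_{A^e}(A,A^e)=0$ for $i\neq d$, and $\mathrm{Ext}^d_{A^e}(A,A^e)\cong A^\nu$ as bimodules. Here $\mathrm{Ext}$ is formed with the outer bimodule structure $a(m\otimes n)b=am\otimes nb$ on $A^e$, and its bimodule structure is induced by the inner one, $a(m\otimes n)b=mb\otimes an$. **Theorem.** Let $A$ be a $k$-algebra that is projective as a $k$-module, $\sigma$ a $k$-algebra automorphism of $A$, and $\delta\colon A\to A$ a $\sigma$-derivation, that is, a $k$-linear map with $\delta(ab)=\delta(a)b+\sigma(a)\delta(b)$ for all $a,b\in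 A$. Let $E=A[x;\sigma,\delta]$ be the Ore extension, i.e. the $k$-algebra containing $A$ which is free as a left $A$-module with basis $1,x,x^2,\dots$ and satisfies $xa=\sigma(a)x+\delta(a)$ for all $a\in A$. Suppose that $A$ is $\nu$-twisted Calabi–Yau of dimension $d$ for an algebra automorphism $\nu$ of $A$. Then there is an algebra automorphism $\nu'$ of $E$ such that $E$ is $\nu'$-twisted Calabi–Yau of dimension $d+1$, $\nu'|_A=\sigma^{-1}\nu$, and $\nu'(x)=ux+b$ for some $u,b\in A$ with $u$ a unit of $A$. -/

import Mathlib

open CategoryTheory TensorProduct MulOpposite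

universe u v w

noncomputable section

/-- The enveloping algebra `Aᵉ = A ⊗ Aᵒᵖ` of a `k`-algebra `A`. Left `Aᵉ`-modules are the same as
`A`-`A`-bimodules with central action of `k`. -/
abbrev EnvelopingAlgebra (k : Type u) (A : Type v) [CommRing k] [Ring A] [Algebra k A] : Type v :=
  A ⊗[k] Aᵐᵒᵖ

section Bimodules

variable (k : Type u) (A : Type v) [CommRing k] [Ring A] [Algebra k A]

/-- `A` as an `Aᵉ`-module: `(a ⊗ b) • m = a * m * b`. -/
abbrev selfBimoduleStructure : Module (EnvelopingAlgebra k A) A :=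
  Module.compHom A (AlgHom.mulLeftRight k A).toRingHom

/-- `A` as an object of the category of left `Aᵉ`-modules. -/
def selfBimodule : ModuleCat.{v} (EnvelopingAlgebra k A) :=
  letI := selfBimoduleStructure k A
  ModuleCat.of (EnvelopingAlgebra k A) A

/-- `Aᵉ` as the left regular `Aᵉ`-module; in terms of `A ⊗ A` this is the outer bimodule structure
`a • (m ⊗ n) • b = a m ⊗ n b`. -/
def envelopingModule : ModuleCat.{v} (EnvelopingAlgebra k A) :=
  ModuleCat.of (EnvelopingAlgebra k A) (EnvelopingAlgebra k A)

lemma selfBimodule_smul (a b : A) (m : A) :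
    letI := selfBimoduleStructure k A
    ((a ⊗ₜ[k] op b : EnvelopingAlgebra k A) • m : A) = a * m * b :=
  AlgHom.mulLeftRight_apply k A a (op b) m

/-- Right multiplication by `r` on `Aᵉ`, an endomorphism of the left regular `Aᵉ`-module. -/
def envelopingRightMul (r : EnvelopingAlgebra k A) :
    envelopingModule k A ⟶ envelopingModule k A :=
  ModuleCat.ofHom (LinearMap.toSpanSingleton (EnvelopingAlgebra k A) (EnvelopingAlgebra k A) r)

/-- Right multiplication by `b ⊗ a` on `Aᵉ` is the inner bimodule action
`a • (m ⊗ n) • b = m b ⊗ a n`. -/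
lemma envelopingRightMul_tmul (a b m n : A) :
    (envelopingRightMul k A (b ⊗ₜ[k] op a)).hom (m ⊗ₜ[k] op n : EnvelopingAlgebra k A) =
      ((m * b) ⊗ₜ[k] op (a * n) : EnvelopingAlgebra k A) := by
  change (m ⊗ₜ[k] op n : EnvelopingAlgebra k A) * (b ⊗ₜ[k] op a) = _
  rw [Algebra.TensorProduct.tmul_mul_tmul, op_mul]

/-- The group `Ext^i_{Aᵉ}(A, Aᵉ)` of left `Aᵉ`-modules. -/
abbrev ExtEnveloping (i : ℕ) : Type v :=
  Abelian.Ext (selfBimodule k A) (envelopingModule k A) i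

variable {k A} in
/-- The bimodule action `ξ ↦ a • ξ • b` on `Ext^i_{Aᵉ}(A, Aᵉ)` induced by the inner bimodule action
`a • (m ⊗ n) • b = m b ⊗ a n` on `Aᵉ`. -/
def ExtEnveloping.biact {i : ℕ} (a b : A) (ξ : ExtEnveloping k A i) : ExtEnveloping k A i :=
  ξ.comp (Abelian.Ext.mk₀ (envelopingRightMul k A (b ⊗ₜ[k] op a))) (add_zero i)

/-- `A` is homologically smooth over `k`: as an `Aᵉ`-module it has a resolution of finite length
by finitely generated projective modules. -/
def IsHomologicallySmooth : Prop :=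
  ∃ P : ProjectiveResolution (selfBimodule k A),
    (∀ n, Module.Finite (EnvelopingAlgebra k A) (P.complex.X n)) ∧
    ∃ N : ℕ, ∀ n, N < n → Limits.IsZero (P.complex.X n)

variable {A} in
/-- `A` is `ν`-twisted Calabi–Yau of dimension `d`, i.e. it is homologically smooth and
`Ext^i_{Aᵉ}(A, Aᵉ)` is zero for `i ≠ d` and isomorphic to `A^ν` as a bimodule for `i = d`. Here `A^ν`
is `A` with the bimodule structure `a • m • b = a * m * ν b`. -/
structure IsTwistedCalabiYau (ν : A ≃ₐ[k] A) (d : ℕ) : Prop where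
  smooth : IsHomologicallySmooth k A
  ext_subsingleton : ∀ i : ℕ, i ≠ d → Subsingleton (ExtEnveloping k A i)
  ext_iso : ∃ φ : ExtEnveloping k A d ≃+ A, ∀ (a b : A) (ξ : ExtEnveloping k A d),
    φ (ExtEnveloping.biact a b ξ) = a * φ ξ * ν b

end Bimodules

section OreExtensions

variable {k : Type u} {A : Type v} [CommRing k] [Ring A] [Algebra k A]

/-- `δ` is a `σ`-derivation of `A`. -/
def IsSkewDerivation (σ : A →ₐ[k] A) (δ : A →ₗ[k] A) : Prop :=
  ∀ a b : A, δ (a * b) = δ a * b + σ a * δ b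

/-- The `k`-algebra `E`, with the structure map `ι : A → E` and the element `x`, is the Ore
extension `A[x; σ, δ]`: `E` is free as a left `A`-module on the powers `1, x, x², …`, and
`x a = σ(a) x + δ(a)` for all `a` in `A`. (In particular `ι` is injective.) -/
structure IsOreExtension (σ : A →ₐ[k] A) (δ : A →ₗ[k] A) {E : Type w} [Ring E] [Algebra k E]
    (ι : A →ₐ[k] E) (x : E) : Prop where
  bijective : Function.Bijective fun f : ℕ →₀ A => f.sum fun n a => ι a * x ^ n
  x_mul : ∀ a : A, x * ι a = ι (σ a) * x + ι (δ a)

namespace OreModel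

/-- Left multiplication by `a` on finitely supported sequences, the sequence `f` standing for
`∑ f n x^n`. -/
def left (k : Type u) {A : Type v} [CommRing k] [Ring A] [Algebra k A] :
    A →ₐ[k] Module.End k (ℕ →₀ A) :=
  Algebra.lsmul k k (ℕ →₀ A)

/-- Left multiplication by `x`: `a x^n ↦ σ(a) x^(n+1) + δ(a) x^n`. -/
def X (σ : A →ₐ[k] A) (δ : A →ₗ[k] A) : Module.End k (ℕ →₀ A) :=
  Finsupp.lsum k fun n => (Finsupp.lsingle (n + 1)).comp σ.toLinearMap +
    (Finsupp.lsingle n).comp δ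

lemma left_single (a b : A) (n : ℕ) :
    left k a (Finsupp.single n b) = Finsupp.single n (a * b) := by
  simp [left]

lemma X_single (σ : A →ₐ[k] A) (δ : A →ₗ[k] A) (b : A) (n : ℕ) :
    X σ δ (Finsupp.single n b) = Finsupp.single (n + 1) (σ b) + Finsupp.single n (δ b) := by
  simp [X]

lemma X_mul_left {σ : A →ₐ[k] A} {δ : A →ₗ[k] A} (hδ : IsSkewDerivation σ δ) (a : A) :
    X σ δ * left k a = left k (σ a) * X σ δ + left k (δ a) := by
  refine Finsupp.lhom_ext fun n b => ?_
  simp only [Module.End.mul_apply, LinearMap.add_apply, left_single, X_single, map_add, hδ a b,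
    map_mul, Finsupp.single_add]
  abel

lemma delta_one {σ : A →ₐ[k] A} {δ : A →ₗ[k] A} (hδ : IsSkewDerivation σ δ) : δ 1 = 0 := by
  have h := hδ 1 1
  simpa using h

lemma X_pow_one {σ : A →ₐ[k] A} {δ : A →ₗ[k] A} (hδ : IsSkewDerivation σ δ) (n : ℕ) :
    (X σ δ ^ n) (Finsupp.single 0 1) = Finsupp.single n 1 := by
  induction n with
  | zero => simp
  | succ n ih => simp [pow_succ', Module.End.mul_apply, ih, X_single, delta_one hδ]

/-- The operator `∑ f n X^n`. -/
def evalOp (σ : A →ₐ[k] A) (δ : A →ₗ[k] A) : (ℕ →₀ A) →ₗ[k] Module.End k (ℕ →₀ A) :=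
  Finsupp.lsum k fun n => (LinearMap.mulRight k (X σ δ ^ n)).comp (left k).toLinearMap

lemma eval_single (σ : A →ₐ[k] A) (δ : A →ₗ[k] A) (n : ℕ) (a : A) :
    evalOp σ δ (Finsupp.single n a) = left k a * X σ δ ^ n := by
  simp [evalOp]

lemma eval_one {σ : A →ₐ[k] A} {δ : A →ₗ[k] A} (hδ : IsSkewDerivation σ δ) (f : ℕ →₀ A) :
    evalOp σ δ f (Finsupp.single 0 1) = f := by
  induction f using Finsupp.induction_linear with
  | zero => simp
  | add f g hf hg => simp [hf, hg]
  | single n a => rw [eval_single, Module.End.mul_apply, X_pow_one hδ, left_single, mul_one]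

lemma left_mul_eval (σ : A →ₐ[k] A) (δ : A →ₗ[k] A) (a : A) (f : ℕ →₀ A) :
    left k a * evalOp σ δ f = evalOp σ δ (left k a f) := by
  induction f using Finsupp.induction_linear with
  | zero => simp
  | add f g hf hg => simp only [map_add, mul_add, hf, hg]
  | single n b => rw [left_single, eval_single, eval_single, map_mul, mul_assoc]

lemma X_mul_eval {σ : A →ₐ[k] A} {δ : A →ₗ[k] A} (hδ : IsSkewDerivation σ δ) (f : ℕ →₀ A) :
    X σ δ * evalOp σ δ f = evalOp σ δ (X σ δ f) := by
  induction f using Finsupp.induction_linear with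
  | zero => simp
  | add f g hf hg => simp only [map_add, mul_add, hf, hg]
  | single n b =>
    rw [X_single, map_add, eval_single, eval_single, eval_single, ← mul_assoc, X_mul_left hδ,
      add_mul, mul_assoc, pow_succ']

/-- The operators `∑ f n X^n` form a subalgebra. -/
def algebra {σ : A →ₐ[k] A} {δ : A →ₗ[k] A} (hδ : IsSkewDerivation σ δ) :
    Subalgebra k (Module.End k (ℕ →₀ A)) :=
  (LinearMap.range (evalOp σ δ)).toSubalgebra
    ⟨Finsupp.single 0 1, by simp [eval_single]⟩ (by
      have key : ∀ n (g : ℕ →₀ A),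
          X σ δ ^ n * evalOp σ δ g = evalOp σ δ ((X σ δ ^ n) g) := by
        intro n
        induction n with
        | zero => simp
        | succ n ih =>
          intro g
          rw [pow_succ', mul_assoc, ih, X_mul_eval hδ, Module.End.mul_apply]
      rintro _ _ ⟨f, rfl⟩ ⟨g, rfl⟩
      induction f using Finsupp.induction_linear with
      | zero => exact ⟨0, by simp⟩
      | add f₁ f₂ h₁ h₂ =>
        rw [map_add, add_mul]
        exact add_mem h₁ h₂
      | single n a =>
        rw [eval_single, mul_assoc, key, left_mul_eval]
        exact ⟨_, rfl⟩)

end OreModel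

open OreModel in
/-- Ore extensions exist. -/
theorem exists_isOreExtension {σ : A →ₐ[k] A} {δ : A →ₗ[k] A} (hδ : IsSkewDerivation σ δ) :
    ∃ (E : Type v) (_ : Ring E) (_ : Algebra k E) (ι : A →ₐ[k] E) (x : E),
      IsOreExtension σ δ ι x := by
  let ι : A →ₐ[k] algebra hδ := (left k).codRestrict (algebra hδ) fun a =>
    ⟨Finsupp.single 0 a, by simp [eval_single]⟩
  let x : algebra hδ := ⟨X σ δ, Finsupp.single 1 1, by simp [eval_single]⟩
  have hev : ∀ f : ℕ →₀ A, ((f.sum fun n a => ι a * x ^ n : algebra hδ) :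
      Module.End k (ℕ →₀ A)) = evalOp σ δ f := by
    intro f
    simp only [Finsupp.sum, evalOp, Finsupp.coe_lsum]
    rw [AddSubmonoidClass.coe_finsetSum]
    rfl
  let _ : Ring (algebra hδ) := Algebra.semiringToRing k
  refine ⟨algebra hδ, inferInstance, (algebra hδ).algebra, ι, x, ⟨fun f g h => ?_, ?_⟩, fun a => ?_⟩
  · have h' : evalOp σ δ f = evalOp σ δ g := by rw [← hev f, ← hev g]; exact congrArg Subtype.val h
    rw [← eval_one hδ f, h', eval_one hδ g]
  · rintro ⟨_, f, rfl⟩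
    exact ⟨f, Subtype.ext (hev f)⟩
  · exact Subtype.ext (X_mul_left hδ a)

end OreExtensions

end

/-! Write `w = x u + c` below for a unit `u` and an element `c` of `A`. The multiplication map `E
⊗_A E → E` is onto, and its kernel is again an induced bimodule, `E ⊗_A E` with `A` acting on the
left factor through `σ`; the inclusion is right multiplication by `κ = x ⊗ 1 - 1 ⊗ x`
(`exact_kernelIncl`). Since `Eᵉ` is free over `Aᵉ` on both sides, a resolution of `A` extends along
`Aᵉ → Eᵉ` to resolutions of both induced bimodules. Smoothness of `E` follows, and the `Ext` groups
of an induced bimodule with values in `Eᵉ` live in degree `d`, where they are identified with finite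
sequences in `E`: the sequence `∑ eⱼ tʲ` stands for the dual generator times `∑ xʲ ⊗ eⱼ`.

The main point is the map induced by `κ` on these groups. A lift of the inclusion to the resolutions
has the form `x ⊗ 1 - (1 ⊗ x) P - W`, where `P` lifts `σ` semilinearly to the resolution of `A` and
`W` lifts the skew derivation `δ` (`map_mul_kernelMat`). Because `σ` is invertible, `P` acts on the
one-dimensional dual cohomology by a unit `u` (`IsDualGenerator.exists_unit`), and the remaining
terms contribute some `c ∈ A`. So the dual generator is multiplied by `x ⊗ 1 - 1 ⊗ w`
(`exists_kernelLift`), which on sequences is, up to sign, `e tʲ ↦ e w tʲ - e tʲ⁺¹`. This map is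
injective with cokernel `E`, by evaluation at `w` (`shiftSub_injective`, `exists_shiftSub`).

The long exact sequence therefore leaves only `Ext^(d+1)`, isomorphic to `E` as a left module
(`exists_extEquiv`). Its right structure is given by an endomorphism `ρ` with `ρ = ν σ⁻¹` on `A` and
`ρ(x) = w`. Conjugation by `u` turns `ρ` into `ν'`: the relation `x a = σ(a) x + δ(a)` forces `u ν
σ⁻¹(a) u⁻¹ = σ⁻¹ ν(a)`, and `ν'(x) = u x + u c u⁻¹`. A comparison of leading coefficients shows that
`ν'` is bijective. -/

noncomputable section

attribute [local instance] selfBimoduleStructure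

/-! ### Projective resolutions from exact complexes -/

namespace CategoryTheory.ProjectiveResolution

/-- An exact complex of projective objects augmented to `Z` is a projective resolution of `Z`. -/
def ofExact {C : Type u} [Category.{v} C] [Abelian C] {Z : C} (K : ChainComplex C ℕ)
    (hK : ∀ n, Projective (K.X n)) (p : K.X 0 ⟶ Z) (hp : Epi p) (hw : K.d 1 0 ≫ p = 0)
    (h₀ : (ShortComplex.mk _ _ hw).Exact) (h : ∀ n, K.ExactAt (n + 1)) :
    ProjectiveResolution Z where
  complex := K
  projective := hK
  π := (ChainComplex.toSingle₀Equiv _ _).symm ⟨p, hw⟩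
  quasiIso := ⟨fun n => by
    cases n
    · rw [ChainComplex.quasiIsoAt₀_iff, ShortComplex.quasiIso_iff_of_zeros']
      · refine (ShortComplex.exact_and_epi_g_iff_of_iso ?_).2 ⟨h₀, hp⟩
        exact ShortComplex.isoMk (Iso.refl _) (Iso.refl _) (Iso.refl _)
          ((Category.id_comp _).trans (Category.comp_id (K.d 1 0)).symm)
          ((Category.id_comp p).trans ((Category.comp_id _).trans
            (ChainComplex.toSingle₀Equiv_symm_apply_f_zero p hw)).symm)
      · exact K.shape _ _ (by simp)
      all_goals rfl
    · rw [quasiIsoAt_iff_exactAt']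
      · apply h
      · apply ChainComplex.exactAt_succ_single_obj⟩

lemma extMk_zero_eq_zero_iff {C : Type u} [Category.{v} C] [Abelian C] [HasExt.{w} C] {X Y : C}
    (R : ProjectiveResolution X) (f : R.complex.X 0 ⟶ Y) (m : ℕ) (hm : 0 + 1 = m)
    (hf : R.complex.d m 0 ≫ f = 0) : R.extMk f m hm hf = 0 ↔ f = 0 := by
  simp only [← R.extEquivCohomologyClass.apply_eq_iff_eq,
    extEquivCohomologyClass_extMk, extEquivCohomologyClass_zero,
    CochainComplex.HomComplex.CohomologyClass.mk_eq_zero_iff]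
  rw [CochainComplex.HomComplex.Cocycle.toSingleMk_mem_coboundaries_iff _ _ _ _ _ 1 (by simp)]
  -- The cochain complex lives in degrees `≤ 0`, so a coboundary in degree 0 factors through zero.
  have hz : Limits.IsZero (R.cochainComplex.X 1) :=
    R.complex.isZero_extend_X _ _ (by simp; omega)
  constructor
  · rintro ⟨g, hg⟩
    rw [hz.eq_of_src g 0, Limits.comp_zero] at hg
    rw [← cancel_epi (R.cochainComplexXIso (-(0 : ℕ)) 0 rfl).hom, ← hg, Limits.comp_zero]
  · rintro rfl
    exact ⟨0, by simp⟩

end CategoryTheory.ProjectiveResolution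

/-! ### Matrix resolutions and `Ext` as column vectors modulo coboundaries -/

/-- A resolution of a left module by finitely generated free modules, given by matrices acting on
row vectors from the right. -/
structure MatRes (R : Type u) [Ring R] (M : Type v) [AddCommGroup M] [Module R M] where
  /-- the rank of the free module in degree `n` -/
  rk : ℕ → ℕ
  /-- the differentials -/
  D : ∀ n, Matrix (Fin (rk (n + 1))) (Fin (rk n)) R
  /-- the images of the basis vectors under the augmentation -/
  ε : Fin (rk 0) → M
  ε_surj : Function.Surjective (Fintype.linearCombination R ε)
  D_ε : ∀ i, Fintype.linearCombination R ε (D 0 i) = 0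
  exact_zero : ∀ v, Fintype.linearCombination R ε v = 0 → ∃ w, Matrix.vecMul w (D 0) = v
  D_D : ∀ n, D (n + 1) * D n = 0
  exact_succ : ∀ n v, Matrix.vecMul v (D n) = 0 → ∃ w, Matrix.vecMul w (D (n + 1)) = v

namespace MatRes

section Defs

variable {R : Type u} [Ring R] {M : Type v} [AddCommGroup M] [Module R M] (Q : MatRes R M)

lemma linearCombination_vecMul {m n : ℕ} (A : Matrix (Fin m) (Fin n) R) (e : Fin n → M)
    (v : Fin m → R) : Fintype.linearCombination R e (Matrix.vecMul v A) =
      Fintype.linearCombination R (fun i => Fintype.linearCombination R e (A i)) v := by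
  simp only [Fintype.linearCombination_apply, Matrix.vecMul, dotProduct, Finset.sum_smul,
    Finset.smul_sum, smul_smul]
  exact Finset.sum_comm

lemma linearCombination_D_zero (v : Fin (Q.rk 1) → R) :
    Fintype.linearCombination R Q.ε (Matrix.vecMul v (Q.D 0)) = 0 := by
  rw [linearCombination_vecMul, funext Q.D_ε]
  simp [Fintype.linearCombination_apply]

lemma linearCombination_comp_vecMulLinear {m n : ℕ} (A : Matrix (Fin m) (Fin n) R) (e : Fin n → M) :
    Fintype.linearCombination R e ∘ₗ A.vecMulLinear =
      Fintype.linearCombination R fun i => Fintype.linearCombination R e (A i) :=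
  LinearMap.ext (linearCombination_vecMul A e)

lemma linearCombination_eq_dotProduct {n : ℕ} (y v : Fin n → R) :
    Fintype.linearCombination R y v = v ⬝ᵥ y := by
  simp [Fintype.linearCombination_apply, dotProduct]

lemma linearCombination_row {m n : ℕ} (A : Matrix (Fin m) (Fin n) R) (y : Fin n → R) :
    (fun i => Fintype.linearCombination R y (A i)) = A.mulVec y :=
  funext fun i => linearCombination_eq_dotProduct y (A i)

lemma linearCombination_add {n : ℕ} (y z : Fin n → M) :
    Fintype.linearCombination R (y + z) =
      Fintype.linearCombination R y + Fintype.linearCombination R z := by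
  ext
  simp

/-- The coboundaries of degree `n` of the dual complex. -/
def IsCob : ∀ n, (Fin (Q.rk n) → R) → Prop
  | 0, y => y = 0
  | n + 1, y => ∃ z, (Q.D n).mulVec z = y

/-- The cocycles of degree `n` of the dual complex. -/
def IsCoc (n : ℕ) (y : Fin (Q.rk n) → R) : Prop := (Q.D n).mulVec y = 0

end Defs

variable {R : Type v} [Ring R] {M N : ModuleCat.{v} R} (Q : MatRes R M) (Q' : MatRes R N)

/-- The complex of free modules attached to a matrix resolution. -/
def complex : ChainComplex (ModuleCat.{v} R) ℕ :=
  ChainComplex.of (fun n => ModuleCat.of R (Fin (Q.rk n) → R))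
    (fun n => ModuleCat.ofHom (Matrix.vecMulLinear (Q.D n))) fun n => by
      ext1
      refine LinearMap.ext fun v => ?_
      simp [Matrix.vecMul_vecMul, Q.D_D]

lemma complex_d (n : ℕ) :
    Q.complex.d (n + 1) n = ModuleCat.ofHom (Matrix.vecMulLinear (Q.D n)) :=
  ChainComplex.of_d (fun n => ModuleCat.of R (Fin (Q.rk n) → R))
    (fun n => ModuleCat.ofHom (Matrix.vecMulLinear (Q.D n))) n

/-- The augmentation. -/
def aug : Q.complex.X 0 ⟶ M := ModuleCat.ofHom (Fintype.linearCombination R Q.ε)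

/-- A matrix resolution as a projective resolution. -/
def toProjectiveResolution : ProjectiveResolution M :=
  ProjectiveResolution.ofExact Q.complex
    (fun n => ModuleCat.projective_of_free (Pi.basisFun R (Fin (Q.rk n))))
    Q.aug ((ModuleCat.epi_iff_surjective _).2 Q.ε_surj)
    (by
      rw [complex_d]
      ext1
      exact LinearMap.ext Q.linearCombination_D_zero)
    (by
      rw [ShortComplex.moduleCat_exact_iff]
      intro v hv
      obtain ⟨w, hw⟩ := Q.exact_zero v hv
      refine ⟨w, ?_⟩
      simp only [complex_d]
      exact hw)
    (fun n => by
      rw [HomologicalComplex.exactAt_iff' _ (n + 2) (n + 1) n (by simp) (by simp),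
        ShortComplex.moduleCat_exact_iff]
      intro v hv
      simp only [HomologicalComplex.sc', HomologicalComplex.shortComplexFunctor', complex_d]
        at hv
      obtain ⟨w, hw⟩ := Q.exact_succ n v hv
      refine ⟨w, ?_⟩
      simp only [HomologicalComplex.sc', HomologicalComplex.shortComplexFunctor', complex_d]
      exact hw)

/-- The linear form attached to a column vector. -/
def form {n : ℕ} (y : Fin (Q.rk n) → R) :
    Q.toProjectiveResolution.complex.X n ⟶ ModuleCat.of R R :=
  ModuleCat.ofHom (Fintype.linearCombination R y)

lemma d_comp_form {n : ℕ} (y : Fin (Q.rk n) → R) :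
    Q.toProjectiveResolution.complex.d (n + 1) n ≫ Q.form y = Q.form ((Q.D n).mulVec y) := by
  change Q.complex.d (n + 1) n ≫ _ = _
  rw [complex_d, ← linearCombination_row]
  exact congrArg ModuleCat.ofHom (linearCombination_comp_vecMulLinear (Q.D n) y)

lemma form_add {n : ℕ} (y z : Fin (Q.rk n) → R) : Q.form (y + z) = Q.form y + Q.form z := by
  exact congrArg ModuleCat.ofHom (linearCombination_add y z)

lemma form_injective {n : ℕ} : Function.Injective (Q.form (n := n)) := by
  intro y z h
  funext i
  have h' : Fintype.linearCombination R y (Pi.single i 1) =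
    Fintype.linearCombination R z (Pi.single i 1) := LinearMap.congr_fun
      (congrArg ModuleCat.Hom.hom h) (Pi.single i 1)
  simpa using h'

lemma form_zero {n : ℕ} : Q.form (0 : Fin (Q.rk n) → R) = 0 := by
  have h := Q.form_add (0 : Fin (Q.rk n) → R) 0
  simpa using h

lemma form_surjective {n : ℕ} : Function.Surjective (Q.form (n := n)) := by
  intro f
  let f' : (Fin (Q.rk n) → R) →ₗ[R] R := f.hom
  refine ⟨fun i => f' (Pi.single i 1), ?_⟩
  ext1
  change Fintype.linearCombination R (fun i => f' (Pi.single i 1)) = f'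
  refine (Pi.basisFun R (Fin (Q.rk n))).ext fun i => ?_
  simp

/-- The class in `Ext` of a cocycle. -/
def cls {n : ℕ} (y : Fin (Q.rk n) → R) (hy : Q.IsCoc n y) :
    Abelian.Ext M (ModuleCat.of R R) n :=
  Q.toProjectiveResolution.extMk (Q.form y) (n + 1) rfl
    ((Q.d_comp_form y).trans ((congrArg Q.form hy).trans Q.form_zero))

lemma cls_surjective {n : ℕ} (ξ : Abelian.Ext M (ModuleCat.of R R) n) :
    ∃ y hy, Q.cls (n := n) y hy = ξ := by
  obtain ⟨f, hf, rfl⟩ := Q.toProjectiveResolution.extMk_surjective ξ (n + 1) rfl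
  obtain ⟨y, rfl⟩ := Q.form_surjective f
  rw [d_comp_form, ← Q.form_zero] at hf
  exact ⟨y, Q.form_injective hf, rfl⟩

lemma IsCoc.add {Q : MatRes R M} {n : ℕ} {y z : Fin (Q.rk n) → R} (hy : Q.IsCoc n y)
    (hz : Q.IsCoc n z) : Q.IsCoc n (y + z) := by
  rw [IsCoc, Matrix.mulVec_add, hy, hz, add_zero]

lemma cls_add {n : ℕ} (y z : Fin (Q.rk n) → R) (hy : Q.IsCoc n y) (hz : Q.IsCoc n z) :
    Q.cls (y + z) (hy.add hz) = Q.cls y hy + Q.cls z hz := by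
  rw [cls, cls, cls, ProjectiveResolution.add_extMk]
  simp only [form_add]

/-- With `cls_surjective` and `cls_add`, this replaces `Ext` by matrix algebra. -/
lemma cls_eq_zero_iff {n : ℕ} (y : Fin (Q.rk n) → R) (hy : Q.IsCoc n y) :
    Q.cls y hy = 0 ↔ Q.IsCob n y := by
  rw [cls]
  cases n with
  | zero =>
    rw [ProjectiveResolution.extMk_zero_eq_zero_iff, ← Q.form_zero]
    exact Q.form_injective.eq_iff
  | succ n =>
    rw [ProjectiveResolution.extMk_eq_zero_iff _ _ _ _ _ n rfl]
    constructor
    · rintro ⟨g, hg⟩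
      obtain ⟨z, rfl⟩ := Q.form_surjective g
      rw [d_comp_form] at hg
      exact ⟨z, Q.form_injective hg⟩
    · rintro ⟨z, rfl⟩
      exact ⟨Q.form z, Q.d_comp_form z⟩

/-- Right multiplication of a column vector by a scalar. -/
def rmul {n : ℕ} (y : Fin n → R) (r : R) : Fin n → R := fun i => y i * r

lemma mulVec_rmul {m n : ℕ} (A : Matrix (Fin m) (Fin n) R) (y : Fin n → R) (r : R) :
    A.mulVec (rmul y r) = rmul (A.mulVec y) r := by
  funext i
  simp [rmul, Matrix.mulVec, dotProduct, Finset.sum_mul, mul_assoc]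

lemma IsCoc.rmul {Q : MatRes R M} {n : ℕ} {y : Fin (Q.rk n) → R} (hy : Q.IsCoc n y) (r : R) :
    Q.IsCoc n (rmul y r) := by
  rw [IsCoc, mulVec_rmul, hy]
  funext i
  simp [MatRes.rmul]

/-- The form that the inner bimodule action on `Ext` takes on cocycles. -/
lemma cls_rmul {n : ℕ} (y : Fin (Q.rk n) → R) (hy : Q.IsCoc n y) (r : R) :
    Q.cls (rmul y r) (hy.rmul r) = (Q.cls y hy).comp
      (Abelian.Ext.mk₀ (ModuleCat.ofHom (LinearMap.toSpanSingleton R R r))) (add_zero n) := by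
  rw [cls, cls, ProjectiveResolution.extMk_comp_mk₀]
  congr 1
  refine congrArg ModuleCat.ofHom (?_ : Fintype.linearCombination R (rmul y r) =
    LinearMap.toSpanSingleton R R r ∘ₗ Fintype.linearCombination R y)
  ext
  simp [rmul]

variable {Q Q'} in
/-- Matrices `H n` defining a morphism of complexes covering `f` compute the map induced by `f`. -/
lemma mk₀_comp_cls (f : M ⟶ N) (H : ∀ n, Matrix (Fin (Q.rk n)) (Fin (Q'.rk n)) R)
    (h₀ : ∀ i, Fintype.linearCombination R Q'.ε (H 0 i) = f.hom (Q.ε i))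
    (hH : ∀ n, Q.D n * H n = H (n + 1) * Q'.D n) {n : ℕ} (y : Fin (Q'.rk n) → R)
    (hy : Q'.IsCoc n y) (hy' : Q.IsCoc n ((H n).mulVec y)) :
    (Abelian.Ext.mk₀ f).comp (Q'.cls y hy) (zero_add n) = Q.cls ((H n).mulVec y) hy' := by
  let φ : Q.complex ⟶ Q'.complex := ChainComplex.ofHom
    (fun n => ModuleCat.ofHom (Matrix.vecMulLinear (H n))) fun n => by
      rw [complex_d, complex_d]
      refine congrArg ModuleCat.ofHom (?_ : (Q'.D n).vecMulLinear ∘ₗ (H (n + 1)).vecMulLinear =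
        (H n).vecMulLinear ∘ₗ (Q.D n).vecMulLinear)
      refine LinearMap.ext fun v => ?_
      simp only [LinearMap.comp_apply, Matrix.vecMulLinear_apply, Matrix.vecMul_vecMul, hH]
  let Φ : ProjectiveResolution.Hom Q.toProjectiveResolution Q'.toProjectiveResolution f :=
    { hom := φ
      hom_f_zero_comp_π_f_zero := by
        refine congrArg ModuleCat.ofHom (?_ : Fintype.linearCombination R Q'.ε ∘ₗ
          (H 0).vecMulLinear = f.hom ∘ₗ Fintype.linearCombination R Q.ε)
        rw [linearCombination_comp_vecMulLinear, funext h₀]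
        ext
        simp }
  rw [cls, cls, ProjectiveResolution.mk₀_comp_extMk _ _ _ _ Φ]
  congr 1
  rw [← linearCombination_row]
  exact congrArg ModuleCat.ofHom (linearCombination_comp_vecMulLinear (H n) y)

end MatRes

/-! ### Modules with finite resolutions by finitely generated projectives -/

/-- `M` has a resolution of length at most `n` by finitely generated projective modules. -/
def FinRes (R : Type v) [Ring R] : ℕ → ∀ (M : Type v) [AddCommGroup M] [Module R M], Prop
  | 0, M, _, _ => Module.Finite R M ∧ Module.Projective R M
  | n + 1, M, _, _ => ∃ (P : Type v) (_ : AddCommGroup P) (_ : Module R P) (f : P →ₗ[R] M),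
      Module.Finite R P ∧ Module.Projective R P ∧ Function.Surjective f ∧
        FinRes R n (LinearMap.ker f)

namespace FinRes

variable {R : Type v} [Ring R] {K L M : Type v} [AddCommGroup K] [Module R K] [AddCommGroup L]
  [Module R L] [AddCommGroup M] [Module R M]

lemma of_equiv {n : ℕ} (e : L ≃ₗ[R] M) (h : FinRes R n L) : FinRes R n M := by
  cases n with
  | zero =>
    obtain ⟨_, _⟩ := h
    exact ⟨Module.Finite.equiv e, Module.Projective.of_equiv e⟩
  | succ n =>
    obtain ⟨P, _, _, f, h₁, h₂, h₃, h₄⟩ := h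
    refine ⟨P, _, _, e.toLinearMap ∘ₗ f, h₁, h₂, e.surjective.comp h₃, ?_⟩
    rwa [LinearEquiv.ker_comp]

lemma of_subsingleton [Subsingleton M] : FinRes R 0 M :=
  ⟨inferInstance, inferInstance⟩

lemma succ {n : ℕ} : ∀ {M : Type v} [AddCommGroup M] [Module R M], FinRes R n M →
    FinRes R (n + 1) M := by
  induction n with
  | zero =>
    intro M _ _ h
    refine ⟨M, _, _, LinearMap.id, h.1, h.2, Function.surjective_id, ?_⟩
    rw [LinearMap.ker_id]
    exact of_subsingleton
  | succ n ih =>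
    rintro M _ _ ⟨P, _, _, f, h₁, h₂, h₃, h₄⟩
    exact ⟨P, _, _, f, h₁, h₂, h₃, ih h₄⟩

lemma mono {m n : ℕ} (hmn : m ≤ n) (h : FinRes R m M) : FinRes R n M := by
  induction hmn with
  | refl => exact h
  | step _ ih => exact ih.succ

/-- Extensions. -/
lemma extension {n : ℕ} : ∀ {K L M : Type v} [AddCommGroup K] [Module R K] [AddCommGroup L]
    [Module R L] [AddCommGroup M] [Module R M] (i : K →ₗ[R] L) (p : L →ₗ[R] M),
    Function.Injective i → Function.Surjective p → Function.Exact i p → FinRes R n K →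
    FinRes R n M → FinRes R n L := by
  induction n with
  | zero =>
    rintro K L M _ _ _ _ _ _ i p hi hp he ⟨_, _⟩ ⟨_, _⟩
    obtain ⟨s, hs⟩ := Module.projective_lifting_property p LinearMap.id hp
    have hs' : ∀ m, p (s m) = m := fun m => LinearMap.congr_fun hs m
    have hb : Function.Bijective (LinearMap.coprod i s) := by
      constructor
      · rw [← LinearMap.ker_eq_bot, LinearMap.ker_eq_bot']
        rintro ⟨k, m⟩ h
        have hm : m = 0 := by
          have := congrArg p h
          simpa [he.apply_apply_eq_zero, hs'] using this
        subst hm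
        have hk : i k = i 0 := by simpa using h
        rw [hi hk]
        rfl
      · intro l
        obtain ⟨k, hk⟩ := (he (l - s (p l))).1 (by simp [hs'])
        exact ⟨(k, p l), by simp [hk]⟩
    exact of_equiv (n := 0) (LinearEquiv.ofBijective _ hb) ⟨inferInstance, inferInstance⟩
  | succ n ih =>
    rintro K L M _ _ _ _ _ _ i p hi hp he ⟨P, _, _, f, _, _, h₃, h₄⟩ ⟨Q, _, _, g, _, _, h₅, h₆⟩
    obtain ⟨s, hs⟩ := Module.projective_lifting_property p g hp
    have hs' : ∀ m, p (s m) = g m := fun m => LinearMap.congr_fun hs m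
    refine ⟨P × Q, _, _, LinearMap.coprod (i ∘ₗ f) s, inferInstance, inferInstance, ?_, ?_⟩
    · intro l
      obtain ⟨q, hq⟩ := h₅ (p l)
      obtain ⟨k, hk⟩ := (he (l - s q)).1 (by simp [hs', hq])
      obtain ⟨x, rfl⟩ := h₃ k
      exact ⟨(x, q), by simp [hk]⟩
    -- Horseshoe lemma: the kernel of the cover `P × Q → L` is an extension of `ker g` by `ker f`.
    · refine ih (((LinearMap.inl R P Q) ∘ₗ (LinearMap.ker f).subtype).codRestrict _ ?_)
        (((LinearMap.snd R P Q) ∘ₗ (LinearMap.ker _).subtype).codRestrict (LinearMap.ker g) ?_)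
        ?_ ?_ ?_ h₄ h₆
      · rintro ⟨x, hx⟩
        simp [LinearMap.mem_ker.1 hx]
      · rintro ⟨⟨x, y⟩, hx⟩
        have := congrArg p (LinearMap.mem_ker.1 hx)
        simpa [he.apply_apply_eq_zero, hs'] using this
      · rintro ⟨x, hx⟩ ⟨y, hy⟩ h
        simpa [Subtype.ext_iff] using h
      · rintro ⟨y, hy⟩
        obtain ⟨k, hk⟩ := (he (-s y)).1 (by simp [hs', LinearMap.mem_ker.1 hy])
        obtain ⟨x, rfl⟩ := h₃ k
        exact ⟨⟨(x, y), by simp [hk]⟩, rfl⟩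
      · rintro ⟨⟨x, y⟩, hx⟩
        constructor
        · intro h
          obtain rfl : y = 0 := congrArg Subtype.val h
          refine ⟨⟨x, ?_⟩, rfl⟩
          apply hi
          simpa using hx
        · rintro ⟨z, hz⟩
          refine Subtype.ext ?_
          simpa using (congrArg (fun t => (Subtype.val t).2) hz).symm

lemma ker_of_exact {n : ℕ} {P Q : Type v} [AddCommGroup P] [Module R P] [AddCommGroup Q]
    [Module R Q] [Module.Finite R P] [Module.Projective R P] (f : P →ₗ[R] L) (g : L →ₗ[R] Q)
    (h : Function.Exact f g) (hf : FinRes R n (LinearMap.ker f)) :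
    FinRes R (n + 1) (LinearMap.ker g) := by
  refine ⟨P, _, _, f.codRestrict (LinearMap.ker g) fun x =>
    LinearMap.mem_ker.2 (h.apply_apply_eq_zero x), ‹_›, ‹_›, ?_, ?_⟩
  · rintro ⟨y, hy⟩
    obtain ⟨x, rfl⟩ := (h y).1 hy
    exact ⟨x, rfl⟩
  · rwa [LinearMap.ker_codRestrict]

/-- Cokernels. -/
lemma cokernel {n : ℕ} (i : K →ₗ[R] L) (p : L →ₗ[R] M) (hi : Function.Injective i)
    (hp : Function.Surjective p) (he : Function.Exact i p) (hK : FinRes R n K)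
    (hL : FinRes R n L) : FinRes R (n + 1) M := by
  cases n with
  | zero =>
    refine ⟨L, _, _, p, hL.1, hL.2, hp, hK.of_equiv (LinearEquiv.ofBijective
      (i.codRestrict (LinearMap.ker p) fun x => LinearMap.mem_ker.2 (he.apply_apply_eq_zero x))
      ⟨fun x y h => hi (congrArg Subtype.val h), ?_⟩)⟩
    · rintro ⟨y, hy⟩
      obtain ⟨x, rfl⟩ := (he y).1 hy
      exact ⟨x, rfl⟩
  | succ n =>
    obtain ⟨P, _, _, f, h₁, h₂, h₃, h₄⟩ := hL
    refine ⟨P, _, _, p ∘ₗ f, h₁, h₂, hp.comp h₃, ?_⟩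
    let e : K ≃ₗ[R] LinearMap.range i := LinearEquiv.ofInjective i hi
    have hmem : ∀ x : LinearMap.ker (p ∘ₗ f), f x.1 ∈ LinearMap.range i := fun x =>
      (he (f x.1)).1 x.2
    -- `f` maps `ker (p ∘ f)` onto the image of `i`, a copy of `K`, with kernel `ker f`.
    refine extension (Submodule.inclusion (LinearMap.ker_le_ker_comp f p))
      (e.symm.toLinearMap ∘ₗ (f ∘ₗ Submodule.subtype _).codRestrict _ hmem)
      (Submodule.inclusion_injective _) ?_ ?_ h₄.succ hK
    · refine e.symm.surjective.comp ?_
      rintro ⟨_, k, rfl⟩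
      obtain ⟨x, hx⟩ := h₃ (i k)
      refine ⟨⟨x, ?_⟩, Subtype.ext hx⟩
      rw [LinearMap.mem_ker, LinearMap.comp_apply, hx]
      exact he.apply_apply_eq_zero k
    · rintro ⟨x, hx⟩
      have h : (e.symm.toLinearMap ∘ₗ (f ∘ₗ Submodule.subtype _).codRestrict _ hmem) ⟨x, hx⟩ = 0 ↔
          f x = 0 := by
        rw [LinearMap.comp_apply, LinearEquiv.coe_coe, LinearEquiv.map_eq_zero_iff, Subtype.ext_iff]
        rfl
      rw [h]
      constructor
      · intro hx'
        exact ⟨⟨x, hx'⟩, rfl⟩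
      · rintro ⟨y, hy⟩
        obtain rfl : y.1 = x := congrArg Subtype.val hy
        exact y.2

/-- The map `id - s ∘ f` retracts `L` onto the kernel, which is thus a direct summand. -/
lemma ker_of_split {P : Type v} [AddCommGroup P] [Module R P] [Module.Finite R L]
    [Module.Projective R L] (f : L →ₗ[R] P) (s : P →ₗ[R] L) (h : ∀ x, f (s x) = x) :
    FinRes R 0 (LinearMap.ker f) := by
  let r : L →ₗ[R] LinearMap.ker f := (LinearMap.id - s ∘ₗ f).codRestrict _ fun x => by simp [h]
  have hr : r ∘ₗ (LinearMap.ker f).subtype = LinearMap.id := by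
    ext ⟨x, hx⟩
    simp [r, LinearMap.mem_ker.1 hx]
  exact ⟨Module.Finite.of_surjective r fun x => ⟨x.1, LinearMap.congr_fun hr x⟩,
    Module.Projective.of_split _ r hr⟩

/-- The covering module can be chosen free. -/
lemma exists_free {n : ℕ} (h : FinRes R (n + 1) M) : ∃ (m : ℕ) (f : (Fin m → R) →ₗ[R] M),
    Function.Surjective f ∧ FinRes R n (LinearMap.ker f) := by
  obtain ⟨P, _, _, f, _, _, h₃, h₄⟩ := h
  obtain ⟨m, g, hg⟩ := Module.Finite.exists_fin' R P
  obtain ⟨s, hs⟩ := Module.projective_lifting_property g LinearMap.id hg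
  have hs' : ∀ m, g (s m) = m := fun m => LinearMap.congr_fun hs m
  refine ⟨m, f ∘ₗ g, h₃.comp hg, ?_⟩
  -- The kernel of `f ∘ g` is an extension of `ker f` by `ker g`, and `ker g` is projective because
  -- `g` splits.
  refine extension (Submodule.inclusion (LinearMap.ker_le_ker_comp g f))
    ((g ∘ₗ Submodule.subtype _).codRestrict (LinearMap.ker f) fun x => x.2)
    (Submodule.inclusion_injective _) ?_ ?_ ((ker_of_split g s hs').mono (Nat.zero_le n)) h₄
  · rintro ⟨x, hx⟩
    exact ⟨⟨s x, by simpa [hs'] using hx⟩, Subtype.ext (hs' x)⟩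
  · rintro ⟨x, hx⟩
    constructor
    · intro h
      exact ⟨⟨x, congrArg Subtype.val h⟩, rfl⟩
    · rintro ⟨y, hy⟩
      refine Subtype.ext ?_
      rw [← hy]
      exact y.2

end FinRes

/-! ### Passage between finite projective resolutions and matrix resolutions -/

namespace MatRes

section Splice

variable {R : Type u} [Ring R] {M : Type v} [AddCommGroup M] [Module R M]

/-- The image of the `N`-th differential is projective: there is an idempotent matrix with the same
kernel. -/
def IsFiniteAt (Q : MatRes R M) (N : ℕ) : Prop :=
  ∃ e : Matrix (Fin (Q.rk (N + 1))) (Fin (Q.rk (N + 1))) R,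
    e * Q.D N = Q.D N ∧ Q.D (N + 1) * e = 0

/-- The matrix of a linear map between free left modules. -/
def toMat {m n : ℕ} (f : (Fin m → R) →ₗ[R] (Fin n → R)) : Matrix (Fin m) (Fin n) R :=
  Matrix.of fun i => f (Pi.single i 1)

@[simp]
lemma toMat_apply {m n : ℕ} (f : (Fin m → R) →ₗ[R] (Fin n → R)) (i : Fin m) :
    toMat f i = f (Pi.single i 1) := rfl

lemma vecMulLinear_toMat {m n : ℕ} (f : (Fin m → R) →ₗ[R] (Fin n → R)) :
    (toMat f).vecMulLinear = f := by
  refine (Pi.basisFun R (Fin m)).ext fun i => ?_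
  simp [Matrix.row]

lemma vecMul_toMat {m n : ℕ} (f : (Fin m → R) →ₗ[R] (Fin n → R)) (v : Fin m → R) :
    Matrix.vecMul v (toMat f) = f v :=
  LinearMap.congr_fun (vecMulLinear_toMat f) v

lemma toMat_comp {l m n : ℕ} (g : (Fin m → R) →ₗ[R] (Fin n → R))
    (f : (Fin l → R) →ₗ[R] (Fin m → R)) : toMat f * toMat g = toMat (g ∘ₗ f) := by
  ext i j
  exact congrFun (vecMul_toMat g (f (Pi.single i 1))) j

lemma linearCombination_single {m : ℕ} (f : (Fin m → R) →ₗ[R] M) :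
    (Fintype.linearCombination R fun i => f (Pi.single i 1)) = f := by
  ext i
  simp

/-- Splicing a resolution of the kernel of a map from a free module. -/
def splice {m : ℕ} (f : (Fin m → R) →ₗ[R] M) (hf : Function.Surjective f)
    (Q : MatRes R (LinearMap.ker f)) : MatRes R M where
  rk := fun | 0 => m | n + 1 => Q.rk n
  D := fun | 0 => Matrix.of fun i => (Q.ε i).1 | n + 1 => Q.D n
  ε := fun i => f (Pi.single i 1)
  ε_surj := by
    rw [linearCombination_single]
    exact hf
  D_ε := fun i => by
    rw [linearCombination_single]
    exact (Q.ε i).2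
  exact_zero := by
    rw [linearCombination_single]
    intro v hv
    obtain ⟨w, hw⟩ := Q.ε_surj ⟨v, hv⟩
    refine ⟨w, ?_⟩
    rw [Subtype.ext_iff] at hw
    refine Eq.trans ?_ hw
    ext j
    simp [Matrix.vecMul, dotProduct, Fintype.linearCombination_apply]
  D_D := fun
    | 0 => by
      ext i j
      have := congrFun (congrArg Subtype.val (Q.D_ε i)) j
      simpa [Matrix.mul_apply, Fintype.linearCombination_apply] using this
    | n + 1 => Q.D_D n
  exact_succ := fun
    | 0 => fun v hv => Q.exact_zero v (by
        refine Subtype.ext (funext fun j => Eq.trans ?_ (congrFun hv j))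
        simp [Matrix.vecMul, dotProduct, Fintype.linearCombination_apply])
    | n + 1 => Q.exact_succ n

/-- The resolution of the first syzygy. -/
def tail (Q : MatRes R M) : MatRes R (LinearMap.ker (Fintype.linearCombination R Q.ε)) where
  rk n := Q.rk (n + 1)
  D n := Q.D (n + 1)
  ε i := ⟨Q.D 0 i, Q.D_ε i⟩
  ε_surj := by
    rintro ⟨v, hv⟩
    obtain ⟨w, hw⟩ := Q.exact_zero v hv
    refine ⟨w, Subtype.ext (Eq.trans ?_ hw)⟩
    ext j
    simp [Matrix.vecMul, dotProduct, Fintype.linearCombination_apply]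
  D_ε i := by
    refine Subtype.ext (funext fun j => Eq.trans ?_ (congrFun (congrFun (Q.D_D 0) i) j))
    simp [Matrix.mul_apply, Fintype.linearCombination_apply]
  exact_zero v hv := Q.exact_succ 0 v (by
    refine Eq.trans ?_ (congrArg Subtype.val hv)
    ext j
    simp [Matrix.vecMul, dotProduct, Fintype.linearCombination_apply])
  D_D n := Q.D_D (n + 1)
  exact_succ n := Q.exact_succ (n + 1)

/-- The augmentation of the resolution of the first syzygy. -/
def tailAug (Q : MatRes R M) :
    (Fin (Q.rk 1) → R) →ₗ[R] LinearMap.ker (Fintype.linearCombination R Q.ε) :=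
  Fintype.linearCombination R fun i => ⟨Q.D 0 i, Q.D_ε i⟩

lemma coe_tailAug (Q : MatRes R M) (v : Fin (Q.rk 1) → R) :
    (Q.tailAug v).1 = Matrix.vecMul v (Q.D 0) := by
  ext j
  simp [Matrix.vecMul, dotProduct, Fintype.linearCombination_apply, tailAug]

/-- The periodic resolution of a direct summand of a free module. -/
def ofSplit {m : ℕ} (f : (Fin m → R) →ₗ[R] M) (s : M →ₗ[R] (Fin m → R)) (h : ∀ x, f (s x) = x) :
    MatRes R M where
  rk _ := m
  -- Complementary idempotents: the image of each is the kernel of the other, and `id - s ∘ f` has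
  -- image `ker f`.
  D n := if Even n then toMat (LinearMap.id - s ∘ₗ f) else toMat (s ∘ₗ f)
  ε := fun i => f (Pi.single i 1)
  ε_surj := by
    rw [linearCombination_single]
    exact fun x => ⟨s x, h x⟩
  D_ε := fun i => by
    rw [linearCombination_single]
    simp [h]
  exact_zero := by
    rw [linearCombination_single]
    intro v hv
    exact ⟨v, by simp [vecMul_toMat, hv]⟩
  D_D := fun n => by
    by_cases hn : Even n
    · rw [if_pos hn, if_neg (by simpa [Nat.even_add_one] using hn), toMat_comp]
      ext i j
      simp [toMat, h]
    · rw [if_neg hn, if_pos (by simpa [Nat.even_add_one] using hn), toMat_comp]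
      ext i j
      simp [toMat, h]
  exact_succ := fun n v => by
    by_cases hn : Even n
    · rw [if_pos hn, if_neg (by simpa [Nat.even_add_one] using hn)]
      simp only [vecMul_toMat]
      exact fun hv => ⟨v, (sub_eq_zero.1 hv).symm⟩
    · rw [if_neg hn, if_pos (by simpa [Nat.even_add_one] using hn)]
      simp only [vecMul_toMat]
      intro hv
      refine ⟨v, ?_⟩
      rw [LinearMap.sub_apply, hv, sub_zero, LinearMap.id_apply]

lemma isFiniteAt_ofSplit {m : ℕ} (f : (Fin m → R) →ₗ[R] M) (s : M →ₗ[R] (Fin m → R))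
    (h : ∀ x, f (s x) = x) : (ofSplit f s h).IsFiniteAt 0 := by
  have h₁ : toMat (LinearMap.id - s ∘ₗ f) * toMat (LinearMap.id - s ∘ₗ f) =
      toMat (LinearMap.id - s ∘ₗ f) := by
    rw [toMat_comp]
    congr 1
    ext
    simp [h]
  have h₂ : toMat (s ∘ₗ f) * toMat (LinearMap.id - s ∘ₗ f) = 0 := by
    rw [toMat_comp]
    ext i j
    simp [toMat, h]
  exact ⟨_, h₁, h₂⟩

end Splice

variable {R : Type v} [Ring R]

/-- Free modules replace projective ones at the price of an infinite periodic tail; the idempotent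
of `IsFiniteAt` remembers where the resolution could stop. -/
lemma exists_of_finRes {n : ℕ} : ∀ {M : Type v} [AddCommGroup M] [Module R M], FinRes R n M →
    ∃ (Q : MatRes R M) (N : ℕ), Q.IsFiniteAt N := by
  induction n with
  | zero =>
    rintro M _ _ ⟨_, _⟩
    obtain ⟨m, g, hg⟩ := Module.Finite.exists_fin' R M
    obtain ⟨s, hs⟩ := Module.projective_lifting_property g LinearMap.id hg
    exact ⟨_, 0, isFiniteAt_ofSplit g s fun m => LinearMap.congr_fun hs m⟩
  | succ n ih =>
    intro M _ _ h
    obtain ⟨m, f, hf, hk⟩ := h.exists_free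
    obtain ⟨Q, N, hQ⟩ := ih hk
    exact ⟨splice f hf Q, N + 1, hQ⟩

lemma finRes_of_isFiniteAt {N : ℕ} : ∀ {M : Type v} [AddCommGroup M] [Module R M]
    (Q : MatRes R M), Q.IsFiniteAt N → FinRes R (N + 1) M := by
  induction N with
  | zero =>
    rintro M _ _ Q ⟨e, he, he'⟩
    refine ⟨_, _, _, Fintype.linearCombination R Q.ε, inferInstance, inferInstance, Q.ε_surj, ?_⟩
    let g := Q.tailAug
    have hg : Function.Surjective g := Q.tail.ε_surj
    -- The kernel of `g` is the row space of `D 1`, which `e` annihilates; so `e` descends to the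
    -- syzygy, where `e * D 0 = D 0` makes it a section of `g`.
    have hker : LinearMap.ker g ≤ LinearMap.ker e.vecMulLinear := by
      intro v hv
      obtain ⟨w, hw⟩ : ∃ w, Matrix.vecMul w (Q.D 1) = v := Q.tail.exact_zero v hv
      rw [LinearMap.mem_ker, Matrix.vecMulLinear_apply, ← hw, Matrix.vecMul_vecMul]
      exact (congrArg (Matrix.vecMul w) he').trans (Matrix.vecMul_zero w)
    let s := (LinearMap.ker g).liftQ e.vecMulLinear hker ∘ₗ
      (g.quotKerEquivOfSurjective hg).symm.toLinearMap
    have hs : ∀ v, s (g v) = Matrix.vecMul v e := fun v => by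
      have : (g.quotKerEquivOfSurjective hg).symm (g v) = (LinearMap.ker g).mkQ v := by
        rw [LinearEquiv.symm_apply_eq]
        rfl
      simp only [s, LinearMap.comp_apply, LinearEquiv.coe_coe, this]
      exact (LinearMap.ker g).liftQ_apply _ v
    have hgs : g ∘ₗ s = LinearMap.id := by
      refine LinearMap.ext fun x => ?_
      obtain ⟨v, rfl⟩ := hg x
      rw [LinearMap.comp_apply, hs]
      refine Subtype.ext ?_
      change (Q.tailAug _).1 = (Q.tailAug _).1
      rw [coe_tailAug, coe_tailAug, Matrix.vecMul_vecMul, he]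
    exact ⟨Module.Finite.of_surjective g hg, Module.Projective.of_split s g hgs⟩
  | succ N ih =>
    intro M _ _ Q hQ
    exact ⟨_, _, _, Fintype.linearCombination R Q.ε, inferInstance, inferInstance, Q.ε_surj,
      ih Q.tail hQ⟩

end MatRes

/-! ### Comparison with projective resolutions in the module category -/

section Smooth

variable {R : Type v} [Ring R]

/-- `M` has a finite resolution by finitely generated projective objects. -/
def HasFiniteProjectiveResolution (M : ModuleCat.{v} R) : Prop :=
  ∃ P : ProjectiveResolution M, (∀ n, Module.Finite R (P.complex.X n)) ∧
    ∃ N : ℕ, ∀ n, N < n → Limits.IsZero (P.complex.X n)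

/-- The kernels of the differentials vanish in high degree, and each kernel is covered by the next
projective with the next kernel as syzygy. The augmentation and `d 1 0` account for the `2` in the
length `N + 2`. -/
lemma HasFiniteProjectiveResolution.finRes {M : ModuleCat.{v} R}
    (h : HasFiniteProjectiveResolution M) : ∃ n, FinRes R n M := by
  obtain ⟨P, hfin, N, hN⟩ := h
  have hproj : ∀ n, Module.Projective R (P.complex.X n) := fun n =>
    (IsProjective.iff_projective _).2 (P.projective n)
  have hex : ∀ j, Function.Exact (P.complex.d (j + 2) (j + 1)).hom (P.complex.d (j + 1) j).hom :=
    fun j => (ShortComplex.ShortExact.moduleCat_exact_iff_function_exact _).1 (P.exact_succ j)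
  have key : ∀ i j, N ≤ j + i → FinRes R i (LinearMap.ker (P.complex.d (j + 1) j).hom) := by
    intro i
    induction i with
    | zero =>
      intro j hj
      have := ModuleCat.subsingleton_of_isZero (hN (j + 1) (by omega))
      exact FinRes.of_subsingleton
    | succ i ih =>
      intro j hj
      exact FinRes.ker_of_exact _ _ (hex j) (ih (j + 1) (by omega))
  refine ⟨N + 2, P.complex.X 0, _, _, (P.π.f 0).hom, hfin 0, hproj 0, ?_, ?_⟩
  · exact (ModuleCat.epi_iff_surjective (P.π.f 0)).1 inferInstance
  · exact FinRes.ker_of_exact _ _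
      ((ShortComplex.ShortExact.moduleCat_exact_iff_function_exact _).1 P.exact₀)
      (key N 0 (by omega))

lemma FinRes.hasFiniteProjectiveResolution {n : ℕ} : ∀ {M : Type v} [AddCommGroup M] [Module R M],
    FinRes R n M → HasFiniteProjectiveResolution (ModuleCat.of R M) := by
  induction n with
  | zero =>
    rintro M _ _ ⟨h₁, h₂⟩
    have : Projective (ModuleCat.of R M) := (IsProjective.iff_projective M).1 h₂
    refine ⟨ProjectiveResolution.self _, fun n => ?_, 0, fun n hn => ?_⟩
    · cases n with
      | zero => exact h₁
      | succ n =>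
        have := ModuleCat.subsingleton_of_isZero
          (HomologicalComplex.isZero_single_obj_X (ComplexShape.down ℕ) 0 (ModuleCat.of R M)
            (n + 1) (by simp))
        change Module.Finite R (((ChainComplex.single₀ _).obj (ModuleCat.of R M)).X (n + 1))
        infer_instance
    · exact HomologicalComplex.isZero_single_obj_X (ComplexShape.down ℕ) 0 _ n (by omega)
  | succ n ih =>
    rintro M _ _ ⟨P, _, _, f, h₁, h₂, h₃, h₄⟩
    obtain ⟨K, hfin, N, hN⟩ := ih h₄
    let ι : ModuleCat.of R (LinearMap.ker f) ⟶ ModuleCat.of R P :=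
      ModuleCat.ofHom (LinearMap.ker f).subtype
    have : Mono ι := (ModuleCat.mono_iff_injective ι).2 Subtype.val_injective
    let p : K.complex.X 0 ⟶ ModuleCat.of R (LinearMap.ker f) := K.π.f 0
    have hw : K.complex.d 1 0 ≫ p ≫ ι = 0 := by
      rw [← Category.assoc, show K.complex.d 1 0 ≫ p = 0 from K.complex_d_comp_π_f_zero,
        Limits.zero_comp]
    let C := K.complex.augment (p ≫ ι) hw
    have hp : Epi (ModuleCat.ofHom f) := (ModuleCat.epi_iff_surjective _).2 h₃
    have hzero : (p ≫ ι) ≫ ModuleCat.ofHom f = 0 := by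
      rw [Category.assoc]
      have : ι ≫ ModuleCat.ofHom f = 0 := by
        ext x
        exact x.2
      rw [this, Limits.comp_zero]
    refine ⟨ProjectiveResolution.ofExact C ?_ (ModuleCat.ofHom f) hp hzero ?_ ?_, ?_, N + 1, ?_⟩
    · intro i
      cases i with
      | zero => exact (IsProjective.iff_projective P).1 h₂
      | succ i => exact K.projective i
    · rw [ShortComplex.moduleCat_exact_iff]
      intro x hx
      obtain ⟨y, hy⟩ := (ModuleCat.epi_iff_surjective (K.π.f 0)).1 inferInstance ⟨x, hx⟩
      exact ⟨y, congrArg Subtype.val hy⟩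
    · intro i
      rw [HomologicalComplex.exactAt_iff' _ (i + 2) (i + 1) i (by simp) (by simp)]
      cases i with
      | zero =>
        have := K.exact₀
        rw [ShortComplex.moduleCat_exact_iff] at this ⊢
        intro x hx
        exact this x (Subtype.ext hx)
      | succ i => exact K.exact_succ i
    · intro i
      cases i with
      | zero => exact h₁
      | succ i => exact hfin i
    · intro i hi
      cases i with
      | zero => omega
      | succ i => exact hN i (by omega)

end Smooth

/-! ### Decompositions into copies of one group, and componentwise exactness -/

section Decomposition

variable {ι : Type*} {M N P M' N' P' : Type*} [AddCommGroup M] [AddCommGroup N] [AddCommGroup P]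
  [AddCommGroup M'] [AddCommGroup N'] [AddCommGroup P']

/-- The additive maps `α j : M → M'` exhibit `M'` as a direct sum of copies of `M`. -/
def IsDec (α : ι → M →+ M') : Prop := Function.Bijective (Finsupp.liftAddHom α)

namespace IsDec

lemma map_liftAddHom {α : ι → M →+ M'} {β : ι → N →+ N'} (f : M →+ N) (f' : M' →+ N')
    (h : ∀ j m, f' (α j m) = β j (f m)) (n : ι →₀ M) :
    f' (Finsupp.liftAddHom α n) = Finsupp.liftAddHom β (Finsupp.mapRange.addMonoidHom f n) := by
  induction n using Finsupp.induction_linear with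
  | zero => simp
  | add x y hx hy => simp only [map_add, hx, hy]
  | single j m => simp [h]

lemma exists_of_ker {α : ι → M →+ M'} {β : ι → N →+ N'} (hα : IsDec α) (hβ : IsDec β)
    (f : M →+ N) (f' : M' →+ N') (h : ∀ j m, f' (α j m) = β j (f m)) {v : M'} (hv : f' v = 0) :
    ∃ n : ι →₀ M, (∀ j, f (n j) = 0) ∧ Finsupp.liftAddHom α n = v := by
  obtain ⟨n, rfl⟩ := hα.2 v
  rw [map_liftAddHom f f' h] at hv
  have h' := hβ.1 (hv.trans (map_zero _).symm)
  exact ⟨n, fun j => by simpa using DFunLike.congr_fun h' j, rfl⟩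

/-- Maps compatible with the decompositions act component by component, so preimages may be chosen
on the finite support and added up. -/
lemma exact {α : ι → M →+ M'} {β : ι → N →+ N'} {γ : ι → P →+ P'} (hβ : IsDec β) (hγ : IsDec γ)
    (f : M →+ N) (f' : M' →+ N') (h : ∀ j m, f' (α j m) = β j (f m))
    (g : N →+ P) (g' : N' →+ P') (h' : ∀ j m, g' (β j m) = γ j (g m))
    (hfg : ∀ y, g y = 0 → ∃ x, f x = y) (v : N') (hv : g' v = 0) : ∃ u, f' u = v := by
  obtain ⟨n, hn, rfl⟩ := exists_of_ker hβ hγ g g' h' hv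
  choose m hm using fun j => hfg (n j) (hn j)
  refine ⟨∑ j ∈ n.support, α j (m j), ?_⟩
  simp [h, hm, Finsupp.liftAddHom_apply, Finsupp.sum]

lemma surjective {α : ι → M →+ M'} {β : ι → N →+ N'} (hβ : IsDec β)
    (f : M →+ N) (f' : M' →+ N') (h : ∀ j m, f' (α j m) = β j (f m))
    (hf : Function.Surjective f) : Function.Surjective f' := by
  intro v
  obtain ⟨n, rfl⟩ := hβ.2 v
  choose m hm using fun j => hf (n j)
  refine ⟨∑ j ∈ n.support, α j (m j), ?_⟩
  simp [h, hm, Finsupp.liftAddHom_apply, Finsupp.sum]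

lemma mem_range {α : ι → M →+ M'} {β : ι → N →+ N'} (hα : IsDec α) (hβ : IsDec β)
    (f : M →+ N) (f' : M' →+ N') (h : ∀ j m, f' (α j m) = β j (f m)) {n : ι →₀ N} {u : M'}
    (hu : f' u = Finsupp.liftAddHom β n) (j : ι) : ∃ m, f m = n j := by
  obtain ⟨m, rfl⟩ := hα.2 u
  rw [map_liftAddHom f f' h] at hu
  exact ⟨m j, by simpa using DFunLike.congr_fun (hβ.1 hu) j⟩

lemma pi {α : ι → M →+ M'} (hα : IsDec α) (m : ℕ) :
    IsDec fun j => (α j).compLeft (Fin m) := by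
  have key : ∀ (n : ι →₀ (Fin m → M)) (k : Fin m),
      Finsupp.liftAddHom (fun j => (α j).compLeft (Fin m)) n k =
        Finsupp.liftAddHom α (Finsupp.mapRange.addMonoidHom (Pi.evalAddMonoidHom _ k) n) :=
    fun n k => map_liftAddHom (α := fun j => (α j).compLeft (Fin m))
      (Pi.evalAddMonoidHom (fun _ => M) k) (Pi.evalAddMonoidHom (fun _ => M') k) (fun j v => rfl) n
  constructor
  · intro n n' h
    ext j k
    have := hα.1 ((key n k).symm.trans ((congrFun h k).trans (key n' k)))
    simpa using DFunLike.congr_fun this j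
  · intro v
    choose c hc using fun k => hα.2 (v k)
    refine ⟨∑ k, Finsupp.mapRange.addMonoidHom (AddMonoidHom.single (fun _ : Fin m => M) k) (c k),
      ?_⟩
    ext k
    rw [key, map_sum, ← hc k]
    congr 1
    ext j
    simp [Pi.single_apply]

lemma comp_bijective {α : ι → M →+ M'} (hα : IsDec α) (τ : N →+ M) (hτ : Function.Bijective τ) :
    IsDec fun j => (α j).comp τ := by
  have h : ∀ n, Finsupp.liftAddHom (fun j => (α j).comp τ) n =
      Finsupp.liftAddHom α (Finsupp.mapRange.addMonoidHom τ n) := fun n => by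
    induction n using Finsupp.induction_linear with
    | zero => simp
    | add x y hx hy => simp only [map_add, hx, hy]
    | single j m => simp
  rw [IsDec, funext h]
  exact hα.comp ⟨Finsupp.mapRange_injective _ (map_zero _) hτ.1,
    Finsupp.mapRange_surjective _ (map_zero _) hτ.2⟩

lemma bijective_comp {α : ι → M →+ M'} (hα : IsDec α) (τ : M' →+ N') (hτ : Function.Bijective τ) :
    IsDec fun j => τ.comp (α j) := by
  have h : ∀ n, Finsupp.liftAddHom (fun j => τ.comp (α j)) n =
      τ (Finsupp.liftAddHom α n) := fun n => by
    induction n using Finsupp.induction_linear with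
    | zero => simp
    | add x y hx hy => simp only [map_add, hx, hy]
    | single j m => simp
  rw [IsDec, funext h]
  exact hτ.comp hα

end IsDec

/-- Tensor products of direct sum decompositions. -/
lemma isDec_tensor {k : Type*} [CommRing k] {ι κ : Type*} {M N M' N' : Type*} [AddCommGroup M]
    [AddCommGroup N] [AddCommGroup M'] [AddCommGroup N'] [Module k M] [Module k N] [Module k M']
    [Module k N'] {α : ι → M →ₗ[k] M'} {β : κ → N →ₗ[k] N'}
    (hα : IsDec fun j => (α j).toAddMonoidHom) (hβ : IsDec fun j => (β j).toAddMonoidHom) :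
    IsDec fun p : ι × κ => (TensorProduct.map (α p.1) (β p.2)).toAddMonoidHom := by
  classical
  let e₁ : (ι →₀ M) ≃ₗ[k] M' := LinearEquiv.ofBijective (Finsupp.lsum k α) hα
  let e₂ : (κ →₀ N) ≃ₗ[k] N' := LinearEquiv.ofBijective (Finsupp.lsum k β) hβ
  have he₁ : ∀ i m, e₁ (Finsupp.single i m) = α i m := fun i m => by
    change Finsupp.lsum k α _ = _
    simp
  have he₂ : ∀ i m, e₂ (Finsupp.single i m) = β i m := fun i m => by
    change Finsupp.lsum k β _ = _
    simp
  let e := (finsuppTensorFinsupp k k M N ι κ).symm ≪≫ₗ TensorProduct.congr e₁ e₂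
  have h : Finsupp.liftAddHom (fun p : ι × κ =>
      (TensorProduct.map (α p.1) (β p.2)).toAddMonoidHom) = e.toLinearMap.toAddMonoidHom := by
    ext ⟨i, j⟩ z
    induction z using TensorProduct.induction_on with
    | zero => simp
    | add x y hx hy => simp only [map_add, hx, hy]
    | tmul m n => simp [e, he₁, he₂]
  rw [IsDec, h]
  exact e.bijective

end Decomposition

/-! ### Base change of matrix resolutions -/

namespace MatRes

/-- Base change along `φ : R → S`, when `S` is free as a right `R`-module on the elements `s j`. -/
abbrev baseChange {ι : Type*} {R : Type u} [Ring R] {M : Type v} [AddCommGroup M] [Module R M]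
    (Q : MatRes R M) {S : Type*} [Ring S] {M' : Type*} [AddCommGroup M'] [Module S M'] (φ : R →+* S)
    (s : ι → S) (i : M →+ M') (hi : ∀ r m, i (r • m) = φ r • i m)
    (hS : IsDec fun j => (AddMonoidHom.mulLeft (s j)).comp φ.toAddMonoidHom)
    (hM : IsDec fun j => (DistribSMul.toAddMonoidHom M' (s j)).comp i) : MatRes S M' where
  rk := Q.rk
  D n := (Q.D n).map φ
  ε j := i (Q.ε j)
  ε_surj := by
    -- Row vectors over `S` split into the pieces `s j * φ(v)`. Matrices act from the right, so on
    -- every piece the new maps are the old ones.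
    refine IsDec.surjective hM (Fintype.linearCombination R Q.ε).toAddMonoidHom
      (Fintype.linearCombination S fun j => i (Q.ε j)).toAddMonoidHom
      (α := fun j => ((AddMonoidHom.mulLeft (s j)).comp φ.toAddMonoidHom).compLeft _)
      (fun j v => ?_) Q.ε_surj
    simp [Fintype.linearCombination_apply, hi, mul_smul]
  D_ε j := by
    have := congrArg i (Q.D_ε j)
    simpa [Fintype.linearCombination_apply, hi] using this
  exact_zero := by
    refine IsDec.exact (hS.pi _) hM (Q.D 0).vecMulLinear.toAddMonoidHom
      ((Q.D 0).map φ).vecMulLinear.toAddMonoidHom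
      (α := fun j => ((AddMonoidHom.mulLeft (s j)).comp φ.toAddMonoidHom).compLeft _)
      (fun j v => ?_)
      (Fintype.linearCombination R Q.ε).toAddMonoidHom
      (Fintype.linearCombination S fun j => i (Q.ε j)).toAddMonoidHom (fun j v => ?_) Q.exact_zero
    · ext l
      simp [Matrix.vecMul, dotProduct, Finset.mul_sum, mul_assoc]
    · simp [Fintype.linearCombination_apply, hi, mul_smul]
  D_D n := by
    rw [← Matrix.map_mul, Q.D_D]
    simp
  exact_succ n := by
    refine IsDec.exact (hS.pi _) (hS.pi _) (Q.D (n + 1)).vecMulLinear.toAddMonoidHom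
      ((Q.D (n + 1)).map φ).vecMulLinear.toAddMonoidHom
      (α := fun j => ((AddMonoidHom.mulLeft (s j)).comp φ.toAddMonoidHom).compLeft _)
      (fun j v => ?_) (Q.D n).vecMulLinear.toAddMonoidHom
      ((Q.D n).map φ).vecMulLinear.toAddMonoidHom (fun j v => ?_) (Q.exact_succ n)
    all_goals
      ext l
      simp [Matrix.vecMul, dotProduct, Finset.mul_sum, mul_assoc]

/-- Finiteness is recorded by matrix identities, and these survive any ring homomorphism. -/
lemma IsFiniteAt.baseChange {ι : Type*} {R : Type u} [Ring R] {M : Type v} [AddCommGroup M]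
    [Module R M] {Q : MatRes R M} {N : ℕ} (hQ : Q.IsFiniteAt N) {S : Type*} [Ring S] {M' : Type*}
    [AddCommGroup M'] [Module S M'] (φ : R →+* S)
    (s : ι → S) (i : M →+ M') (hi : ∀ r m, i (r • m) = φ r • i m)
    (hS : IsDec fun j => (AddMonoidHom.mulLeft (s j)).comp φ.toAddMonoidHom)
    (hM : IsDec fun j => (DistribSMul.toAddMonoidHom M' (s j)).comp i) :
    (Q.baseChange φ s i hi hS hM).IsFiniteAt N := by
  obtain ⟨e, he, he'⟩ := hQ
  refine ⟨e.map φ, ?_, ?_⟩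
  · exact (Matrix.map_mul (f := φ)).symm.trans (congrArg (fun A => Matrix.map A φ) he)
  · refine (Matrix.map_mul (f := φ)).symm.trans ((congrArg (fun A => Matrix.map A φ) he').trans ?_)
    exact Matrix.map_zero _ (map_zero φ)

end MatRes

/-! ### Triangular maps and the shift operator on finite sequences -/

section Sequences

variable {A : Type*} [AddCommGroup A]

/-- `L` respects the filtration by degree, and `c n` is its effect on leading coefficients.
Injectivity is seen at the top degree; preimages are built by removing leading terms. -/
lemma bijective_of_triangular (L : (ℕ →₀ A) →+ (ℕ →₀ A)) (c : ℕ → A → A)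
    (hc : ∀ n, Function.Bijective (c n)) (h : ∀ n a, L (Finsupp.single n a) n = c n a)
    (h' : ∀ n a m, n < m → L (Finsupp.single n a) m = 0) : Function.Bijective L := by
  have hc₀ : ∀ n, c n 0 = 0 := fun n => by rw [← h]; simp
  constructor
  · refine (injective_iff_map_eq_zero L).2 fun f hf => ?_
    have key : ∀ n, (∀ m, n < m → f m = 0) → f n = 0 := by
      intro n hn
      have h₁ : L f n = c n (f n) := by
        conv_lhs => rw [← Finsupp.sum_single f, Finsupp.sum, map_sum, Finsupp.finsetSum_apply]
        rw [Finset.sum_eq_single n, h]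
        · intro m _ hmn
          rcases lt_or_gt_of_ne hmn with hlt | hlt
          · exact h' _ _ _ hlt
          · simp [hn m hlt]
        · intro hn'
          simp [Finsupp.notMem_support_iff.1 hn']
      rw [hf] at h₁
      exact (hc n).1 (h₁.symm.trans (hc₀ n).symm)
    obtain ⟨N, hN⟩ := f.support.bddAbove
    -- Descending induction on `n` from above the support, run through the auxiliary `j`.
    have h₂ : ∀ j n, N < n + j → f n = 0 := by
      intro j
      induction j with
      | zero =>
        intro n hn
        by_contra hne
        exact absurd (hN (Finsupp.mem_support_iff.2 hne)) (by omega)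
      | succ j ih =>
        intro n hn
        refine key n fun m hm => ih m (by omega)
    ext n
    exact h₂ (N + 1) n (by omega)
  · have key : ∀ N (g : ℕ →₀ A), (∀ m, N ≤ m → g m = 0) → ∃ f, L f = g := by
      intro N
      induction N with
      | zero =>
        intro g hg
        exact ⟨0, by ext m; simp [hg m (Nat.zero_le m)]⟩
      | succ N ih =>
        intro g hg
        obtain ⟨a, ha⟩ := (hc N).2 (g N)
        obtain ⟨f, hf⟩ := ih (g - L (Finsupp.single N a)) fun m hm => by
          rcases hm.eq_or_lt with rfl | hlt
          · simp [h, ha]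
          · simp [h' _ _ _ hlt, hg m hlt]
        exact ⟨f + Finsupp.single N a, by simp [hf]⟩
    intro g
    obtain ⟨N, hN⟩ := g.support.bddAbove
    refine key (N + 1) g fun m hm => ?_
    by_contra hne
    exact absurd (hN (Finsupp.mem_support_iff.2 hne)) (by omega)

variable {E : Type*} [Ring E] (w : E)

/-- `e tʲ ↦ e w tʲ - e tʲ⁺¹`. -/
def shiftSub : (ℕ →₀ E) →+ (ℕ →₀ E) :=
  Finsupp.liftAddHom fun j => (Finsupp.singleAddHom j).comp (AddMonoidHom.mulRight w) -
    Finsupp.singleAddHom (j + 1)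

/-- `e tʲ ↦ e wʲ`. -/
def evalRight : (ℕ →₀ E) →+ E := Finsupp.liftAddHom fun j => AddMonoidHom.mulRight (w ^ j)

@[simp]
lemma shiftSub_single (j : ℕ) (e : E) : shiftSub w (Finsupp.single j e) =
    Finsupp.single j (e * w) - Finsupp.single (j + 1) e := by
  simp [shiftSub]

@[simp]
lemma evalRight_single (j : ℕ) (e : E) : evalRight w (Finsupp.single j e) = e * w ^ j := by
  simp [evalRight]

lemma shiftSub_apply_succ (f : ℕ →₀ E) (j : ℕ) :
    shiftSub w f (j + 1) = f (j + 1) * w - f j := by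
  classical
  induction f using Finsupp.induction_linear with
  | zero => simp
  | add f g hf hg => simp only [map_add, Finsupp.add_apply, hf, hg, add_mul]; abel
  | single n a => by_cases h : n = j <;> by_cases h' : n = j + 1 <;> simp [h, h']

/-- A sequence in the kernel satisfies `f j = f (j + i) * w ^ i` for all `i`, and the right side
vanishes for large `i`. -/
lemma shiftSub_injective : Function.Injective (shiftSub w) := by
  refine (injective_iff_map_eq_zero _).2 fun f hf => ?_
  have h : ∀ j, f j = f (j + 1) * w := fun j => by
    have := shiftSub_apply_succ w f j
    rw [hf, Finsupp.zero_apply] at this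
    exact (sub_eq_zero.1 this.symm).symm
  have h' : ∀ i j, f j = f (j + i) * w ^ i := by
    intro i
    induction i with
    | zero => simp
    | succ i ih =>
      intro j
      rw [ih j, h (j + i), mul_assoc, ← pow_succ', add_assoc]
  obtain ⟨N, hN⟩ := f.support.bddAbove
  ext j
  rw [h' (N + 1) j]
  have : f (j + (N + 1)) = 0 := by
    by_contra hne
    exact absurd (hN (Finsupp.mem_support_iff.2 hne)) (by omega)
  simp [this]

lemma evalRight_shiftSub (f : ℕ →₀ E) : evalRight w (shiftSub w f) = 0 := by
  induction f using Finsupp.induction_linear with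
  | zero => simp
  | add f g hf hg => simp only [map_add, hf, hg, add_zero]
  | single n a =>
    rw [shiftSub_single, map_sub, evalRight_single, evalRight_single, pow_succ', mul_assoc,
      sub_self]

/-- Modulo the image, `e tⁿ⁺¹` equals `e w tⁿ`, so every sequence reduces to degree 0. The cokernel
is thus `E` through `evalRight w`; this serves with `w = x` for the bimodule sequence and with `w =
x u + c` for its dual. -/
lemma exists_shiftSub (g : ℕ →₀ E) :
    ∃ f, g = Finsupp.single 0 (evalRight w g) + shiftSub w f := by
  induction g using Finsupp.induction_linear with
  | zero => exact ⟨0, by simp⟩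
  | add g₁ g₂ h₁ h₂ =>
    obtain ⟨f₁, h₁⟩ := h₁
    obtain ⟨f₂, h₂⟩ := h₂
    refine ⟨f₁ + f₂, ?_⟩
    conv_lhs => rw [h₁, h₂]
    simp only [map_add, Finsupp.single_add]
    abel
  | single n e =>
    induction n generalizing e with
    | zero => exact ⟨0, by simp⟩
    | succ n ih =>
      obtain ⟨f, hf⟩ := ih (e * w)
      refine ⟨f - Finsupp.single n e, ?_⟩
      rw [map_sub, shiftSub_single, hf]
      simp only [evalRight_single, mul_assoc, ← pow_succ']
      abel

end Sequences

/-! ### Left and right coefficients in an Ore extension -/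

namespace IsOreExtension

variable {k : Type u} {A : Type v} {E : Type w} [CommRing k] [Ring A] [Algebra k A] [Ring E]
  [Algebra k E] {σ : A →ₐ[k] A} {δ : A →ₗ[k] A} {ι : A →ₐ[k] E} {x : E}

/-- `a ↦ a xⁿ`. -/
def leftTerm (ι : A →ₐ[k] E) (x : E) (n : ℕ) : A →ₗ[k] E :=
  LinearMap.mulRight k (x ^ n) ∘ₗ ι.toLinearMap

/-- `a ↦ xⁿ a`. -/
def rightTerm (ι : A →ₐ[k] E) (x : E) (n : ℕ) : A →ₗ[k] E :=
  LinearMap.mulLeft k (x ^ n) ∘ₗ ι.toLinearMap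

@[simp]
lemma leftTerm_apply (n : ℕ) (a : A) : leftTerm ι x n a = ι a * x ^ n := rfl

@[simp]
lemma rightTerm_apply (n : ℕ) (a : A) : rightTerm ι x n a = x ^ n * ι a := rfl

lemma isDec_left (hE : IsOreExtension σ δ ι x) :
    IsDec fun n => (leftTerm ι x n).toAddMonoidHom :=
  hE.bijective

/-- The left coefficients of an element of an Ore extension. -/
def coords (hE : IsOreExtension σ δ ι x) : E ≃ₗ[k] (ℕ →₀ A) :=
  (LinearEquiv.ofBijective (Finsupp.lsum k (leftTerm ι x)) hE.isDec_left).symm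

lemma coords_symm_single (hE : IsOreExtension σ δ ι x) (n : ℕ) (a : A) :
    hE.coords.symm (Finsupp.single n a) = ι a * x ^ n := by
  change Finsupp.lsum k (leftTerm ι x) _ = _
  simp

@[simp]
lemma coords_mul_pow (hE : IsOreExtension σ δ ι x) (n : ℕ) (a : A) :
    hE.coords (ι a * x ^ n) = Finsupp.single n a := by
  rw [← coords_symm_single hE, LinearEquiv.apply_symm_apply]

@[simp]
lemma coords_ι (hE : IsOreExtension σ δ ι x) (a : A) : hE.coords (ι a) = Finsupp.single 0 a := by
  simpa using hE.coords_mul_pow 0 a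

@[elab_as_elim]
lemma induction_on (hE : IsOreExtension σ δ ι x) {p : E → Prop} (z : E)
    (add : ∀ y z, p y → p z → p (y + z)) (term : ∀ a n, p (ι a * x ^ n)) : p z := by
  rw [← hE.coords.symm_apply_apply z]
  generalize hE.coords z = f
  induction f using Finsupp.induction_linear with
  | zero => simpa using term 0 0
  | add f g hf hg => rw [map_add]; exact add _ _ hf hg
  | single n a => rw [coords_symm_single]; exact term a n

lemma coords_ι_mul (hE : IsOreExtension σ δ ι x) (a : A) (z : E) (m : ℕ) :
    hE.coords (ι a * z) m = a * hE.coords z m := by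
  induction z using hE.induction_on with
  | add y z hy hz => simp only [mul_add, map_add, Finsupp.add_apply, hy, hz]
  | term b n =>
    rw [← mul_assoc, ← map_mul, coords_mul_pow, coords_mul_pow]
    by_cases h : n = m <;> simp [h]

lemma coords_x_mul_succ (hE : IsOreExtension σ δ ι x) (z : E) (m : ℕ) :
    hE.coords (x * z) (m + 1) = σ (hE.coords z m) + δ (hE.coords z (m + 1)) := by
  classical
  induction z using hE.induction_on with
  | add y z hy hz => simp only [mul_add, map_add, Finsupp.add_apply, hy, hz]; abel
  | term b n =>
    rw [← mul_assoc, hE.x_mul, add_mul, mul_assoc, ← pow_succ', map_add hE.coords, coords_mul_pow,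
      coords_mul_pow, coords_mul_pow]
    by_cases h : n = m <;> by_cases h' : n = m + 1 <;> simp [h, h']

/-- `xⁿ a` is `σⁿ(a) xⁿ` plus terms of lower degree, so the passage to left coefficients is
triangular with the bijections `σⁿ` on the diagonal. -/
lemma isDec_right {σ : A ≃ₐ[k] A} (hE : IsOreExtension σ.toAlgHom δ ι x) :
    IsDec fun n => (rightTerm ι x n).toAddMonoidHom := by
  have key : ∀ n a m, n ≤ m → hE.coords (x ^ n * ι a) m = if n = m then (σ ^ n) a else 0 := by
    intro n a
    induction n with
    | zero =>
      intro m _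
      by_cases h : 0 = m
      · subst h
        simp
      · simp [h]
    | succ n ih =>
      intro m hm
      obtain ⟨m, rfl⟩ : ∃ l, m = l + 1 := ⟨m - 1, by omega⟩
      rw [pow_succ', mul_assoc, coords_x_mul_succ, ih m (by omega), ih (m + 1) (by omega),
        if_neg (by omega : ¬ n = m + 1)]
      by_cases h : n = m
      · simp [h, pow_succ']
      · simp [h]
  have h := bijective_of_triangular (hE.coords.toLinearMap.toAddMonoidHom.comp
    (Finsupp.liftAddHom fun n => (rightTerm ι x n).toAddMonoidHom)) (fun n => (σ ^ n : A ≃ₐ[k] A))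
    (fun n => (σ ^ n : A ≃ₐ[k] A).bijective)
    (fun n a => by simpa using key n a n le_rfl)
    (fun n a m hnm => by simpa [hnm.ne] using key n a m hnm.le)
  exact (Function.Bijective.of_comp_iff' hE.coords.bijective _).1 h

end IsOreExtension

/-! ### Enveloping algebras, and freeness of `Eᵉ` over `Aᵉ` on both sides -/

section EnvelopingMap

variable {k : Type*} {A : Type*} {B : Type*} [CommRing k] [Ring A] [Algebra k A] [Ring B]
  [Algebra k B]

/-- The homomorphism `f ⊗ g` of enveloping algebras. -/
def envMap (f g : A →ₐ[k] B) : EnvelopingAlgebra k A →ₐ[k] EnvelopingAlgebra k B :=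
  Algebra.TensorProduct.map f (AlgHom.op g)

@[simp]
lemma envMap_tmul (f g : A →ₐ[k] B) (a b : A) :
    envMap f g (a ⊗ₜ op b) = f a ⊗ₜ op (g b) := rfl

@[elab_as_elim]
lemma EnvelopingAlgebra.induction_on {p : EnvelopingAlgebra k A → Prop}
    (z : EnvelopingAlgebra k A) (tmul : ∀ a b : A, p (a ⊗ₜ op b))
    (add : ∀ y z, p y → p z → p (y + z)) : p z := by
  induction z using TensorProduct.induction_on with
  | zero => simpa using tmul 0 0
  | add y z hy hz => exact add y z hy hz
  | tmul a b => exact tmul a b.unop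

@[simp]
lemma EnvelopingAlgebra.tmul_mul_tmul (a b c d : A) :
    (a ⊗ₜ[k] op b : EnvelopingAlgebra k A) * (c ⊗ₜ op d) = (a * c) ⊗ₜ op (d * b) := by
  rw [Algebra.TensorProduct.tmul_mul_tmul, op_mul]

lemma EnvelopingAlgebra.tmul_smul (a b m : A) :
    (a ⊗ₜ[k] op b : EnvelopingAlgebra k A) • m = a * m * b :=
  selfBimodule_smul k A a b m

end EnvelopingMap

section Decomposition

/-- A linear map viewed as a map of opposite modules. -/
def opMap (k : Type*) [CommRing k] {M N : Type*} [AddCommGroup M] [Module k M] [AddCommGroup N]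
    [Module k N] (f : M →ₗ[k] N) : Mᵐᵒᵖ →ₗ[k] Nᵐᵒᵖ :=
  (opLinearEquiv k).toLinearMap ∘ₗ f ∘ₗ (opLinearEquiv k).symm.toLinearMap

@[simp]
lemma opMap_op (k : Type*) [CommRing k] {M N : Type*} [AddCommGroup M] [Module k M]
    [AddCommGroup N] [Module k N] (f : M →ₗ[k] N) (m : M) : opMap k f (op m) = op (f m) := rfl

lemma IsDec.opMap {k : Type*} [CommRing k] {ι M N : Type*} [AddCommGroup M] [Module k M]
    [AddCommGroup N] [Module k N] {α : ι → M →ₗ[k] N} (h : IsDec fun j => (α j).toAddMonoidHom) :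
    IsDec fun j => (opMap k (α j)).toAddMonoidHom :=
  (h.comp_bijective (opAddEquiv (α := M)).symm.toAddMonoidHom
    (opAddEquiv (α := M)).symm.bijective).bijective_comp (opAddEquiv (α := N)).toAddMonoidHom
    (opAddEquiv (α := N)).bijective

lemma isDec_single {κ M : Type*} [AddCommGroup M] :
    IsDec fun j : κ => Finsupp.singleAddHom (M := M) j := by
  rw [IsDec, Finsupp.liftAddHom_singleAddHom]
  exact Function.bijective_id

lemma IsDec.prod {ι κ M M' M'' : Type*} [AddCommGroup M] [AddCommGroup M'] [AddCommGroup M'']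
    {α : ι → M →+ M'} {β : κ → M' →+ M''} (hα : IsDec α) (hβ : IsDec β) :
    IsDec fun p : ι × κ => (β p.2).comp (α p.1) := by
  let e : (ι × κ →₀ M) ≃+ (κ →₀ ι →₀ M) :=
    (Finsupp.domCongr (Equiv.prodComm ι κ)).trans Finsupp.curryAddEquiv
  have h : Finsupp.liftAddHom (fun p : ι × κ => (β p.2).comp (α p.1)) =
      ((Finsupp.liftAddHom β).comp (Finsupp.mapRange.addMonoidHom (Finsupp.liftAddHom α))).comp
        e.toAddMonoidHom := by
    ext ⟨i, j⟩ m
    simp [e, Finsupp.domCongr]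
  rw [IsDec, h]
  exact (hβ.comp ⟨Finsupp.mapRange_injective _ (map_zero _) hα.1,
    Finsupp.mapRange_surjective _ (map_zero _) hα.2⟩).comp e.bijective

end Decomposition

namespace IsOreExtension

variable {k : Type u} {A : Type v} {E : Type w} [CommRing k] [Ring A] [Algebra k A] [Ring E]
  [Algebra k E] {σ : A ≃ₐ[k] A} {δ : A →ₗ[k] A} {ι : A →ₐ[k] E} {x : E}

/-- The element `xⁱ ⊗ xʲ`. -/
def bipow (k : Type u) {E : Type w} [CommRing k] [Ring E] [Algebra k E] (x : E) (p : ℕ × ℕ) :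
    EnvelopingAlgebra k E :=
  (x ^ p.1) ⊗ₜ op (x ^ p.2)

lemma isDec_left_comp {σ : A →ₐ[k] A} (hE : IsOreExtension σ δ ι x) (τ : A ≃ₐ[k] A) :
    IsDec fun n => (leftTerm ι x n ∘ₗ τ.toLinearMap).toAddMonoidHom :=
  hE.isDec_left.comp_bijective τ.toLinearMap.toAddMonoidHom τ.bijective

lemma isDec_right_comp (hE : IsOreExtension σ.toAlgHom δ ι x) (τ : A ≃ₐ[k] A) :
    IsDec fun n => (rightTerm ι x n ∘ₗ τ.toLinearMap).toAddMonoidHom :=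
  hE.isDec_right.comp_bijective τ.toLinearMap.toAddMonoidHom τ.bijective

/-- The homomorphism of enveloping algebras by which `A ⊗ Aᵒᵖ` acts, twisted on the left. -/
def twist (ι : A →ₐ[k] E) (τ : A ≃ₐ[k] A) : EnvelopingAlgebra k A →+* EnvelopingAlgebra k E :=
  (envMap (ι.comp τ.toAlgHom) ι).toRingHom

@[simp]
lemma twist_tmul (τ : A ≃ₐ[k] A) (a b : A) :
    twist ι τ (a ⊗ₜ op b) = ι (τ a) ⊗ₜ op (ι b) := rfl

/-- `E ⊗ Eᵒᵖ` is free as a right module over `A ⊗ Aᵒᵖ`. -/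
lemma isDec_env_right (hE : IsOreExtension σ.toAlgHom δ ι x) (τ : A ≃ₐ[k] A) :
    IsDec fun p => (AddMonoidHom.mulLeft (bipow k x p)).comp (twist ι τ).toAddMonoidHom := by
  -- The opposite multiplication exchanges sides: a right basis of `E` over `A` in the first factor
  -- goes with a left basis in the second.
  have h := isDec_tensor (hE.isDec_right_comp τ) hE.isDec_left.opMap
  convert h using 2 with p
  ext z
  induction z using EnvelopingAlgebra.induction_on with
  | add y z hy hz => simp only [map_add, hy, hz]
  | tmul a b => simp [bipow]

/-- `E ⊗ Eᵒᵖ` is free as a left module over `A ⊗ Aᵒᵖ`. -/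
lemma isDec_env_left (hE : IsOreExtension σ.toAlgHom δ ι x) (τ : A ≃ₐ[k] A) :
    IsDec fun p => (AddMonoidHom.mulRight (bipow k x p)).comp (twist ι τ).toAddMonoidHom := by
  have h := isDec_tensor (hE.isDec_left_comp τ) hE.isDec_right.opMap
  convert h using 2 with p
  ext z
  induction z using EnvelopingAlgebra.induction_on with
  | add y z hy hz => simp only [map_add, hy, hz]
  | tmul a b => simp [bipow]

end IsOreExtension

/-! ### Induced bimodules -/

section Induced

variable {k : Type u} {A : Type v} {E : Type w} [CommRing k] [Ring A] [Algebra k A] [Ring E]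
  [Algebra k E]

/-- The relations defining `E ⊗_A E`, where `a` acts on the left factor through `τ`. -/
def inducedRel (ι : A →ₐ[k] E) (τ : A ≃ₐ[k] A) :
    Submodule (EnvelopingAlgebra k E) (EnvelopingAlgebra k E) :=
  Submodule.span _ (Set.range fun a : A => (ι (τ a) ⊗ₜ 1 - 1 ⊗ₜ op (ι a) : EnvelopingAlgebra k E))

/-- `E ⊗_A E`, where `a` acts on the left factor through `τ`. -/
abbrev Induced (ι : A →ₐ[k] E) (τ : A ≃ₐ[k] A) : Type w :=
  EnvelopingAlgebra k E ⧸ inducedRel ι τ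

/-- The class of an element of `E ⊗ E`. -/
abbrev Induced.mk (ι : A →ₐ[k] E) (τ : A ≃ₐ[k] A) :
    EnvelopingAlgebra k E →ₗ[EnvelopingAlgebra k E] Induced ι τ :=
  (inducedRel ι τ).mkQ

lemma Induced.mk_tmul (ι : A →ₐ[k] E) (τ : A ≃ₐ[k] A) (e f : E) (a : A) :
    Induced.mk ι τ (e ⊗ₜ op (ι a * f)) = Induced.mk ι τ ((e * ι (τ a)) ⊗ₜ op f) := by
  have h : Induced.mk ι τ (ι (τ a) ⊗ₜ 1 - 1 ⊗ₜ op (ι a)) = 0 :=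
    (Submodule.Quotient.mk_eq_zero _).2 (Submodule.subset_span ⟨a, rfl⟩)
  have h' := congrArg (fun z => (e ⊗ₜ op f : EnvelopingAlgebra k E) • z) h
  simp only [← map_smul, smul_zero, smul_eq_mul, mul_sub] at h'
  rw [← op_one, EnvelopingAlgebra.tmul_mul_tmul, EnvelopingAlgebra.tmul_mul_tmul, map_sub,
    sub_eq_zero, one_mul, mul_one] at h'
  exact h'.symm

/-- The canonical map from `A` to the induced bimodule. -/
def Induced.incl (ι : A →ₐ[k] E) (τ : A ≃ₐ[k] A) : A →+ Induced ι τ where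
  toFun a := Induced.mk ι τ (1 ⊗ₜ op (ι a))
  map_zero' := by simp
  map_add' a b := by simp [TensorProduct.tmul_add]

lemma Induced.incl_smul (ι : A →ₐ[k] E) (τ : A ≃ₐ[k] A) (r : EnvelopingAlgebra k A) (m : A) :
    Induced.incl ι τ (r • m) = IsOreExtension.twist ι τ r • Induced.incl ι τ m := by
  induction r using EnvelopingAlgebra.induction_on with
  | add y z hy hz => simp only [add_smul, map_add, hy, hz]
  | tmul a b =>
    rw [EnvelopingAlgebra.tmul_smul]
    change Induced.mk ι τ _ = (ι (τ a) ⊗ₜ op (ι b) : EnvelopingAlgebra k E) • Induced.mk ι τ _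
    rw [← map_smul, smul_eq_mul, EnvelopingAlgebra.tmul_mul_tmul, map_mul, map_mul, mul_assoc,
      Induced.mk_tmul, mul_one, one_mul]

end Induced

namespace IsOreExtension

variable {k : Type u} {A : Type v} {E : Type w} [CommRing k] [Ring A] [Algebra k A] [Ring E]
  [Algebra k E] {σ : A ≃ₐ[k] A} {δ : A →ₗ[k] A} {ι : A →ₐ[k] E} {x : E}

/-- The left coefficients of an element of the induced bimodule with respect to `1 ⊗ xⁿ`. -/
def preCoeff (hE : IsOreExtension σ.toAlgHom δ ι x) (τ : A ≃ₐ[k] A) :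
    EnvelopingAlgebra k E →ₗ[k] (ℕ →₀ E) :=
  TensorProduct.lift (LinearMap.mk₂ k
    (fun e f => Finsupp.mapRange.linearMap
      (LinearMap.mulLeft k e ∘ₗ (ι.comp τ.toAlgHom).toLinearMap) (hE.coords f.unop))
    (fun e e' f => by ext; simp [add_mul]) (fun c e f => by ext; simp)
    (fun e f f' => by rw [MulOpposite.unop_add, map_add, map_add])
    (fun c e f => by rw [MulOpposite.unop_smul, map_smul, map_smul]))

lemma preCoeff_tmul (hE : IsOreExtension σ.toAlgHom δ ι x) (τ : A ≃ₐ[k] A) (e f : E) (j : ℕ) :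
    hE.preCoeff τ (e ⊗ₜ op f) j = e * ι (τ (hE.coords f j)) := by
  simp [preCoeff]

@[simp]
lemma preCoeff_tmul_pow (hE : IsOreExtension σ.toAlgHom δ ι x) (τ : A ≃ₐ[k] A) (e : E) (a : A)
    (j : ℕ) : hE.preCoeff τ (e ⊗ₜ op (ι a * x ^ j)) = Finsupp.single j (e * ι (τ a)) := by
  simp [preCoeff]

@[simp]
lemma preCoeff_tmul_pow_one (hE : IsOreExtension σ.toAlgHom δ ι x) (τ : A ≃ₐ[k] A) (e : E)
    (j : ℕ) : hE.preCoeff τ (e ⊗ₜ op (x ^ j)) = Finsupp.single j e := by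
  simpa using hE.preCoeff_tmul_pow τ e 1 j

lemma preCoeff_rel (hE : IsOreExtension σ.toAlgHom δ ι x) (τ : A ≃ₐ[k] A) :
    ∀ z ∈ inducedRel ι τ, hE.preCoeff τ z = 0 := by
  -- `preCoeff` is only `k`-linear, so its vanishing on generators does not suffice. `J` is the
  -- largest submodule inside its kernel.
  let J : Submodule (EnvelopingAlgebra k E) (EnvelopingAlgebra k E) :=
    { carrier := {z | ∀ s, hE.preCoeff τ (s * z) = 0}
      add_mem' := fun {y z} hy hz s => by rw [mul_add, map_add, hy, hz, add_zero]
      zero_mem' := fun s => by simp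
      smul_mem' := fun c z hz s => by rw [smul_eq_mul, ← mul_assoc]; exact hz _ }
  have hJ : inducedRel ι τ ≤ J := by
    refine Submodule.span_le.2 ?_
    rintro _ ⟨a, rfl⟩ s
    induction s using EnvelopingAlgebra.induction_on with
    | add y z hy hz => rw [add_mul, map_add, hy, hz, add_zero]
    | tmul e f =>
      rw [mul_sub, ← op_one, EnvelopingAlgebra.tmul_mul_tmul, EnvelopingAlgebra.tmul_mul_tmul,
        map_sub]
      ext j
      rw [Finsupp.sub_apply, preCoeff_tmul, preCoeff_tmul, coords_ι_mul]
      simp [mul_assoc]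
  intro z hz
  simpa using hJ hz 1

/-- The left coefficients of an element of the induced bimodule with respect to `1 ⊗ xⁿ`. -/
def coeff (hE : IsOreExtension σ.toAlgHom δ ι x) (τ : A ≃ₐ[k] A) : Induced ι τ →+ (ℕ →₀ E) :=
  QuotientAddGroup.lift (inducedRel ι τ).toAddSubgroup (hE.preCoeff τ).toAddMonoidHom
    (hE.preCoeff_rel τ)

@[simp]
lemma coeff_mk (hE : IsOreExtension σ.toAlgHom δ ι x) (τ : A ≃ₐ[k] A)
    (z : EnvelopingAlgebra k E) : hE.coeff τ (Induced.mk ι τ z) = hE.preCoeff τ z := rfl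

/-- The element of the induced bimodule with given coefficients. -/
def ofCoeff (ι : A →ₐ[k] E) (x : E) (τ : A ≃ₐ[k] A) : (ℕ →₀ E) →+ Induced ι τ :=
  Finsupp.liftAddHom fun j =>
    { toFun := fun e => Induced.mk ι τ (e ⊗ₜ op (x ^ j))
      map_zero' := by simp
      map_add' := fun a b => by simp [TensorProduct.add_tmul] }

@[simp]
lemma ofCoeff_single (τ : A ≃ₐ[k] A) (j : ℕ) (e : E) :
    ofCoeff ι x τ (Finsupp.single j e) = Induced.mk ι τ (e ⊗ₜ op (x ^ j)) := by
  simp [ofCoeff]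

lemma ofCoeff_coeff (hE : IsOreExtension σ.toAlgHom δ ι x) (τ : A ≃ₐ[k] A) (z : Induced ι τ) :
    ofCoeff ι x τ (hE.coeff τ z) = z := by
  obtain ⟨z, rfl⟩ := (inducedRel ι τ).mkQ_surjective z
  rw [coeff_mk]
  induction z using EnvelopingAlgebra.induction_on with
  | add y z hy hz => simp only [map_add, hy, hz]
  | tmul e f =>
    induction f using hE.induction_on with
    | add f f' hf hf' => simp only [MulOpposite.op_add, TensorProduct.tmul_add, map_add, hf, hf']
    | term a n => rw [preCoeff_tmul_pow, ofCoeff_single, Induced.mk_tmul]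

lemma coeff_ofCoeff (hE : IsOreExtension σ.toAlgHom δ ι x) (τ : A ≃ₐ[k] A) (f : ℕ →₀ E) :
    hE.coeff τ (ofCoeff ι x τ f) = f := by
  induction f using Finsupp.induction_linear with
  | zero => simp
  | add f g hf hg => simp only [map_add, hf, hg]
  | single j e => rw [ofCoeff_single, coeff_mk, preCoeff_tmul_pow_one]

/-- The induced bimodule is a direct sum of copies of `A`. -/
lemma isDec_induced (hE : IsOreExtension σ.toAlgHom δ ι x) (τ : A ≃ₐ[k] A) :
    IsDec fun p => (DistribSMul.toAddMonoidHom (Induced ι τ) (bipow k x p)).comp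
      (Induced.incl ι τ) := by
  have h₁ := (hE.isDec_right_comp τ).prod (isDec_single (κ := ℕ) (M := E))
  have h₂ := h₁.bijective_comp (ofCoeff ι x τ) (Function.bijective_iff_has_inverse.2
    ⟨_, hE.coeff_ofCoeff τ, hE.ofCoeff_coeff τ⟩)
  convert h₂ using 2 with p
  ext a
  change bipow k x p • Induced.mk ι τ (1 ⊗ₜ op (ι a)) =
    ofCoeff ι x τ (Finsupp.single p.2 (x ^ p.1 * ι (τ a)))
  rw [ofCoeff_single, ← map_smul, smul_eq_mul, bipow, EnvelopingAlgebra.tmul_mul_tmul, mul_one,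
    Induced.mk_tmul]

end IsOreExtension

/-! ### The short exact sequence of bimodules -/

namespace IsOreExtension

variable {k : Type u} {A : Type v} {E : Type w} [CommRing k] [Ring A] [Algebra k A] [Ring E]
  [Algebra k E] {σ : A ≃ₐ[k] A} {δ : A →ₗ[k] A} {ι : A →ₐ[k] E} {x : E}

/-- The element `x ⊗ 1 - 1 ⊗ x`. -/
def kappa (k : Type u) {E : Type w} [CommRing k] [Ring E] [Algebra k E] (x : E) :
    EnvelopingAlgebra k E :=
  x ⊗ₜ op 1 - 1 ⊗ₜ op x

lemma tmul_mul_kappa (e f : E) :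
    (e ⊗ₜ op f : EnvelopingAlgebra k E) * kappa k x = (e * x) ⊗ₜ op f - e ⊗ₜ op (x * f) := by
  rw [kappa, mul_sub, EnvelopingAlgebra.tmul_mul_tmul, EnvelopingAlgebra.tmul_mul_tmul, one_mul,
    mul_one]

/-- In `E ⊗_A E`, both `σ(a) ⊗ 1` and `1 ⊗ a` times `κ` become `σ(a) x ⊗ 1 - σ(a) ⊗ x`, because `x a
- δ(a) = σ(a) x`. This is the source of the twist by `σ`. -/
lemma mk_rel_mul_kappa (hE : IsOreExtension σ.toAlgHom δ ι x) :
    ∀ z ∈ inducedRel ι σ, Induced.mk ι AlgEquiv.refl (z * kappa k x) = 0 := by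
  intro z hz
  refine Submodule.span_induction (p := fun z _ =>
    Induced.mk ι AlgEquiv.refl (z * kappa k x) = 0) ?_ ?_ ?_ ?_ hz
  · rintro _ ⟨a, rfl⟩
    have h₁ := Induced.mk_tmul ι AlgEquiv.refl x 1 a
    have h₂ := Induced.mk_tmul ι AlgEquiv.refl 1 x (σ a)
    have h₃ := Induced.mk_tmul ι AlgEquiv.refl 1 1 (δ a)
    have hx := hE.x_mul a
    simp only [mul_one, one_mul, AlgEquiv.coe_refl, id_eq] at h₁ h₂ h₃
    rw [sub_mul, ← op_one, tmul_mul_kappa, tmul_mul_kappa, mul_one, one_mul, hx,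
      MulOpposite.op_add, TensorProduct.tmul_add]
    simp only [map_sub, map_add]
    rw [h₁, hx, TensorProduct.add_tmul, map_add, h₃]
    change _ - (_ - (Induced.mk ι AlgEquiv.refl (1 ⊗ₜ op (ι (σ a) * x)) + _)) = _
    rw [h₂]
    change Induced.mk ι AlgEquiv.refl ((ι (σ a) * x) ⊗ₜ op 1) - _ - (Induced.mk ι AlgEquiv.refl
      ((ι (σ a) * x) ⊗ₜ op 1) + _ - _) = 0
    abel
  · simp
  · intro y z _ _ hy hz
    rw [add_mul, map_add, hy, hz, add_zero]
  · intro s z _ hz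
    rw [smul_eq_mul, mul_assoc, ← smul_eq_mul, map_smul, hz, smul_zero]

/-- The inclusion of the kernel of the multiplication map. -/
def kernelIncl (hE : IsOreExtension σ.toAlgHom δ ι x) :
    Induced ι σ →ₗ[EnvelopingAlgebra k E] Induced ι (AlgEquiv.refl : A ≃ₐ[k] A) :=
  (inducedRel ι σ).liftQ (Induced.mk ι AlgEquiv.refl ∘ₗ LinearMap.toSpanSingleton _ _ (kappa k x))
    hE.mk_rel_mul_kappa

@[simp]
lemma kernelIncl_mk (hE : IsOreExtension σ.toAlgHom δ ι x) (z : EnvelopingAlgebra k E) :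
    hE.kernelIncl (Induced.mk ι σ z) = Induced.mk ι AlgEquiv.refl (z * kappa k x) := rfl

/-- The multiplication map. -/
def inducedMul (ι : A →ₐ[k] E) :
    Induced ι (AlgEquiv.refl : A ≃ₐ[k] A) →ₗ[EnvelopingAlgebra k E] E :=
  (inducedRel ι AlgEquiv.refl).liftQ (LinearMap.toSpanSingleton _ E 1) (by
    refine Submodule.span_le.2 ?_
    rintro _ ⟨a, rfl⟩
    change (ι a ⊗ₜ 1 - 1 ⊗ₜ op (ι a) : EnvelopingAlgebra k E) • (1 : E) = 0
    rw [sub_smul, ← op_one, EnvelopingAlgebra.tmul_smul, EnvelopingAlgebra.tmul_smul]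
    simp)

@[simp]
lemma inducedMul_mk_tmul (ι : A →ₐ[k] E) (e f : E) :
    inducedMul ι (Induced.mk ι AlgEquiv.refl (e ⊗ₜ op f)) = e * f := by
  change (e ⊗ₜ op f : EnvelopingAlgebra k E) • (1 : E) = _
  rw [EnvelopingAlgebra.tmul_smul, mul_one]

/-- In coefficients with respect to `1 ⊗ xⁿ` the inclusion is the shift operator at `x`, and
multiplication is evaluation at `x`; exactness then comes from the facts on sequences. -/
lemma kernelIncl_ofCoeff (hE : IsOreExtension σ.toAlgHom δ ι x) (g : ℕ →₀ E) :
    hE.kernelIncl (ofCoeff ι x σ g) = ofCoeff ι x AlgEquiv.refl (shiftSub x g) := by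
  induction g using Finsupp.induction_linear with
  | zero => simp
  | add g g' hg hg' => simp only [map_add, hg, hg']
  | single j e =>
    rw [ofCoeff_single, kernelIncl_mk, tmul_mul_kappa, shiftSub_single, map_sub, map_sub,
      ofCoeff_single, ofCoeff_single, pow_succ']

lemma inducedMul_ofCoeff (g : ℕ →₀ E) :
    inducedMul ι (ofCoeff ι x AlgEquiv.refl g) = evalRight x g := by
  induction g using Finsupp.induction_linear with
  | zero => simp
  | add g g' hg hg' => simp only [map_add, hg, hg']
  | single j e => rw [ofCoeff_single, inducedMul_mk_tmul, evalRight_single]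

lemma kernelIncl_injective (hE : IsOreExtension σ.toAlgHom δ ι x) :
    Function.Injective hE.kernelIncl := by
  intro y z h
  rw [← hE.ofCoeff_coeff σ y, ← hE.ofCoeff_coeff σ z, kernelIncl_ofCoeff, kernelIncl_ofCoeff] at h
  have h' := congrArg (hE.coeff AlgEquiv.refl) h
  rw [coeff_ofCoeff, coeff_ofCoeff] at h'
  rw [← hE.ofCoeff_coeff σ y, ← hE.ofCoeff_coeff σ z, shiftSub_injective x h']

lemma inducedMul_surjective : Function.Surjective (inducedMul ι) := fun e =>
  ⟨Induced.mk ι AlgEquiv.refl (e ⊗ₜ op 1), by rw [inducedMul_mk_tmul, mul_one]⟩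

lemma exact_kernelIncl (hE : IsOreExtension σ.toAlgHom δ ι x) :
    Function.Exact hE.kernelIncl (inducedMul ι) := by
  intro z
  constructor
  · intro hz
    rw [← hE.ofCoeff_coeff AlgEquiv.refl z, inducedMul_ofCoeff] at hz
    obtain ⟨f, hf⟩ := exists_shiftSub x (hE.coeff AlgEquiv.refl z)
    refine ⟨ofCoeff ι x σ f, ?_⟩
    rw [kernelIncl_ofCoeff, ← hE.ofCoeff_coeff AlgEquiv.refl z, hf, hz]
    simp
  · rintro ⟨y, rfl⟩
    rw [← hE.ofCoeff_coeff σ y, kernelIncl_ofCoeff, inducedMul_ofCoeff, evalRight_shiftSub]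

/-- The resolution of the induced bimodule obtained from a resolution of `A`. -/
abbrev inducedRes (hE : IsOreExtension σ.toAlgHom δ ι x) (Q : MatRes (EnvelopingAlgebra k A) A)
    (τ : A ≃ₐ[k] A) : MatRes (EnvelopingAlgebra k E) (Induced ι τ) :=
  Q.baseChange (twist ι τ) (bipow k x) (Induced.incl ι τ) (Induced.incl_smul ι τ)
    (hE.isDec_env_right τ) (hE.isDec_induced τ)

end IsOreExtension

/-! ### Homological smoothness of the Ore extension -/

section Smooth

variable {k : Type u} {A : Type v} {E : Type w} [CommRing k] [Ring A] [Algebra k A] [Ring E]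
  [Algebra k E] {σ : A ≃ₐ[k] A} {δ : A →ₗ[k] A} {ι : A →ₐ[k] E} {x : E}

lemma IsHomologicallySmooth.exists_matRes (h : IsHomologicallySmooth k A) :
    ∃ (Q : MatRes (EnvelopingAlgebra k A) A) (N : ℕ), Q.IsFiniteAt N := by
  obtain ⟨n, hn⟩ := HasFiniteProjectiveResolution.finRes (M := selfBimodule k A) h
  exact MatRes.exists_of_finRes (M := A) hn

/-- `E` is the cokernel of an injection between two induced bimodules, each with a resolution of
length `N + 1` by base change. -/
lemma IsOreExtension.isHomologicallySmooth (hE : IsOreExtension σ.toAlgHom δ ι x)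
    {Q : MatRes (EnvelopingAlgebra k A) A} {N : ℕ} (hQ : Q.IsFiniteAt N) :
    IsHomologicallySmooth k E := by
  have h : ∀ τ : A ≃ₐ[k] A, FinRes (EnvelopingAlgebra k E) (N + 1) (Induced ι τ) := fun τ =>
    MatRes.finRes_of_isFiniteAt (hE.inducedRes Q τ) (hQ.baseChange _ _ _ _ _ _)
  exact (FinRes.cokernel hE.kernelIncl (inducedMul ι) hE.kernelIncl_injective
    inducedMul_surjective hE.exact_kernelIncl (h σ)
    (h AlgEquiv.refl)).hasFiniteProjectiveResolution

end Smooth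

/-! ### Lifting semilinear maps to resolutions, and their action on cochains -/

namespace MatRes

section Lift

variable {R : Type u} [Ring R] {M : Type v} [AddCommGroup M] [Module R M] (Q : MatRes R M)

lemma exists_mul_D_zero {l : ℕ} (Z : Matrix (Fin l) (Fin (Q.rk 0)) R)
    (hZ : ∀ i, Fintype.linearCombination R Q.ε (Z i) = 0) : ∃ W, W * Q.D 0 = Z := by
  choose W hW using fun i => Q.exact_zero (Z i) (hZ i)
  exact ⟨Matrix.of W, by ext i j; exact congrFun (hW i) j⟩

lemma exists_mul_D_succ {l n : ℕ} (Z : Matrix (Fin l) (Fin (Q.rk (n + 1))) R)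
    (hZ : Z * Q.D n = 0) : ∃ W, W * Q.D (n + 1) = Z := by
  choose W hW using fun i => Q.exact_succ n (Z i) (congrFun hZ i)
  exact ⟨Matrix.of W, by ext i j; exact congrFun (hW i) j⟩

/-- The matrices `W n` give additive maps of the resolution, semilinear over `θ` up to the
correction `U`, that cover the values `g` on the generators. -/
structure IsLift (θ : R →+* R) (U : ∀ n, Matrix (Fin (Q.rk (n + 1))) (Fin (Q.rk n)) R)
    (g : Fin (Q.rk 0) → M) (W : ∀ n, Matrix (Fin (Q.rk n)) (Fin (Q.rk n)) R) : Prop where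
  zero : ∀ i, Fintype.linearCombination R Q.ε (W 0 i) = g i
  succ : ∀ n, W (n + 1) * Q.D n = U n + (Q.D n).map θ * W n

variable (θ : R →+* R) (U : ∀ n, Matrix (Fin (Q.rk (n + 1))) (Fin (Q.rk n)) R)

/-- The obstruction against extending a lift by one step. -/
def IsLiftable : ∀ n, Matrix (Fin (Q.rk n)) (Fin (Q.rk n)) R → Prop
  | 0, W => ∀ i, Fintype.linearCombination R Q.ε ((U 0 + (Q.D 0).map θ * W) i) = 0
  | n + 1, W => (U (n + 1) + (Q.D (n + 1)).map θ * W) * Q.D n = 0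

/-- Comparison theorem for maps that are merely additive. By `h₀` and `h`, the right side of the
equation for the next matrix always lies in the kernel of the preceding map, whichever solution was
chosen before. -/
lemma exists_isLift (g : Fin (Q.rk 0) → M)
    (h₀ : ∀ i, Fintype.linearCombination R Q.ε (U 0 i) +
      Fintype.linearCombination R g ((Q.D 0).map θ i) = 0)
    (h : ∀ n, U (n + 1) * Q.D n + (Q.D (n + 1)).map θ * U n = 0) :
    ∃ W, Q.IsLift θ U g W := by
  choose W₀ hW₀ using fun i => Q.ε_surj (g i)
  have hl₀ : Q.IsLiftable θ U 0 (Matrix.of W₀) := by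
    intro i
    rw [← h₀ i]
    refine (map_add (Fintype.linearCombination R Q.ε) (U 0 i) _).trans (congrArg _ ?_)
    have := linearCombination_vecMul (R := R) (Matrix.of W₀) Q.ε ((Q.D 0).map θ i)
    refine Eq.trans ?_ (this.trans ?_)
    · rfl
    · congr 2
      exact funext hW₀
  have hstep : ∀ n (W : Matrix (Fin (Q.rk n)) (Fin (Q.rk n)) R), Q.IsLiftable θ U n W →
      ∃ W' : Matrix (Fin (Q.rk (n + 1))) (Fin (Q.rk (n + 1))) R,
        W' * Q.D n = U n + (Q.D n).map θ * W := by
    intro n W hW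
    cases n with
    | zero => exact Q.exists_mul_D_zero _ hW
    | succ n => exact Q.exists_mul_D_succ _ hW
  have hsolv : ∀ n (W : Matrix (Fin (Q.rk n)) (Fin (Q.rk n)) R)
      (W' : Matrix (Fin (Q.rk (n + 1))) (Fin (Q.rk (n + 1))) R),
      W' * Q.D n = U n + (Q.D n).map θ * W → Q.IsLiftable θ U (n + 1) W' := by
    intro n W W' hW'
    rw [IsLiftable, Matrix.add_mul, Matrix.mul_assoc, hW', Matrix.mul_add, ← add_assoc, h, zero_add,
      ← Matrix.mul_assoc, ← Matrix.map_mul, Q.D_D, Matrix.map_zero _ (map_zero θ), Matrix.zero_mul]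
  choose next hnext using hstep
  let W : ∀ n, {W : Matrix (Fin (Q.rk n)) (Fin (Q.rk n)) R // Q.IsLiftable θ U n W} := fun n =>
    Nat.rec ⟨Matrix.of W₀, hl₀⟩ (fun n w => ⟨next n w.1 w.2, hsolv n _ _ (hnext n w.1 w.2)⟩) n
  exact ⟨fun n => (W n).1, hW₀, fun n => hnext n (W n).1 (W n).2⟩

end Lift

section Cochains

variable {R : Type u} [Ring R] {M : Type v} [AddCommGroup M] [Module R M] {Q : MatRes R M}

lemma IsCob.zero {n : ℕ} : Q.IsCob n 0 := by
  cases n with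
  | zero => rfl
  | succ n => exact ⟨0, Matrix.mulVec_zero _⟩

lemma IsCob.add {n : ℕ} {y z : Fin (Q.rk n) → R} (hy : Q.IsCob n y) (hz : Q.IsCob n z) :
    Q.IsCob n (y + z) := by
  cases n with
  | zero =>
    obtain rfl : y = 0 := hy
    simpa using hz
  | succ n =>
    obtain ⟨y, rfl⟩ := hy
    obtain ⟨z, rfl⟩ := hz
    exact ⟨y + z, Matrix.mulVec_add _ _ _⟩

lemma IsCob.neg {n : ℕ} {y : Fin (Q.rk n) → R} (hy : Q.IsCob n y) : Q.IsCob n (-y) := by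
  cases n with
  | zero =>
    obtain rfl : y = 0 := hy
    exact neg_zero
  | succ n =>
    obtain ⟨y, rfl⟩ := hy
    exact ⟨-y, Matrix.mulVec_neg _ _⟩

lemma IsCob.sub {n : ℕ} {y z : Fin (Q.rk n) → R} (hy : Q.IsCob n y) (hz : Q.IsCob n z) :
    Q.IsCob n (y - z) := by
  rw [sub_eq_add_neg]
  exact hy.add hz.neg

lemma rmul_sub {n : ℕ} (y z : Fin n → R) (r : R) : rmul (y - z) r = rmul y r - rmul z r :=
  funext fun _ => sub_mul _ _ _

lemma rmul_add {n : ℕ} (y : Fin n → R) (r s : R) : rmul y (r + s) = rmul y r + rmul y s :=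
  funext fun _ => mul_add _ _ _

lemma rmul_rmul {n : ℕ} (y : Fin n → R) (r s : R) : rmul (rmul y r) s = rmul y (r * s) :=
  funext fun _ => mul_assoc _ _ _

lemma rmul_one {n : ℕ} (y : Fin n → R) : rmul y 1 = y :=
  funext fun _ => mul_one _

lemma IsCob.rmul {n : ℕ} {y : Fin (Q.rk n) → R} (hy : Q.IsCob n y) (r : R) :
    Q.IsCob n (rmul y r) := by
  cases n with
  | zero =>
    obtain rfl : y = 0 := hy
    exact funext fun _ => zero_mul _
  | succ n =>
    obtain ⟨y, rfl⟩ := hy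
    exact ⟨_, mulVec_rmul _ _ _⟩

/-- The semilinear map on cochains induced by a lift. -/
def dualLift (θ : R ≃+* R) {n : ℕ} (W : Matrix (Fin (Q.rk n)) (Fin (Q.rk n)) R)
    (y : Fin (Q.rk n) → R) : Fin (Q.rk n) → R := fun i => θ.symm (W.mulVec y i)

lemma dualLift_rmul (θ : R ≃+* R) {n : ℕ} (W : Matrix (Fin (Q.rk n)) (Fin (Q.rk n)) R)
    (y : Fin (Q.rk n) → R) (r : R) :
    dualLift θ W (rmul y r) = rmul (dualLift θ W y) (θ.symm r) := by
  funext i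
  rw [dualLift, mulVec_rmul]
  exact map_mul _ _ _

lemma dualLift_sub (θ : R ≃+* R) {n : ℕ} (W : Matrix (Fin (Q.rk n)) (Fin (Q.rk n)) R)
    (y z : Fin (Q.rk n) → R) : dualLift θ W (y - z) = dualLift θ W y - dualLift θ W z := by
  funext i
  rw [dualLift, Matrix.mulVec_sub]
  exact map_sub _ _ _

lemma comp_mulVec {S : Type*} [Ring S] (f : R →+* S) {m n : ℕ} (B : Matrix (Fin m) (Fin n) R)
    (y : Fin n → R) : f ∘ B.mulVec y = (B.map f).mulVec (f ∘ y) := by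
  funext i
  simp [Matrix.mulVec, dotProduct]

/-- Without correction term, applying `θ⁻¹` to `W (n + 1) * D n = θ(D n) * W n` says that the dual
maps commute with the differentials. -/
lemma mulVec_dualLift {θ : R ≃+* R} {g : Fin (Q.rk 0) → M}
    {W : ∀ n, Matrix (Fin (Q.rk n)) (Fin (Q.rk n)) R} (hW : Q.IsLift θ.toRingHom 0 g W) (n : ℕ)
    (y : Fin (Q.rk n) → R) :
    (Q.D n).mulVec (dualLift θ (W n) y) = dualLift θ (W (n + 1)) ((Q.D n).mulVec y) := by
  have h := hW.succ n
  rw [Pi.zero_apply, zero_add] at h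
  have h₁ : dualLift θ (W (n + 1)) ((Q.D n).mulVec y) = θ.symm ∘ (W (n + 1) * Q.D n).mulVec y := by
    rw [← Matrix.mulVec_mulVec]
    rfl
  have h₂ : ((Q.D n).map θ.toRingHom).map θ.symm.toRingHom = Q.D n := by
    ext i j
    simp
  have h₃ := comp_mulVec θ.symm.toRingHom ((Q.D n).map θ.toRingHom) ((W n).mulVec y)
  rw [h₁, h, ← Matrix.mulVec_mulVec]
  refine Eq.trans ?_ h₃.symm
  rw [h₂]
  rfl

lemma IsCoc.dualLift {θ : R ≃+* R} {g : Fin (Q.rk 0) → M}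
    {W : ∀ n, Matrix (Fin (Q.rk n)) (Fin (Q.rk n)) R} (hW : Q.IsLift θ.toRingHom 0 g W) {n : ℕ}
    {y : Fin (Q.rk n) → R} (hy : Q.IsCoc n y) : Q.IsCoc n (dualLift θ (W n) y) := by
  rw [IsCoc, mulVec_dualLift hW, hy]
  funext i
  simp [MatRes.dualLift]

lemma IsCob.dualLift {θ : R ≃+* R} {g : Fin (Q.rk 0) → M}
    {W : ∀ n, Matrix (Fin (Q.rk n)) (Fin (Q.rk n)) R} (hW : Q.IsLift θ.toRingHom 0 g W) {n : ℕ}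
    {y : Fin (Q.rk n) → R} (hy : Q.IsCob n y) : Q.IsCob n (dualLift θ (W n) y) := by
  cases n with
  | zero =>
    obtain rfl : y = 0 := hy
    funext i
    simp [MatRes.dualLift]
  | succ n =>
    obtain ⟨z, rfl⟩ := hy
    exact ⟨_, mulVec_dualLift hW n z⟩

end Cochains

/-- Lifts of mutually inverse semilinear maps induce mutually inverse maps on cohomology. -/
lemma isCob_dualLift_dualLift {R : Type v} [Ring R] {M : ModuleCat.{v} R} {Q : MatRes R M}
    {θ : R ≃+* R} {g g' : M →+ M} (hg' : ∀ r m, g' (r • m) = θ.symm r • g' m)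
    (hgg : ∀ m, g' (g m) = m)
    {W W' : ∀ n, Matrix (Fin (Q.rk n)) (Fin (Q.rk n)) R}
    (hW : Q.IsLift θ.toRingHom 0 (fun i => g (Q.ε i)) W)
    (hW' : Q.IsLift θ.symm.toRingHom 0 (fun i => g' (Q.ε i)) W') {n : ℕ}
    {y : Fin (Q.rk n) → R} (hy : Q.IsCoc n y) :
    Q.IsCob n (dualLift θ (W n) (dualLift θ.symm (W' n) y) - y) := by
  -- The two twists cancel, so `K` is an honestly linear lift of `g' ∘ g = id` and induces the
  -- identity on `Ext`.
  let K : ∀ n, Matrix (Fin (Q.rk n)) (Fin (Q.rk n)) R := fun n =>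
    (W n).map θ.symm.toRingHom * W' n
  have hθ : ∀ {m n} (B : Matrix (Fin m) (Fin n) R),
      (B.map θ.toRingHom).map θ.symm.toRingHom = B := fun B => by
    ext i j
    simp
  have hK : ∀ n, Q.D n * K n = K (n + 1) * Q.D n := by
    intro n
    have h := hW.succ n
    have h' := hW'.succ n
    rw [Pi.zero_apply, zero_add] at h h'
    simp only [K]
    rw [Matrix.mul_assoc, h', ← Matrix.mul_assoc, ← Matrix.mul_assoc, ← Matrix.map_mul, h,
      Matrix.map_mul, hθ]
  have hK₀ : ∀ i, Fintype.linearCombination R Q.ε (K 0 i) = (𝟙 M : M ⟶ M).hom (Q.ε i) := by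
    intro i
    have h₁ := linearCombination_vecMul (W' 0) Q.ε ((W 0).map θ.symm.toRingHom i)
    have h₂ := congrArg g' (hW.zero i)
    rw [hgg] at h₂
    refine Eq.trans ?_ (h₁.trans (Eq.trans ?_ h₂))
    · rfl
    · rw [funext hW'.zero]
      simp [Fintype.linearCombination_apply, hg']
  have hKy : dualLift θ (W n) (dualLift θ.symm (W' n) y) = (K n).mulVec y := by
    simp only [K]
    rw [← Matrix.mulVec_mulVec]
    have h₃ := comp_mulVec θ.symm.toRingHom (W n) (dualLift θ.symm (W' n) y)
    refine Eq.trans h₃ (congrArg _ ?_)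
    funext i
    simp [dualLift]
  have hcoc : Q.IsCoc n ((K n).mulVec y) := by
    rw [IsCoc, Matrix.mulVec_mulVec, hK, ← Matrix.mulVec_mulVec, hy, Matrix.mulVec_zero]
  have hcls := mk₀_comp_cls (𝟙 M) K hK₀ hK y hy hcoc
  rw [Abelian.Ext.mk₀_id_comp] at hcls
  have hsub : Q.IsCoc n ((K n).mulVec y - y) := by
    rw [IsCoc, Matrix.mulVec_sub, hcoc, hy, sub_zero]
  rw [hKy, ← Q.cls_eq_zero_iff _ hsub]
  have hadd := Q.cls_add _ _ hsub hy
  simp only [sub_add_cancel] at hadd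
  rw [← hcls] at hadd
  simpa using hadd.symm

end MatRes

lemma MatRes.cls_eq_iff {R : Type v} [Ring R] {M : ModuleCat.{v} R} (Q : MatRes R M) {n : ℕ}
    {y z : Fin (Q.rk n) → R} (hy : Q.IsCoc n y) (hz : Q.IsCoc n z) :
    Q.cls y hy = Q.cls z hz ↔ Q.IsCob n (y - z) := by
  have hsub : Q.IsCoc n (y - z) := by
    rw [IsCoc, Matrix.mulVec_sub, hy, hz, sub_zero]
  have hadd := Q.cls_add _ _ hsub hz
  simp only [sub_add_cancel] at hadd
  rw [← Q.cls_eq_zero_iff _ hsub, hadd, add_eq_right]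

/-! ### The generator of the dual cohomology -/

section Dual

variable {k : Type u} {A : Type v} [CommRing k] [Ring A] [Algebra k A]

/-- The cocycle `t` generates the cohomology of the dual of the resolution `Q`, which is
concentrated in degree `d` and isomorphic to `A^ν`. -/
structure IsDualGenerator (Q : MatRes (EnvelopingAlgebra k A) A) (ν : A ≃ₐ[k] A) (d : ℕ)
    (t : Fin (Q.rk d) → EnvelopingAlgebra k A) : Prop where
  vanish : ∀ i, i ≠ d → ∀ y, Q.IsCoc i y → Q.IsCob i y
  isCoc : Q.IsCoc d t
  gen : ∀ y, Q.IsCoc d y → ∃ a : A, Q.IsCob d (y - MatRes.rmul t (1 ⊗ₜ op a))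
  free : ∀ a : A, Q.IsCob d (MatRes.rmul t (1 ⊗ₜ op a)) → a = 0
  twist : ∀ b : A, Q.IsCob d (MatRes.rmul t (b ⊗ₜ op 1) - MatRes.rmul t (1 ⊗ₜ op (ν b)))

/-- `t` represents the class that corresponds to `1 ∈ A^ν`; then `t (b ⊗ a)` represents `a ν(b)`,
from which all the properties are read off. -/
lemma IsTwistedCalabiYau.exists_isDualGenerator {ν : A ≃ₐ[k] A} {d : ℕ}
    (hA : IsTwistedCalabiYau k ν d) (Q : MatRes (EnvelopingAlgebra k A) A) :
    ∃ t, IsDualGenerator Q ν d t := by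
  obtain ⟨φ, hφ⟩ := hA.ext_iso
  let cl : ∀ {n : ℕ} (y : Fin (Q.rk n) → EnvelopingAlgebra k A), Q.IsCoc n y →
      ExtEnveloping k A n := fun y hy => MatRes.cls (M := selfBimodule k A) Q y hy
  have hzero : ∀ {n : ℕ} (y : Fin (Q.rk n) → EnvelopingAlgebra k A) (hy : Q.IsCoc n y),
      cl y hy = 0 ↔ Q.IsCob n y := fun y hy =>
    MatRes.cls_eq_zero_iff (M := selfBimodule k A) Q y hy
  have heq : ∀ {n : ℕ} (y z : Fin (Q.rk n) → EnvelopingAlgebra k A) (hy : Q.IsCoc n y)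
      (hz : Q.IsCoc n z), cl y hy = cl z hz ↔ Q.IsCob n (y - z) := fun y z hy hz =>
    MatRes.cls_eq_iff (M := selfBimodule k A) Q hy hz
  have hbi : ∀ {n : ℕ} (y : Fin (Q.rk n) → EnvelopingAlgebra k A) (hy : Q.IsCoc n y) (a b : A),
      cl (MatRes.rmul y (b ⊗ₜ op a)) (MatRes.IsCoc.rmul (M := selfBimodule k A) hy _) =
        ExtEnveloping.biact a b (cl y hy) := fun y hy a b =>
    MatRes.cls_rmul (M := selfBimodule k A) Q y hy _
  obtain ⟨t, ht, hcl⟩ := MatRes.cls_surjective (M := selfBimodule k A) Q (φ.symm 1)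
  have hcl' : φ (cl t ht) = 1 := (congrArg φ hcl).trans (φ.apply_symm_apply 1)
  have hval : ∀ a b : A, φ (cl (MatRes.rmul t (b ⊗ₜ op a))
      (MatRes.IsCoc.rmul (M := selfBimodule k A) ht _)) = a * ν b := fun a b => by
    rw [hbi t ht, hφ, hcl', mul_one]
  refine ⟨t, ?_, ht, ?_, ?_, ?_⟩
  · intro i hi y hy
    have := hA.ext_subsingleton i hi
    exact (hzero y hy).1 (Subsingleton.elim _ _)
  · intro y hy
    refine ⟨φ (cl y hy), ?_⟩
    rw [← heq y _ hy (MatRes.IsCoc.rmul (M := selfBimodule k A) ht _)]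
    apply φ.injective
    rw [hval, map_one, mul_one]
  · intro a ha
    rw [← hzero _ (MatRes.IsCoc.rmul (M := selfBimodule k A) ht _)] at ha
    have := hval a 1
    rw [show (1 : A) ⊗ₜ[k] op a = (1 ⊗ₜ op a : EnvelopingAlgebra k A) from rfl, ha] at this
    simpa using this.symm
  · intro b
    rw [← heq _ _ (MatRes.IsCoc.rmul (M := selfBimodule k A) ht _)
      (MatRes.IsCoc.rmul (M := selfBimodule k A) ht _)]
    apply φ.injective
    rw [hval, hval, map_one, mul_one, one_mul]

/-- The automorphism `σ ⊗ σ`. -/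
def envEquiv (σ : A ≃ₐ[k] A) : EnvelopingAlgebra k A ≃+* EnvelopingAlgebra k A :=
  RingEquiv.ofRingHom (envMap σ.toAlgHom σ.toAlgHom).toRingHom
    (envMap σ.symm.toAlgHom σ.symm.toAlgHom).toRingHom
    (by
      refine RingHom.ext fun z => ?_
      induction z using EnvelopingAlgebra.induction_on with
      | add y z hy hz => rw [map_add, hy, hz, map_add]
      | tmul a b => simp)
    (by
      refine RingHom.ext fun z => ?_
      induction z using EnvelopingAlgebra.induction_on with
      | add y z hy hz => rw [map_add, hy, hz, map_add]
      | tmul a b => simp)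

@[simp]
lemma envEquiv_tmul (σ : A ≃ₐ[k] A) (a b : A) :
    envEquiv σ (a ⊗ₜ op b) = σ a ⊗ₜ op (σ b) := rfl

lemma envEquiv_symm (σ : A ≃ₐ[k] A) : (envEquiv σ).symm = envEquiv σ.symm := rfl

lemma envEquiv_smul (σ : A ≃ₐ[k] A) (r : EnvelopingAlgebra k A) (m : A) :
    σ (r • m) = envEquiv σ r • σ m := by
  induction r using EnvelopingAlgebra.induction_on with
  | add y z hy hz => simp only [add_smul, map_add, hy, hz]
  | tmul a b =>
    rw [envEquiv_tmul, EnvelopingAlgebra.tmul_smul, EnvelopingAlgebra.tmul_smul, map_mul, map_mul]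

lemma exists_isLift_envEquiv (Q : MatRes (EnvelopingAlgebra k A) A) (σ : A ≃ₐ[k] A) :
    ∃ W, Q.IsLift (envEquiv σ).toRingHom 0 (fun i => σ (Q.ε i)) W := by
  refine Q.exists_isLift _ _ _ (fun i => ?_) (fun n => ?_)
  · have h := congrArg σ (Q.D_ε i)
    rw [map_zero] at h
    refine Eq.trans ?_ h
    rw [Pi.zero_apply]
    refine (congrArg (· + _) (map_zero (Fintype.linearCombination _ Q.ε))).trans ?_
    simp [Fintype.linearCombination_apply, envEquiv_smul]
  · simp

/-- An automorphism acts on the generator of the dual cohomology through a unit. -/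
lemma IsDualGenerator.exists_unit {Q : MatRes (EnvelopingAlgebra k A) A} {ν : A ≃ₐ[k] A} {d : ℕ}
    {t : Fin (Q.rk d) → EnvelopingAlgebra k A} (ht : IsDualGenerator Q ν d t) {σ : A ≃ₐ[k] A}
    {W : ∀ n, Matrix (Fin (Q.rk n)) (Fin (Q.rk n)) (EnvelopingAlgebra k A)}
    (hW : Q.IsLift (envEquiv σ).toRingHom 0 (fun i => σ (Q.ε i)) W) :
    ∃ u : Aˣ, Q.IsCob d (MatRes.dualLift (envEquiv σ) (W d) t -
      MatRes.rmul t (1 ⊗ₜ op (u : A))) := by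
  obtain ⟨W', hW'⟩ := exists_isLift_envEquiv Q σ.symm
  obtain ⟨a, ha⟩ := ht.gen _ (ht.isCoc.dualLift hW)
  obtain ⟨b, hb⟩ := ht.gen _ (ht.isCoc.dualLift hW')
  -- The lifts of `τ` and `τ⁻¹` compose to the identity on cohomology, whereas semilinearity sends
  -- `t` to `t (1 ⊗ τ⁻¹(b) a)`. Used for `σ` and for `σ⁻¹`, this gives both one-sided inverses.
  have key : ∀ {τ : A ≃ₐ[k] A}
      {V V' : ∀ n, Matrix (Fin (Q.rk n)) (Fin (Q.rk n)) (EnvelopingAlgebra k A)},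
      Q.IsLift (envEquiv τ).toRingHom 0 (fun i => τ (Q.ε i)) V →
      Q.IsLift (envEquiv τ.symm).toRingHom 0 (fun i => τ.symm (Q.ε i)) V' → ∀ {a b : A},
      Q.IsCob d (MatRes.dualLift (envEquiv τ) (V d) t - MatRes.rmul t (1 ⊗ₜ op a)) →
      Q.IsCob d (MatRes.dualLift (envEquiv τ.symm) (V' d) t - MatRes.rmul t (1 ⊗ₜ op b)) →
      τ.symm b * a = 1 := by
    intro τ V V' hV hV' a b ha hb
    have h₁ := MatRes.isCob_dualLift_dualLift (M := ModuleCat.of (EnvelopingAlgebra k A) A)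
      (θ := envEquiv τ) (g := (τ : A →+ A)) (g' := (τ.symm : A →+ A))
      (fun r m => envEquiv_smul τ.symm r m)
      (fun m => τ.symm_apply_apply m) hV hV' ht.isCoc
    have h₂ := hb.dualLift hV
    rw [MatRes.dualLift_sub, MatRes.dualLift_rmul, envEquiv_symm, envEquiv_tmul, map_one] at h₂
    have h₃ := ha.rmul (1 ⊗ₜ op (τ.symm b))
    rw [MatRes.rmul_sub, MatRes.rmul_rmul, EnvelopingAlgebra.tmul_mul_tmul, mul_one] at h₃
    have h₄ := (h₁.sub h₂).sub h₃
    have h₅ := ht.free (1 - τ.symm b * a) (by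
      have := h₄.neg
      rw [MulOpposite.op_sub, TensorProduct.tmul_sub, sub_eq_add_neg, MatRes.rmul_add]
      convert this using 1
      have hneg : MatRes.rmul t (-(1 ⊗ₜ[k] op (τ.symm b * a)) : EnvelopingAlgebra k A) =
          - MatRes.rmul t (1 ⊗ₜ[k] op (τ.symm b * a)) :=
        funext fun i => mul_neg (t i) (1 ⊗ₜ[k] op (τ.symm b * a) : EnvelopingAlgebra k A)
      have hone : MatRes.rmul t (1 ⊗ₜ[k] op 1 : EnvelopingAlgebra k A) = t := MatRes.rmul_one t
      rw [hneg, hone, envEquiv_symm]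
      abel)
    exact (sub_eq_zero.1 h₅).symm
  have h₁ : σ.symm b * a = 1 := key hW hW' ha hb
  have h₂ : σ a * b = 1 := key hW' hW hb ha
  have h₃ : a * σ.symm b = 1 := by
    have := congrArg σ.symm h₂
    simpa using this
  exact ⟨⟨a, σ.symm b, h₃, h₁⟩, ha⟩

end Dual

/-! ### Lifting a skew derivation to a resolution -/

section SkewDerivations

variable {k : Type u} {A : Type v} [CommRing k] [Ring A] [Algebra k A]

/-- The automorphism `σ ⊗ 1`. -/
def envLeft (σ : A ≃ₐ[k] A) : EnvelopingAlgebra k A ≃+* EnvelopingAlgebra k A :=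
  RingEquiv.ofRingHom (envMap σ.toAlgHom (AlgHom.id k A)).toRingHom
    (envMap σ.symm.toAlgHom (AlgHom.id k A)).toRingHom
    (by
      refine RingHom.ext fun z => ?_
      induction z using EnvelopingAlgebra.induction_on with
      | add y z hy hz => rw [map_add, hy, hz, map_add]
      | tmul a b => simp)
    (by
      refine RingHom.ext fun z => ?_
      induction z using EnvelopingAlgebra.induction_on with
      | add y z hy hz => rw [map_add, hy, hz, map_add]
      | tmul a b => simp)

@[simp]
lemma envLeft_tmul (σ : A ≃ₐ[k] A) (a b : A) :
    envLeft σ (a ⊗ₜ op b) = σ a ⊗ₜ op b := rfl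

/-- The map `δ ⊗ 1`. -/
def derivLeft (δ : A →ₗ[k] A) : EnvelopingAlgebra k A →+ EnvelopingAlgebra k A :=
  (TensorProduct.map δ (LinearMap.id : Aᵐᵒᵖ →ₗ[k] Aᵐᵒᵖ)).toAddMonoidHom

@[simp]
lemma derivLeft_tmul (δ : A →ₗ[k] A) (a b : A) :
    derivLeft δ (a ⊗ₜ op b) = δ a ⊗ₜ op b := rfl

/-- The map `σ ⊗ δ`. -/
def derivRight (σ : A ≃ₐ[k] A) (δ : A →ₗ[k] A) : EnvelopingAlgebra k A →+ EnvelopingAlgebra k A :=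
  (TensorProduct.map σ.toLinearMap (opMap k δ)).toAddMonoidHom

@[simp]
lemma derivRight_tmul (σ : A ≃ₐ[k] A) (δ : A →ₗ[k] A) (a b : A) :
    derivRight σ δ (a ⊗ₜ op b) = σ a ⊗ₜ op (δ b) := rfl

variable {σ : A ≃ₐ[k] A} {δ : A →ₗ[k] A}

lemma derivLeft_mul (hδ : IsSkewDerivation σ.toAlgHom δ) (r s : EnvelopingAlgebra k A) :
    derivLeft δ (r * s) = derivLeft δ r * s + envLeft σ r * derivLeft δ s := by
  induction r using EnvelopingAlgebra.induction_on with
  | add y z hy hz => simp only [add_mul, map_add, hy, hz]; abel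
  | tmul a b =>
    induction s using EnvelopingAlgebra.induction_on with
    | add y z hy hz => simp only [mul_add, map_add, hy, hz]; abel
    | tmul c d =>
      simp only [EnvelopingAlgebra.tmul_mul_tmul, derivLeft_tmul, envLeft_tmul, hδ a c,
        TensorProduct.add_tmul]
      rfl

lemma derivRight_mul (hδ : IsSkewDerivation σ.toAlgHom δ) (r s : EnvelopingAlgebra k A) :
    derivRight σ δ (r * s) =
      derivRight σ δ r * envEquiv σ s + envLeft σ r * derivRight σ δ s := by
  induction r using EnvelopingAlgebra.induction_on with
  | add y z hy hz => simp only [add_mul, map_add, hy, hz]; abel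
  | tmul a b =>
    induction s using EnvelopingAlgebra.induction_on with
    | add y z hy hz => simp only [mul_add, map_add, hy, hz]; abel
    | tmul c d =>
      simp only [EnvelopingAlgebra.tmul_mul_tmul, derivRight_tmul, envLeft_tmul, envEquiv_tmul,
        hδ d b, MulOpposite.op_add, TensorProduct.tmul_add, map_mul]
      exact add_comm _ _

/-- The middle term involves `σ m`: `δ` is not semilinear up to terms in `m` alone. Hence the lift
of `δ` needs the lift `P` of `σ` in its correction. -/
lemma skewDerivation_smul (hδ : IsSkewDerivation σ.toAlgHom δ) (r : EnvelopingAlgebra k A) (m : A) :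
    δ (r • m) = derivLeft δ r • m + derivRight σ δ r • σ m + envLeft σ r • δ m := by
  induction r using EnvelopingAlgebra.induction_on with
  | add y z hy hz => simp only [add_smul, map_add, hy, hz]; abel
  | tmul a b =>
    simp only [derivLeft_tmul, derivRight_tmul, envLeft_tmul, EnvelopingAlgebra.tmul_smul]
    rw [mul_assoc, hδ, hδ, mul_add]
    change _ + (σ a * _ + σ a * (σ m * _)) = _
    simp only [mul_assoc]
    abel

/-- The correction in the lift of a skew derivation to a resolution. -/
def derivCorrection (σ : A ≃ₐ[k] A) (δ : A →ₗ[k] A) (Q : MatRes (EnvelopingAlgebra k A) A)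
    (P : ∀ n, Matrix (Fin (Q.rk n)) (Fin (Q.rk n)) (EnvelopingAlgebra k A)) (n : ℕ) :
    Matrix (Fin (Q.rk (n + 1))) (Fin (Q.rk n)) (EnvelopingAlgebra k A) :=
  (Q.D n).map (derivLeft δ) + (Q.D n).map (derivRight σ δ) * P n

lemma exists_isLift_skewDerivation (hδ : IsSkewDerivation σ.toAlgHom δ)
    (Q : MatRes (EnvelopingAlgebra k A) A)
    {P : ∀ n, Matrix (Fin (Q.rk n)) (Fin (Q.rk n)) (EnvelopingAlgebra k A)}
    (hP : Q.IsLift (envEquiv σ).toRingHom 0 (fun i => σ (Q.ε i)) P) :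
    ∃ W, Q.IsLift (envLeft σ).toRingHom (derivCorrection σ δ Q P) (fun i => δ (Q.ε i)) W := by
  refine Q.exists_isLift _ _ _ (fun i => ?_) (fun n => ?_)
  · have h := congrArg δ (Q.D_ε i)
    rw [map_zero, Fintype.linearCombination_apply, map_sum] at h
    simp only [skewDerivation_smul hδ, Finset.sum_add_distrib] at h
    rw [← h]
    refine congrArg₂ (· + ·) ?_ ?_
    · refine (map_add (Fintype.linearCombination _ Q.ε) _ _).trans (congrArg₂ (· + ·) ?_ ?_)
      · exact Fintype.linearCombination_apply _ _ _
      · refine (MatRes.linearCombination_vecMul (P 0) Q.ε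
          ((Q.D 0).map (derivRight σ δ) i)).trans ?_
        rw [funext hP.zero]
        exact Fintype.linearCombination_apply _ _ _
    · exact Fintype.linearCombination_apply _ _ _
  · have h := hP.succ n
    rw [Pi.zero_apply, zero_add] at h
    simp only [derivCorrection]
    rw [Matrix.add_mul, Matrix.mul_assoc, h, Matrix.mul_add, ← Matrix.mul_assoc,
      ← Matrix.mul_assoc]
    -- Compatibility of the correction comes from applying `δ ⊗ 1` and `σ ⊗ δ` to `D (n + 1) * D n =
    -- 0`.
    have h₁ : (Q.D (n + 1)).map (derivLeft δ) * Q.D n +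
        (Q.D (n + 1)).map (envLeft σ) * (Q.D n).map (derivLeft δ) = 0 := by
      ext i j
      have := congrArg (derivLeft δ) (congrFun (congrFun (Q.D_D n) i) j)
      simp only [Matrix.mul_apply, map_sum, derivLeft_mul hδ, Finset.sum_add_distrib] at this
      simpa [Matrix.mul_apply] using this
    have h₂ : (Q.D (n + 1)).map (derivRight σ δ) * (Q.D n).map (envEquiv σ) +
        (Q.D (n + 1)).map (envLeft σ) * (Q.D n).map (derivRight σ δ) = 0 := by
      ext i j
      have := congrArg (derivRight σ δ) (congrFun (congrFun (Q.D_D n) i) j)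
      simp only [Matrix.mul_apply, map_sum, derivRight_mul hδ, Finset.sum_add_distrib] at this
      simpa [Matrix.mul_apply] using this
    have h₃ := congrArg (· * P n) h₂
    simp only [Matrix.add_mul, Matrix.zero_mul] at h₃
    have h₄ := congrArg₂ (· + ·) h₁ h₃
    simp only [add_zero] at h₄
    rw [← h₄]
    exact add_add_add_comm _ _ _ _

end SkewDerivations

/-! ### The lift of the kernel inclusion to the resolutions -/

namespace IsOreExtension

variable {k : Type u} {A : Type v} {E : Type w} [CommRing k] [Ring A] [Algebra k A] [Ring E]
  [Algebra k E] {σ : A ≃ₐ[k] A} {δ : A →ₗ[k] A} {ι : A →ₐ[k] E} {x : E}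

/-- This and the next two lemmas supply the rules `hX`, `hY`, `hη` for moving `x ⊗ 1` and `1 ⊗ x`
past `Aᵉ`. -/
lemma left_mul_twist (hE : IsOreExtension σ.toAlgHom δ ι x) (r : EnvelopingAlgebra k A) :
    (x ⊗ₜ op 1) * twist ι AlgEquiv.refl r =
      twist ι σ r * (x ⊗ₜ op 1) + twist ι AlgEquiv.refl (derivLeft δ r) := by
  induction r using EnvelopingAlgebra.induction_on with
  | add y z hy hz => simp only [mul_add, add_mul, map_add, hy, hz]; abel
  | tmul a b =>
    simp only [twist_tmul, derivLeft_tmul, EnvelopingAlgebra.tmul_mul_tmul, AlgEquiv.coe_refl,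
      id_eq, hE.x_mul, TensorProduct.add_tmul, one_mul, mul_one]
    rfl

lemma twist_mul_right (hE : IsOreExtension σ.toAlgHom δ ι x) (r : EnvelopingAlgebra k A) :
    twist ι σ r * (1 ⊗ₜ op x) =
      (1 ⊗ₜ op x) * twist ι AlgEquiv.refl (envEquiv σ r) +
        twist ι AlgEquiv.refl (derivRight σ δ r) := by
  induction r using EnvelopingAlgebra.induction_on with
  | add y z hy hz => simp only [mul_add, add_mul, map_add, hy, hz]; abel
  | tmul a b =>
    simp only [twist_tmul, derivRight_tmul, envEquiv_tmul, EnvelopingAlgebra.tmul_mul_tmul,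
      AlgEquiv.coe_refl, id_eq, hE.x_mul, TensorProduct.tmul_add, MulOpposite.op_add, one_mul,
      mul_one]
    rfl

lemma twist_envLeft (r : EnvelopingAlgebra k A) :
    twist ι AlgEquiv.refl (envLeft σ r) = twist ι σ r := by
  induction r using EnvelopingAlgebra.induction_on with
  | add y z hy hz => simp only [map_add, hy, hz]
  | tmul a b => rfl

end IsOreExtension

section KernelMat

variable {R : Type*} {S : Type*} [Ring R] [Ring S]

lemma Matrix.mul_smul_eq_map_mul {l m n : ℕ} (M : Matrix (Fin l) (Fin m) S)
    (s : S) (N : Matrix (Fin m) (Fin n) S) : M * (s • N) = M.map (· * s) * N := by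
  ext i j
  simp [Matrix.mul_apply, mul_assoc]

/-- The matrix `X - Y P - W`, with coefficients extended along `φ`. -/
def kernelMat (φ : R →+* S) (X Y : S) {m : ℕ} (P W : Matrix (Fin m) (Fin m) R) :
    Matrix (Fin m) (Fin m) S :=
  X • 1 - Y • P.map φ - W.map φ

variable {φ ψ : R →+* S} {X Y : S} {θ η : R ≃+* R} {δ₁ δ₂ : R →+ R}

/-- Moving `X` and `Y` to the left of `D` produces the terms `δ₁ D` and `δ₂ D * P`; together with `η
D * W` they are exactly the right side of `hW`. -/
lemma map_mul_kernelMat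
    (hX : ∀ r, X * φ r = ψ r * X + φ (δ₁ r))
    (hY : ∀ r, ψ r * Y = Y * φ (θ r) + φ (δ₂ r)) (hη : ∀ r, φ (η r) = ψ r)
    {m n : ℕ} {D : Matrix (Fin n) (Fin m) R} {P W : Matrix (Fin m) (Fin m) R}
    {P' W' : Matrix (Fin n) (Fin n) R} (hP : P' * D = D.map θ * P)
    (hW : W' * D = D.map δ₁ + D.map δ₂ * P + D.map η * W) :
    D.map ψ * kernelMat φ X Y P W = kernelMat φ X Y P' W' * D.map φ := by
  have hX : (D.map ψ).map (· * X) = X • D.map φ - (D.map δ₁).map φ := by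
    ext i j
    simp [hX]
  have hY : (D.map ψ).map (· * Y) = Y • (D.map θ).map φ + (D.map δ₂).map φ := by
    ext i j
    simp [hY]
  have hη : D.map ψ = (D.map η).map φ := by
    ext i j
    simp [hη]
  have h₁ := congrArg (fun M => M.map φ) hP
  have h₂ := congrArg (fun M => M.map φ) hW
  simp only [Matrix.map_mul, Matrix.map_add _ (map_add φ)] at h₁ h₂
  simp only [kernelMat, Matrix.mul_sub, Matrix.sub_mul, Matrix.smul_mul, Matrix.one_mul]
  rw [h₁, h₂, Matrix.mul_smul_eq_map_mul, Matrix.mul_smul_eq_map_mul, hX, hY, Matrix.mul_one,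
    Matrix.add_mul, Matrix.smul_mul, hη]
  abel

lemma kernelMat_mulVec
    (hX : ∀ r, X * φ r = ψ r * X + φ (δ₁ r))
    (hY : ∀ r, ψ r * Y = Y * φ (θ r) + φ (δ₂ r)) (hη : ∀ r, φ (η r) = ψ r)
    {n : ℕ} {P W : Matrix (Fin n) (Fin n) R} (t : Fin n → R) :
    ∃ h, (kernelMat φ X Y P W).mulVec (φ ∘ t) =
      MatRes.rmul (ψ ∘ t) X - MatRes.rmul (ψ ∘ fun i => θ.symm (P.mulVec t i)) Y - ψ ∘ h := by
  -- Moving `X` and `Y` to the right of the entries leaves terms with values in `φ(R)`, which `η⁻¹`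
  -- rewrites as values of `ψ`.
  refine ⟨fun i => η.symm (W.mulVec t i - δ₁ (t i) - δ₂ (θ.symm (P.mulVec t i))), ?_⟩
  funext i
  have h₁ := congrFun (MatRes.comp_mulVec φ P t) i
  have h₂ := congrFun (MatRes.comp_mulVec φ W t) i
  simp only [Function.comp_apply] at h₁ h₂
  simp only [kernelMat, Matrix.sub_mulVec, Matrix.smul_mulVec, Matrix.one_mulVec, Pi.sub_apply,
    Pi.smul_apply, smul_eq_mul, MatRes.rmul, Function.comp_apply, ← h₁, ← h₂, hX, hY]
  rw [← hη (η.symm _), RingEquiv.apply_symm_apply, RingEquiv.apply_symm_apply]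
  simp only [map_sub]
  abel

lemma linearCombination_kernelMat {M N : Type*} [AddCommGroup M] [Module R M] [AddCommGroup N]
    [Module S N] (i : M →+ N) (hi : ∀ r m, i (r • m) = φ r • i m) {n : ℕ} (e : Fin n → M)
    {P W : Matrix (Fin n) (Fin n) R} (j : Fin n) :
    Fintype.linearCombination S (fun l => i (e l)) (kernelMat φ X Y P W j) =
      X • i (e j) - Y • i (Fintype.linearCombination R e (P j)) -
        i (Fintype.linearCombination R e (W j)) := by
  simp only [Fintype.linearCombination_apply, map_sum, hi, kernelMat, Matrix.sub_apply,
    Matrix.smul_apply, Matrix.map_apply, sub_smul, Finset.sum_sub_distrib, smul_eq_mul, mul_smul,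
    ← Finset.smul_sum]
  congr 3
  simp [Matrix.one_apply]

end KernelMat

namespace IsOreExtension

variable {k : Type u} {A : Type v} {E : Type w} [CommRing k] [Ring A] [Algebra k A] [Ring E]
  [Algebra k E] {σ : A ≃ₐ[k] A} {δ : A →ₗ[k] A} {ι : A →ₐ[k] E} {x : E}

lemma twist_injective (hE : IsOreExtension σ.toAlgHom δ ι x) (τ : A ≃ₐ[k] A) :
    Function.Injective (twist ι τ) := by
  intro r s h
  have hpow : bipow k x (0, 0) = 1 := by simp [bipow, Algebra.TensorProduct.one_def]
  have := @(hE.isDec_env_left τ).1 (Finsupp.single (0, 0) r) (Finsupp.single (0, 0) s)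
    (by simp [hpow, h])
  exact Finsupp.single_injective _ this

lemma isCob_twist (hE : IsOreExtension σ.toAlgHom δ ι x) {Q : MatRes (EnvelopingAlgebra k A) A}
    (τ : A ≃ₐ[k] A) {n : ℕ} {y : Fin (Q.rk n) → EnvelopingAlgebra k A} (hy : Q.IsCob n y) :
    (hE.inducedRes Q τ).IsCob n (twist ι τ ∘ y) := by
  cases n with
  | zero =>
    obtain rfl : y = 0 := hy
    exact funext fun _ => map_zero _
  | succ n =>
    obtain ⟨z, rfl⟩ := hy
    exact ⟨twist ι τ ∘ z, (MatRes.comp_mulVec (twist ι τ) (Q.D n) z).symm⟩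

lemma isCoc_twist_iff (hE : IsOreExtension σ.toAlgHom δ ι x)
    {Q : MatRes (EnvelopingAlgebra k A) A} (τ : A ≃ₐ[k] A) {n : ℕ}
    {y : Fin (Q.rk n) → EnvelopingAlgebra k A} :
    (hE.inducedRes Q τ).IsCoc n (twist ι τ ∘ y) ↔ Q.IsCoc n y := by
  have h : ((hE.inducedRes Q τ).D n).mulVec (twist ι τ ∘ y) = twist ι τ ∘ (Q.D n).mulVec y :=
    (MatRes.comp_mulVec (twist ι τ) (Q.D n) y).symm
  rw [MatRes.IsCoc, MatRes.IsCoc]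
  refine ⟨fun hy => ?_, fun hy => ?_⟩
  · rw [h] at hy
    exact funext fun i => hE.twist_injective τ ((congrFun hy i).trans (map_zero _).symm)
  · rw [h, hy]
    exact funext fun _ => map_zero _

lemma isCob_twist_sub_rmul (hE : IsOreExtension σ.toAlgHom δ ι x)
    {Q : MatRes (EnvelopingAlgebra k A) A} (τ : A ≃ₐ[k] A) {n : ℕ}
    {y z : Fin (Q.rk n) → EnvelopingAlgebra k A} {r : EnvelopingAlgebra k A}
    (h : Q.IsCob n (y - MatRes.rmul z r)) : (hE.inducedRes Q τ).IsCob n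
      (twist ι τ ∘ y - MatRes.rmul (twist ι τ ∘ z) (twist ι τ r)) := by
  have hyz : twist ι τ ∘ (y - MatRes.rmul z r) =
      twist ι τ ∘ y - MatRes.rmul (twist ι τ ∘ z) (twist ι τ r) :=
    funext fun i => (map_sub (twist ι τ) (y i) (z i * r)).trans
      (congrArg _ (map_mul (twist ι τ) (z i) r))
  rw [← hyz]
  exact hE.isCob_twist τ h

/-- The inclusion of the kernel of the multiplication map lifts to the resolutions, and acts on the
dual generator through `x ⊗ 1 - 1 ⊗ (x u + c)` for a unit `u`. -/
lemma exists_kernelLift (hE : IsOreExtension σ.toAlgHom δ ι x) (hδ : IsSkewDerivation σ.toAlgHom δ)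
    {Q : MatRes (EnvelopingAlgebra k A) A} {ν : A ≃ₐ[k] A} {d : ℕ}
    {t : Fin (Q.rk d) → EnvelopingAlgebra k A} (ht : IsDualGenerator Q ν d t) :
    ∃ H : ∀ n, Matrix (Fin (Q.rk n)) (Fin (Q.rk n)) (EnvelopingAlgebra k E),
      (∀ i, Fintype.linearCombination (EnvelopingAlgebra k E)
        (fun j => Induced.incl ι AlgEquiv.refl (Q.ε j)) (H 0 i) =
        hE.kernelIncl (Induced.incl ι σ (Q.ε i))) ∧
      (∀ n, (Q.D n).map (twist ι σ) * H n = H (n + 1) * (Q.D n).map (twist ι AlgEquiv.refl)) ∧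
      ∃ (u : Aˣ) (c : A), (hE.inducedRes Q σ).IsCob d
        ((H d).mulVec (twist ι AlgEquiv.refl ∘ t) -
          MatRes.rmul (twist ι σ ∘ t) (x ⊗ₜ op 1 - 1 ⊗ₜ op (x * ι u + ι c))) := by
  obtain ⟨P, hP⟩ := exists_isLift_envEquiv Q σ
  obtain ⟨W, hW⟩ := exists_isLift_skewDerivation hδ Q hP
  let H : ∀ n, Matrix (Fin (Q.rk n)) (Fin (Q.rk n)) (EnvelopingAlgebra k E) := fun n =>
    kernelMat (twist ι AlgEquiv.refl) (x ⊗ₜ op 1) (1 ⊗ₜ op x) (P n) (W n)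
  have hH : ∀ n, (Q.D n).map (twist ι σ) * H n =
      H (n + 1) * (Q.D n).map (twist ι AlgEquiv.refl) := fun n =>
    map_mul_kernelMat hE.left_mul_twist hE.twist_mul_right twist_envLeft
      ((hP.succ n).trans (zero_add _)) (hW.succ n)
  refine ⟨H, fun i => ?_, hH, ?_⟩
  -- With `m = ε i` this is `x ⊗ m - 1 ⊗ σ(m) x - 1 ⊗ δ(m) = x ⊗ m - 1 ⊗ x m = (1 ⊗ m) κ`.
  · refine (linearCombination_kernelMat (Induced.incl ι AlgEquiv.refl)
      (Induced.incl_smul ι AlgEquiv.refl) Q.ε i).trans ?_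
    rw [hP.zero, hW.zero]
    change (_ : EnvelopingAlgebra k E) • Induced.mk ι AlgEquiv.refl (1 ⊗ₜ op (ι (Q.ε i))) -
      (_ : EnvelopingAlgebra k E) • Induced.mk ι AlgEquiv.refl (1 ⊗ₜ op (ι (σ (Q.ε i)))) -
      Induced.mk ι AlgEquiv.refl (1 ⊗ₜ op (ι (δ (Q.ε i)))) =
      Induced.mk ι AlgEquiv.refl (1 ⊗ₜ op (ι (Q.ε i)) * kappa k x)
    rw [← map_smul, ← map_smul, ← map_sub, ← map_sub, tmul_mul_kappa, hE.x_mul]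
    simp only [smul_eq_mul, EnvelopingAlgebra.tmul_mul_tmul, one_mul, mul_one,
      MulOpposite.op_add, TensorProduct.tmul_add]
    rw [sub_sub]
    rfl
  · obtain ⟨u, hu⟩ := ht.exists_unit hP
    obtain ⟨h, hh⟩ := kernelMat_mulVec (P := P d) (W := W d) hE.left_mul_twist hE.twist_mul_right
      twist_envLeft t
    set g := MatRes.dualLift (envEquiv σ) (P d) t with hg
    have hg' : Q.IsCoc d g := ht.isCoc.dualLift hP
    have hcoc : ∀ {y : Fin (Q.rk d) → EnvelopingAlgebra k A} (s : EnvelopingAlgebra k E),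
        Q.IsCoc d y → ((Q.D d).map (twist ι σ)).mulVec (MatRes.rmul (twist ι σ ∘ y) s) = 0 := by
      intro y s hy
      rw [MatRes.mulVec_rmul, ← MatRes.comp_mulVec, hy]
      funext i
      simp [MatRes.rmul]
    -- All other terms of `hh` are cocycles and `twist` reflects cocycles, so `h` is cohomologous to
    -- a multiple of `t`; this gives `c`.
    have hh' : Q.IsCoc d h := by
      rw [← hE.isCoc_twist_iff σ]
      have h₁ := congrArg ((Q.D d).map (twist ι σ)).mulVec hh
      have h₂ : ((Q.D d).map (twist ι σ)).mulVec
          ((H d).mulVec (twist ι AlgEquiv.refl ∘ t)) = 0 := by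
        rw [Matrix.mulVec_mulVec, hH, ← Matrix.mulVec_mulVec, ← MatRes.comp_mulVec, ht.isCoc]
        have : (twist ι AlgEquiv.refl ∘ (0 : Fin (Q.rk (d + 1)) → EnvelopingAlgebra k A)) = 0 :=
          funext fun _ => map_zero _
        rw [this, Matrix.mulVec_zero]
      rw [Matrix.mulVec_sub, Matrix.mulVec_sub, hcoc _ ht.isCoc] at h₁
      erw [hcoc _ hg'] at h₁
      erw [h₂] at h₁
      have h₃ : ((Q.D d).map (twist ι σ)).mulVec (twist ι σ ∘ h) = 0 := by
        simpa using h₁.symm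
      exact h₃
    obtain ⟨c, hc⟩ := ht.gen h hh'
    refine ⟨u, c, ?_⟩
    have h₁ := (hE.isCob_twist_sub_rmul σ hu).rmul (1 ⊗ₜ op x)
    have h₂ := hE.isCob_twist_sub_rmul σ hc
    rw [twist_tmul, map_one, map_one] at h₁ h₂
    rw [MatRes.rmul_sub, MatRes.rmul_rmul, EnvelopingAlgebra.tmul_mul_tmul, one_mul] at h₁
    have h₃ := (h₁.add h₂).neg
    convert h₃ using 1
    refine (congrArg (· - _) hh).trans ?_
    funext i
    simp only [MatRes.rmul, Pi.sub_apply, Pi.add_apply, Pi.neg_apply, MulOpposite.op_add,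
      TensorProduct.tmul_add, mul_sub, mul_add]
    change _ - (twist ι σ ∘ g) i * _ - _ - _ = _
    abel

end IsOreExtension

/-! ### Dual cohomology of induced bimodules as sequences in `E` -/

/-- The group of coboundaries. -/
def MatRes.coboundaries {R : Type u} [Ring R] {M : Type v} [AddCommGroup M] [Module R M]
    (Q : MatRes R M) (n : ℕ) : AddSubgroup (Fin (Q.rk n) → R) where
  carrier := {y | Q.IsCob n y}
  add_mem' := IsCob.add
  zero_mem' := IsCob.zero
  neg_mem' := IsCob.neg

/-- Multiplication of column vectors by a matrix, as an additive map. -/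
def MatRes.mulVecHom {R : Type*} [Ring R] {m n : ℕ} (B : Matrix (Fin m) (Fin n) R) :
    (Fin n → R) →+ (Fin m → R) where
  toFun := B.mulVec
  map_zero' := Matrix.mulVec_zero B
  map_add' := Matrix.mulVec_add B

/-- Right multiplication of a column vector by a scalar, as an additive map. -/
def MatRes.rmulHom {R : Type*} [Ring R] {n : ℕ} (y : Fin n → R) : R →+ (Fin n → R) where
  toFun := rmul y
  map_zero' := funext fun _ => mul_zero _
  map_add' := rmul_add y

lemma IsDec.comp_equiv {ι κ M M' : Type*} [AddCommGroup M] [AddCommGroup M'] {α : ι → M →+ M'}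
    (hα : IsDec α) (e : κ ≃ ι) : IsDec fun j => α (e j) := by
  have h : Finsupp.liftAddHom (fun j => α (e j)) =
      (Finsupp.liftAddHom α).comp (Finsupp.domCongr e).toAddMonoidHom := by
    ext j m
    simp [Finsupp.domCongr]
  rw [IsDec, h]
  exact (show Function.Bijective (Finsupp.liftAddHom α) from hα).comp (Finsupp.domCongr e).bijective

namespace IsOreExtension

variable {k : Type u} {A : Type v} {E : Type w} [CommRing k] [Ring A] [Algebra k A] [Ring E]
  [Algebra k E] {σ : A ≃ₐ[k] A} {δ : A →ₗ[k] A} {ι : A →ₐ[k] E} {x : E}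

/-- The components of the decomposition of cochains. -/
def cochainTerm (ι : A →ₐ[k] E) (x : E) (τ : A ≃ₐ[k] A) (m : ℕ) (p : ℕ × ℕ) :
    (Fin m → EnvelopingAlgebra k A) →+ (Fin m → EnvelopingAlgebra k E) :=
  ((AddMonoidHom.mulRight (bipow k x p)).comp (twist ι τ).toAddMonoidHom).compLeft (Fin m)

lemma isDec_cochain (hE : IsOreExtension σ.toAlgHom δ ι x) (τ : A ≃ₐ[k] A) (m : ℕ) :
    IsDec (cochainTerm ι x τ m) :=
  (hE.isDec_env_left τ).pi m

lemma cochainTerm_apply (τ : A ≃ₐ[k] A) {m : ℕ} (p : ℕ × ℕ) (v : Fin m → EnvelopingAlgebra k A) :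
    cochainTerm ι x τ m p v = MatRes.rmul (twist ι τ ∘ v) (bipow k x p) := rfl

lemma mulVec_cochainTerm (τ : A ≃ₐ[k] A) {m n : ℕ}
    (B : Matrix (Fin m) (Fin n) (EnvelopingAlgebra k A)) (p : ℕ × ℕ)
    (v : Fin n → EnvelopingAlgebra k A) :
    (B.map (twist ι τ)).mulVec (cochainTerm ι x τ n p v) =
      cochainTerm ι x τ m p (B.mulVec v) := by
  rw [cochainTerm_apply, cochainTerm_apply, MatRes.mulVec_rmul, MatRes.comp_mulVec]

variable {Q : MatRes (EnvelopingAlgebra k A) A}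

/-- Matrices act on columns from the left, so freeness of `Eᵉ` as a left `Aᵉ`-module splits the dual
complex into copies of that of `Q`. -/
lemma isCob_liftAddHom_cochainTerm (hE : IsOreExtension σ.toAlgHom δ ι x) (τ : A ≃ₐ[k] A) {n : ℕ}
    (v : ℕ × ℕ →₀ (Fin (Q.rk n) → EnvelopingAlgebra k A)) :
    (hE.inducedRes Q τ).IsCob n (Finsupp.liftAddHom (cochainTerm ι x τ _) v) ↔
      ∀ p, Q.IsCob n (v p) := by
  constructor
  · intro h p
    cases n with
    | zero =>
      have h₁ := (hE.isDec_cochain τ _).1 (Eq.trans h (map_zero _).symm)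
      rw [h₁]
      rfl
    | succ n =>
      obtain ⟨z, hz⟩ := h
      exact (hE.isDec_cochain τ _).mem_range (hE.isDec_cochain τ _)
        (MatRes.mulVecHom (Q.D n)) (MatRes.mulVecHom ((Q.D n).map (twist ι τ)))
        (mulVec_cochainTerm τ (Q.D n)) hz p
  · intro h
    rw [Finsupp.liftAddHom_apply]
    exact ((hE.inducedRes Q τ).coboundaries n).sum_mem fun p _ => (hE.isCob_twist τ (h p)).rmul _

lemma exists_of_isCoc (hE : IsOreExtension σ.toAlgHom δ ι x) (τ : A ≃ₐ[k] A) {n : ℕ}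
    {y : Fin (Q.rk n) → EnvelopingAlgebra k E} (hy : (hE.inducedRes Q τ).IsCoc n y) :
    ∃ v, (∀ p, Q.IsCoc n (v p)) ∧ Finsupp.liftAddHom (cochainTerm ι x τ _) v = y :=
  (hE.isDec_cochain τ _).exists_of_ker (hE.isDec_cochain τ _)
    (MatRes.mulVecHom (Q.D n)) (MatRes.mulVecHom ((Q.D n).map (twist ι τ)))
    (mulVec_cochainTerm τ (Q.D n)) hy

lemma isCob_of_isCoc (hE : IsOreExtension σ.toAlgHom δ ι x) (τ : A ≃ₐ[k] A) {n : ℕ}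
    (hQ : ∀ y, Q.IsCoc n y → Q.IsCob n y) {y : Fin (Q.rk n) → EnvelopingAlgebra k E}
    (hy : (hE.inducedRes Q τ).IsCoc n y) : (hE.inducedRes Q τ).IsCob n y := by
  obtain ⟨v, hv, rfl⟩ := hE.exists_of_isCoc τ hy
  exact (hE.isCob_liftAddHom_cochainTerm τ v).2 fun p => hQ _ (hv p)

/-- `e tʲ ↦ xʲ ⊗ e`. -/
def powTensor (k : Type u) {E : Type w} [CommRing k] [Ring E] [Algebra k E] (x : E) :
    (ℕ →₀ E) →+ EnvelopingAlgebra k E :=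
  Finsupp.liftAddHom fun j => (TensorProduct.mk k E Eᵐᵒᵖ (x ^ j)).toAddMonoidHom.comp
    (opAddEquiv (α := E)).toAddMonoidHom

@[simp]
lemma powTensor_single (j : ℕ) (e : E) :
    powTensor k x (Finsupp.single j e) = (x ^ j) ⊗ₜ op e := by
  simp [powTensor]

/-- Turns the factor by which the kernel inclusion acts on the dual generator into the shift
operator. -/
lemma sub_mul_powTensor (w : E) (g : ℕ →₀ E) :
    (x ⊗ₜ op 1 - 1 ⊗ₜ op w) * powTensor k x g = - powTensor k x (shiftSub w g) := by
  induction g using Finsupp.induction_linear with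
  | zero => simp
  | add f g hf hg => simp only [map_add, mul_add, hf, hg, neg_add]
  | single j e =>
    rw [shiftSub_single, map_sub, powTensor_single, powTensor_single, powTensor_single, sub_mul,
      EnvelopingAlgebra.tmul_mul_tmul, EnvelopingAlgebra.tmul_mul_tmul, mul_one, one_mul,
      ← pow_succ', neg_sub]

/-- The sequence of elements of `E` with given right coefficients. -/
def seqTerm (ι : A →ₐ[k] E) (x : E) (p : ℕ × ℕ) : A →+ (ℕ →₀ E) :=
  (Finsupp.singleAddHom p.1).comp (rightTerm ι x p.2).toAddMonoidHom

lemma isDec_seqTerm (hE : IsOreExtension σ.toAlgHom δ ι x) : IsDec (seqTerm ι x) :=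
  (hE.isDec_right.prod isDec_single).comp_equiv (Equiv.prodComm ℕ ℕ)

lemma rmul_powTensor (τ : A ≃ₐ[k] A) {n : ℕ} (t : Fin n → EnvelopingAlgebra k A)
    (a : ℕ × ℕ →₀ A) :
    MatRes.rmul (twist ι τ ∘ t) (powTensor k x (Finsupp.liftAddHom (seqTerm ι x) a)) =
      Finsupp.liftAddHom (cochainTerm ι x τ n) (Finsupp.mapRange.addMonoidHom
        ((MatRes.rmulHom t).comp ((TensorProduct.mk k A Aᵐᵒᵖ 1).toAddMonoidHom.comp
          (opAddEquiv (α := A)).toAddMonoidHom)) a) := by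
  refine IsDec.map_liftAddHom (α := seqTerm ι x) (β := cochainTerm ι x τ n) _
    ((MatRes.rmulHom (twist ι τ ∘ t)).comp (powTensor k x)) (fun p a => ?_) a
  change MatRes.rmul _ (powTensor k x (Finsupp.single p.1 (x ^ p.2 * ι a))) =
    cochainTerm ι x τ n p (MatRes.rmul t (1 ⊗ₜ op a))
  rw [powTensor_single, cochainTerm_apply]
  funext i
  change twist ι τ (t i) * _ = twist ι τ (t i * _) * _
  rw [map_mul, twist_tmul, mul_assoc, bipow, EnvelopingAlgebra.tmul_mul_tmul, map_one, map_one,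
    one_mul]

/-- With `eq_zero_of_isCob_powTensor`: the generator property and freeness of `t`, applied to each
component, identify the cohomology in degree `d` with finite sequences in `E`. -/
lemma exists_powTensor (hE : IsOreExtension σ.toAlgHom δ ι x) {ν : A ≃ₐ[k] A} {d : ℕ}
    {t : Fin (Q.rk d) → EnvelopingAlgebra k A} (ht : IsDualGenerator Q ν d t) (τ : A ≃ₐ[k] A)
    {y : Fin (Q.rk d) → EnvelopingAlgebra k E} (hy : (hE.inducedRes Q τ).IsCoc d y) :
    ∃ g, (hE.inducedRes Q τ).IsCob d (y - MatRes.rmul (twist ι τ ∘ t) (powTensor k x g)) := by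
  classical
  obtain ⟨v, hv, rfl⟩ := hE.exists_of_isCoc τ hy
  choose a ha using fun p => ht.gen (v p) (hv p)
  -- The chosen `a p` may be nonzero where `v p = 0`; it is reset to `0` there to obtain finite
  -- support.
  let n : ℕ × ℕ →₀ A := Finsupp.onFinset v.support (fun p => if v p = 0 then 0 else a p)
    fun p hp => by
      rw [Finsupp.mem_support_iff]
      rintro h
      simp [h] at hp
  refine ⟨Finsupp.liftAddHom (seqTerm ι x) n, ?_⟩
  rw [rmul_powTensor, ← map_sub, isCob_liftAddHom_cochainTerm]
  intro p
  change Q.IsCob d (v p - MatRes.rmul t (1 ⊗ₜ op (n p)))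
  by_cases hp : v p = 0
  · have hn : n p = 0 := if_pos hp
    rw [hp, hn]
    convert MatRes.IsCob.zero (Q := Q) (n := d) using 1
    funext i
    simp [MatRes.rmul]
  · have hn : n p = a p := if_neg hp
    rw [hn]
    exact ha p

lemma eq_zero_of_isCob_powTensor (hE : IsOreExtension σ.toAlgHom δ ι x) {ν : A ≃ₐ[k] A} {d : ℕ}
    {t : Fin (Q.rk d) → EnvelopingAlgebra k A} (ht : IsDualGenerator Q ν d t) (τ : A ≃ₐ[k] A)
    {g : ℕ →₀ E}
    (hg : (hE.inducedRes Q τ).IsCob d (MatRes.rmul (twist ι τ ∘ t) (powTensor k x g))) : g = 0 := by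
  obtain ⟨a, rfl⟩ := hE.isDec_seqTerm.2 g
  rw [rmul_powTensor, isCob_liftAddHom_cochainTerm] at hg
  have ha : a = 0 := by
    ext p
    exact ht.free _ (hg p)
  rw [ha, map_zero]

end IsOreExtension

/-! ### The long exact sequence of `Ext` for the induced bimodules -/

/-- Since `f* g* = 0`, injectivity of `f*` in degree `d` kills `g*` there, and in other degrees its
target vanishes. So every class on `X₃` of positive degree comes from `X₁` one degree lower, while
in degree 0 `g*` is injective. -/
lemma CategoryTheory.ShortComplex.ShortExact.ext_eq_zero {C : Type u} [Category.{v} C] [Abelian C]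
    [HasExt.{w} C] {S : ShortComplex C} (hS : S.ShortExact) {Y : C} {d : ℕ}
    (h₁ : ∀ i, i ≠ d → ∀ y : Abelian.Ext S.X₁ Y i, y = 0)
    (h₂ : ∀ i, i ≠ d → ∀ y : Abelian.Ext S.X₂ Y i, y = 0)
    (hf : ∀ y : Abelian.Ext S.X₂ Y d, (Abelian.Ext.mk₀ S.f).comp y (zero_add d) = 0 → y = 0) :
    (∀ i (y : Abelian.Ext S.X₃ Y i), (Abelian.Ext.mk₀ S.g).comp y (zero_add i) = 0) ∧
      ∀ i, i ≠ d + 1 → ∀ y : Abelian.Ext S.X₃ Y i, y = 0 := by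
  have hg : ∀ i (y : Abelian.Ext S.X₃ Y i), (Abelian.Ext.mk₀ S.g).comp y (zero_add i) = 0 := by
    intro i y
    by_cases hi : i = d
    · subst hi
      refine hf _ ?_
      rw [Abelian.Ext.mk₀_comp_mk₀_assoc, S.zero, Abelian.Ext.mk₀_zero, Abelian.Ext.zero_comp]
    · exact h₂ i hi _
  refine ⟨hg, fun i hi y => ?_⟩
  cases i with
  | zero =>
    have := hS.epi_g
    refine Abelian.Ext.precomp_mk₀_injective_of_epi Y S.g ((hg 0 y).trans ?_)
    exact (map_zero ((Abelian.Ext.mk₀ S.g).precomp Y (zero_add 0))).symm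
  | succ n =>
    obtain ⟨z, rfl⟩ := Abelian.Ext.contravariant_sequence_exact₃ hS Y y (hg _ y) (add_comm 1 n)
    rw [h₁ n (by omega) z, Abelian.Ext.comp_zero]

namespace IsOreExtension

variable {k : Type u} {A : Type v} {E : Type w} [CommRing k] [Ring A] [Algebra k A] [Ring E]
  [Algebra k E] {σ : A ≃ₐ[k] A} {δ : A →ₗ[k] A} {ι : A →ₐ[k] E} {x : E}
  {Q : MatRes (EnvelopingAlgebra k A) A} {ν : A ≃ₐ[k] A} {d : ℕ}
  {t : Fin (Q.rk d) → EnvelopingAlgebra k A}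

/-- The left regular module. -/
abbrev regularModule (R : Type w) [Ring R] : ModuleCat.{w} R := ModuleCat.of R R

/-- The induced bimodule as an object of the category of modules. -/
abbrev inducedModule (ι : A →ₐ[k] E) (τ : A ≃ₐ[k] A) : ModuleCat.{w} (EnvelopingAlgebra k E) :=
  ModuleCat.of (EnvelopingAlgebra k E) (Induced ι τ)

/-- The resolution of the induced bimodule. -/
abbrev inducedModuleRes (hE : IsOreExtension σ.toAlgHom δ ι x)
    (Q : MatRes (EnvelopingAlgebra k A) A) (τ : A ≃ₐ[k] A) :
    MatRes (EnvelopingAlgebra k E) (inducedModule ι τ) :=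
  hE.inducedRes Q τ

lemma isCoc_rmul_powTensor (hE : IsOreExtension σ.toAlgHom δ ι x) (ht : IsDualGenerator Q ν d t)
    (τ : A ≃ₐ[k] A) (s : EnvelopingAlgebra k E) :
    (hE.inducedModuleRes Q τ).IsCoc d (MatRes.rmul (twist ι τ ∘ t) s) :=
  ((hE.isCoc_twist_iff τ).2 ht.isCoc : (hE.inducedModuleRes Q τ).IsCoc d _).rmul s

/-- The class in `Ext` attached to a multiple of the dual generator. -/
def genClass (hE : IsOreExtension σ.toAlgHom δ ι x) (ht : IsDualGenerator Q ν d t)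
    (τ : A ≃ₐ[k] A) :
    EnvelopingAlgebra k E →+
      Abelian.Ext (inducedModule ι τ) (regularModule (EnvelopingAlgebra k E)) d where
  toFun s := (hE.inducedModuleRes Q τ).cls _ (hE.isCoc_rmul_powTensor ht τ s)
  map_zero' := by
    rw [MatRes.cls_eq_zero_iff]
    convert MatRes.IsCob.zero (Q := hE.inducedModuleRes Q τ) (n := d) using 1
    exact funext fun _ => mul_zero _
  map_add' s s' := by
    rw [← MatRes.cls_add]
    congr 1
    exact MatRes.rmul_add _ s s'

lemma genClass_eq_zero_iff (hE : IsOreExtension σ.toAlgHom δ ι x) (ht : IsDualGenerator Q ν d t)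
    (τ : A ≃ₐ[k] A) (s : EnvelopingAlgebra k E) : hE.genClass ht τ s = 0 ↔
      (hE.inducedModuleRes Q τ).IsCob d (MatRes.rmul (twist ι τ ∘ t) s) :=
  MatRes.cls_eq_zero_iff _ _ (hE.isCoc_rmul_powTensor ht τ s)

lemma genClass_comp (hE : IsOreExtension σ.toAlgHom δ ι x) (ht : IsDualGenerator Q ν d t)
    (τ : A ≃ₐ[k] A) (s r : EnvelopingAlgebra k E) :
    (hE.genClass ht τ s).comp (Abelian.Ext.mk₀ (ModuleCat.ofHom
      (LinearMap.toSpanSingleton (EnvelopingAlgebra k E) (EnvelopingAlgebra k E) r)))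
      (add_zero d) = hE.genClass ht τ (s * r) := by
  refine ((hE.inducedModuleRes Q τ).cls_rmul _ (hE.isCoc_rmul_powTensor ht τ s) r).symm.trans ?_
  refine (MatRes.cls_eq_iff _ _ (hE.isCoc_rmul_powTensor ht τ _)).2 ?_
  rw [MatRes.rmul_rmul, sub_self]
  exact MatRes.IsCob.zero

lemma exists_genClass_powTensor (hE : IsOreExtension σ.toAlgHom δ ι x)
    (ht : IsDualGenerator Q ν d t) (τ : A ≃ₐ[k] A)
    (ξ : Abelian.Ext (inducedModule ι τ) (regularModule (EnvelopingAlgebra k E)) d) :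
    ∃ g, ξ = hE.genClass ht τ (powTensor k x g) := by
  obtain ⟨y, hy, rfl⟩ := (hE.inducedModuleRes Q τ).cls_surjective ξ
  obtain ⟨g, hg⟩ := hE.exists_powTensor ht τ hy
  exact ⟨g, (MatRes.cls_eq_iff _ hy (hE.isCoc_rmul_powTensor ht τ _)).2 hg⟩

lemma genClass_powTensor_eq_zero_iff (hE : IsOreExtension σ.toAlgHom δ ι x)
    (ht : IsDualGenerator Q ν d t) (τ : A ≃ₐ[k] A) (g : ℕ →₀ E) :
    hE.genClass ht τ (powTensor k x g) = 0 ↔ g = 0 := by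
  refine ⟨fun h => ?_, ?_⟩
  · rw [genClass_eq_zero_iff] at h
    exact hE.eq_zero_of_isCob_powTensor ht τ h
  · rintro rfl
    rw [map_zero, map_zero]

lemma ext_induced_eq_zero (hE : IsOreExtension σ.toAlgHom δ ι x) (ht : IsDualGenerator Q ν d t)
    (τ : A ≃ₐ[k] A) (i : ℕ) (hi : i ≠ d)
    (ξ : Abelian.Ext (inducedModule ι τ) (regularModule (EnvelopingAlgebra k E)) i) : ξ = 0 := by
  obtain ⟨y, hy, rfl⟩ := (hE.inducedModuleRes Q τ).cls_surjective ξ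
  rw [MatRes.cls_eq_zero_iff]
  exact hE.isCob_of_isCoc τ (ht.vanish i hi) hy

/-- The left multiplication on the dual generator by elements of `A`. -/
lemma genClass_twist (hE : IsOreExtension σ.toAlgHom δ ι x) (ht : IsDualGenerator Q ν d t)
    (b : A) : hE.genClass ht σ (ι b ⊗ₜ op 1) =
      hE.genClass ht σ (1 ⊗ₜ op (ι (ν (σ.symm b)))) := by
  rw [← sub_eq_zero, ← map_sub, genClass_eq_zero_iff]
  have h := hE.isCob_twist_sub_rmul σ (ht.twist (σ.symm b))
  convert h using 1
  funext i
  change twist ι σ (t i) * _ = twist ι σ (t i * _) - twist ι σ (t i) * _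
  rw [map_mul, twist_tmul, twist_tmul, map_one, map_one, map_one, AlgEquiv.apply_symm_apply,
    mul_sub]

/-- The short exact sequence of bimodules that resolves `E` by induced bimodules. -/
abbrev inducedSeq (hE : IsOreExtension σ.toAlgHom δ ι x) :
    ShortComplex (ModuleCat.{w} (EnvelopingAlgebra k E)) where
  X₁ := inducedModule ι σ
  X₂ := inducedModule ι AlgEquiv.refl
  X₃ := ModuleCat.of (EnvelopingAlgebra k E) E
  f := ModuleCat.ofHom hE.kernelIncl
  g := ModuleCat.ofHom (inducedMul ι)
  zero := by
    ext1
    exact LinearMap.ext fun z => (hE.exact_kernelIncl _).2 ⟨z, rfl⟩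

lemma shortExact_inducedSeq (hE : IsOreExtension σ.toAlgHom δ ι x) : hE.inducedSeq.ShortExact where
  exact := (ShortComplex.ShortExact.moduleCat_exact_iff_function_exact _).2 hE.exact_kernelIncl
  mono_f := (ModuleCat.mono_iff_injective _).2 hE.kernelIncl_injective
  epi_g := (ModuleCat.epi_iff_surjective _).2 inducedMul_surjective

/-- The matrix lift, read on sequences. -/
lemma exists_mk₀_comp_genClass (hE : IsOreExtension σ.toAlgHom δ ι x)
    (hδ : IsSkewDerivation σ.toAlgHom δ) (ht : IsDualGenerator Q ν d t) :
    ∃ (u : Aˣ) (c : A), ∀ g, (Abelian.Ext.mk₀ hE.inducedSeq.f).comp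
      (hE.genClass ht AlgEquiv.refl (powTensor k x g)) (zero_add d) =
        - hE.genClass ht σ (powTensor k x (shiftSub (x * ι u + ι c) g)) := by
  obtain ⟨H, hH₀, hH, u, c, huc⟩ := hE.exists_kernelLift hδ ht
  refine ⟨u, c, fun g => ?_⟩
  have hcob := huc.rmul (powTensor k x g)
  rw [MatRes.rmul_sub, MatRes.rmul_rmul, sub_mul_powTensor, ← MatRes.mulVec_rmul] at hcob
  have hcoc : (hE.inducedModuleRes Q σ).IsCoc d
      ((H d).mulVec (MatRes.rmul (twist ι AlgEquiv.refl ∘ t) (powTensor k x g))) := by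
    have h := hE.isCoc_rmul_powTensor ht AlgEquiv.refl (powTensor k x g)
    rw [MatRes.IsCoc] at h ⊢
    rw [Matrix.mulVec_mulVec]
    change ((Q.D d).map (twist ι σ) * H d).mulVec _ = 0
    rw [hH, ← Matrix.mulVec_mulVec]
    exact (congrArg _ h).trans (Matrix.mulVec_zero _)
  refine (MatRes.mk₀_comp_cls (Q := hE.inducedModuleRes Q σ)
    (Q' := hE.inducedModuleRes Q AlgEquiv.refl) (ModuleCat.ofHom hE.kernelIncl) H hH₀ hH _
    (hE.isCoc_rmul_powTensor ht AlgEquiv.refl (powTensor k x g)) hcoc).trans ?_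
  rw [← map_neg]
  exact (MatRes.cls_eq_iff _ hcoc (hE.isCoc_rmul_powTensor ht σ _)).2 hcob

end IsOreExtension

/-! ### The bimodule structure of `Ext` and the endomorphism describing it -/

namespace ExtEnveloping

variable {k : Type u} {E : Type v} [CommRing k] [Ring E] [Algebra k E] {i : ℕ}

lemma envelopingRightMul_add (r s : EnvelopingAlgebra k E) :
    envelopingRightMul k E (r + s) = envelopingRightMul k E r + envelopingRightMul k E s := by
  refine congrArg ModuleCat.ofHom (LinearMap.ext fun z => ?_)
  exact mul_add (R := EnvelopingAlgebra k E) z r s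

lemma envelopingRightMul_comp (r s : EnvelopingAlgebra k E) :
    envelopingRightMul k E r ≫ envelopingRightMul k E s = envelopingRightMul k E (r * s) := by
  refine congrArg ModuleCat.ofHom (LinearMap.ext fun z => ?_)
  exact mul_assoc (G := EnvelopingAlgebra k E) z r s

lemma envelopingRightMul_one : envelopingRightMul k E 1 = 𝟙 _ := by
  refine congrArg ModuleCat.ofHom (LinearMap.ext fun z => ?_)
  exact mul_one (z : EnvelopingAlgebra k E)

lemma add_biact (a b b' : E) (ξ : ExtEnveloping k E i) :
    biact a (b + b') ξ = biact a b ξ + biact a b' ξ := by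
  rw [biact, TensorProduct.add_tmul, envelopingRightMul_add, Abelian.Ext.mk₀_add,
    Abelian.Ext.comp_add]
  rfl

lemma biact_biact (a a' b b' : E) (ξ : ExtEnveloping k E i) :
    biact a b (biact a' b' ξ) = biact (a * a') (b' * b) ξ := by
  rw [biact, biact, biact, Abelian.Ext.comp_assoc_of_third_deg_zero, Abelian.Ext.mk₀_comp_mk₀,
    envelopingRightMul_comp, EnvelopingAlgebra.tmul_mul_tmul]

lemma biact_one_one (ξ : ExtEnveloping k E i) : biact 1 1 ξ = ξ := by
  rw [biact, op_one, ← Algebra.TensorProduct.one_def, envelopingRightMul_one,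
    Abelian.Ext.comp_mk₀_id]

lemma biact_smul (c : k) (a b : E) (ξ : ExtEnveloping k E i) :
    biact a (c • b) ξ = biact (c • a) b ξ := by
  rw [biact, biact, TensorProduct.smul_tmul, ← op_smul]

/-- An identification of `Ext` with `E` as a left module determines an endomorphism of `E` that
describes the right module structure. -/
lemma exists_algHom (ψ : E ≃+ ExtEnveloping k E i) (hψ : ∀ a e, biact a 1 (ψ e) = ψ (a * e)) :
    ∃ ρ : E →ₐ[k] E, ∀ a b e, biact a b (ψ e) = ψ (a * e * ρ b) := by
  let f : E → E := fun b => ψ.symm (biact 1 b (ψ 1))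
  have hf : ∀ b, ψ (f b) = biact 1 b (ψ 1) := fun b => ψ.apply_symm_apply _
  -- The left and right actions commute and `ψ e` is `e` acting on `ψ 1`, so the right action is
  -- determined on `ψ 1`.
  have key : ∀ a b e, biact a b (ψ e) = ψ (a * e * f b) := by
    intro a b e
    rw [← hψ (a * e), hf, biact_biact, ← mul_one e, ← hψ, biact_biact]
    simp
  refine ⟨AlgHom.ofLinearMap { toFun := f, map_add' := fun b b' => ?_, map_smul' := fun c b => ?_ }
    ?_ fun b b' => ?_, key⟩
  · apply ψ.injective
    rw [hf, add_biact, map_add, hf, hf]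
  · apply ψ.injective
    rw [hf, biact_smul, key]
    simp
  · apply ψ.injective
    change ψ (f 1) = _
    rw [hf, biact_one_one]
  · apply ψ.injective
    change ψ (f (b * b')) = ψ (f b * f b')
    rw [hf, ← mul_one (1 : E), ← biact_biact, mul_one, ← hf, key, one_mul]

end ExtEnveloping

/-! ### `Ext` of the Ore extension with values in its enveloping algebra -/

namespace IsOreExtension

variable {k : Type u} {A : Type v} {E : Type w} [CommRing k] [Ring A] [Algebra k A] [Ring E]
  [Algebra k E] {σ : A ≃ₐ[k] A} {δ : A →ₗ[k] A} {ι : A →ₐ[k] E} {x : E}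
  {Q : MatRes (EnvelopingAlgebra k A) A} {ν : A ≃ₐ[k] A} {d : ℕ}
  {t : Fin (Q.rk d) → EnvelopingAlgebra k A}

/-- The image under the connecting homomorphism of a multiple of the dual generator. -/
def connecting (hE : IsOreExtension σ.toAlgHom δ ι x) (ht : IsDualGenerator Q ν d t) :
    EnvelopingAlgebra k E →+ ExtEnveloping k E (d + 1) :=
  (hE.shortExact_inducedSeq.extClass.precomp _ (add_comm 1 d)).comp (hE.genClass ht σ)

/-- The connecting map composes on one side and the bimodule action on the other, so they commute by
associativity. -/
lemma biact_connecting (hE : IsOreExtension σ.toAlgHom δ ι x) (ht : IsDualGenerator Q ν d t)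
    (a b : E) (s : EnvelopingAlgebra k E) :
    ExtEnveloping.biact a b (hE.connecting ht s) = hE.connecting ht (s * (b ⊗ₜ op a)) := by
  refine (Abelian.Ext.comp_assoc_of_third_deg_zero hE.shortExact_inducedSeq.extClass
    (hE.genClass ht σ s) (Abelian.Ext.mk₀ (envelopingRightMul k E (b ⊗ₜ op a)))
    (add_comm 1 d)).trans ?_
  exact congrArg (fun ξ => hE.shortExact_inducedSeq.extClass.comp ξ (add_comm 1 d))
    (hE.genClass_comp ht σ s (b ⊗ₜ op a))

/-- The dual of the resolution of an Ore extension. -/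
lemma exists_extEquiv (hE : IsOreExtension σ.toAlgHom δ ι x)
    (hδ : IsSkewDerivation σ.toAlgHom δ) (ht : IsDualGenerator Q ν d t) :
    (∀ i, i ≠ d + 1 → Subsingleton (ExtEnveloping k E i)) ∧
    ∃ (u : Aˣ) (c : A) (ψ : E ≃+ ExtEnveloping k E (d + 1)),
      (∀ a e, ExtEnveloping.biact a 1 (ψ e) = ψ (a * e)) ∧
      (∀ b, ExtEnveloping.biact 1 (ι b) (ψ 1) = ψ (ι (ν (σ.symm b)))) ∧
      ExtEnveloping.biact 1 x (ψ 1) = ψ (x * ι u + ι c) := by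
  obtain ⟨u, c, huc⟩ := hE.exists_mk₀_comp_genClass hδ ht
  set w := x * ι u + ι c with hw
  have hS := hE.shortExact_inducedSeq
  obtain ⟨hg, hvan⟩ := hS.ext_eq_zero (Y := regularModule (EnvelopingAlgebra k E)) (d := d)
    (hE.ext_induced_eq_zero ht σ) (hE.ext_induced_eq_zero ht AlgEquiv.refl) (fun y hy => by
      obtain ⟨g, rfl⟩ := hE.exists_genClass_powTensor ht AlgEquiv.refl y
      have h : -hE.genClass ht σ (powTensor k x (shiftSub w g)) = 0 := (huc g).symm.trans hy
      rw [neg_eq_zero, genClass_powTensor_eq_zero_iff] at h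
      rw [shiftSub_injective w (h.trans (map_zero _).symm), map_zero, map_zero])
  have hshift : ∀ g, hE.connecting ht (powTensor k x (shiftSub w g)) = 0 := by
    intro g
    have h := hS.extClass_comp_assoc (hE.genClass ht AlgEquiv.refl (powTensor k x g))
      (h := add_comm 1 d)
    rw [huc, Abelian.Ext.comp_neg, neg_eq_zero] at h
    exact h
  -- Sequences in degree 0 represent the cokernel of the shift operator.
  let ψ₀ : E →+ ExtEnveloping k E (d + 1) :=
    (hE.connecting ht).comp ((powTensor k x).comp (Finsupp.singleAddHom 0))
  have hψ₀ : ∀ e, ψ₀ e = hE.connecting ht (1 ⊗ₜ op e) := fun e => by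
    change hE.connecting ht (powTensor k x (Finsupp.single 0 e)) = _
    rw [powTensor_single, pow_zero]
  have hbij : Function.Bijective ψ₀ := by
    constructor
    -- A vanishing image makes `e t⁰` a value of the shift operator, and evaluation at `w` gives `e
    -- = 0`.
    · refine (injective_iff_map_eq_zero ψ₀).2 fun e he => ?_
      obtain ⟨ξ, hξ⟩ := Abelian.Ext.contravariant_sequence_exact₁ hS _
        (hE.genClass ht σ (powTensor k x (Finsupp.single 0 e))) (add_comm 1 d) he
      obtain ⟨g, rfl⟩ := hE.exists_genClass_powTensor ht AlgEquiv.refl ξ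
      have h₁ := (huc g).symm.trans hξ
      rw [← map_neg, ← map_neg, ← sub_eq_zero, ← map_sub, ← map_sub,
        genClass_powTensor_eq_zero_iff] at h₁
      have h₂ := congrArg (evalRight w) h₁
      simpa [evalRight_shiftSub] using h₂
    · intro ξ
      obtain ⟨y, rfl⟩ := Abelian.Ext.contravariant_sequence_exact₃ hS _ ξ (hg _ ξ) (add_comm 1 d)
      obtain ⟨g, rfl⟩ := hE.exists_genClass_powTensor ht σ y
      obtain ⟨f, hf⟩ := exists_shiftSub w g
      refine ⟨evalRight w g, ?_⟩
      change _ = hE.connecting ht (powTensor k x g)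
      conv_rhs => rw [hf, map_add, map_add, hshift, add_zero]
      rfl
  refine ⟨fun i hi => ⟨fun y z => (hvan i hi y).trans (hvan i hi z).symm⟩, u, c,
    AddEquiv.ofBijective ψ₀ hbij, fun a e => ?_, fun b => ?_, ?_⟩
  · change ExtEnveloping.biact a 1 (ψ₀ e) = ψ₀ (a * e)
    rw [hψ₀, hψ₀, biact_connecting, EnvelopingAlgebra.tmul_mul_tmul, one_mul]
  · change ExtEnveloping.biact 1 (ι b) (ψ₀ 1) = ψ₀ _
    rw [hψ₀, hψ₀, biact_connecting, EnvelopingAlgebra.tmul_mul_tmul, one_mul, one_mul]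
    exact congrArg (fun ξ => hS.extClass.comp ξ (add_comm 1 d)) (hE.genClass_twist ht b)
  · change ExtEnveloping.biact 1 x (ψ₀ 1) = ψ₀ _
    -- The shift of `1 t⁰` is `w t⁰ - 1 t¹`, so `x ⊗ 1` and `1 ⊗ w` have the same image.
    have h := hshift (Finsupp.single 0 1)
    rw [shiftSub_single, map_sub, map_sub, powTensor_single, powTensor_single, sub_eq_zero,
      pow_zero, one_mul, zero_add, pow_one] at h
    rw [hψ₀, hψ₀, biact_connecting, EnvelopingAlgebra.tmul_mul_tmul, one_mul, one_mul, h]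

end IsOreExtension

/-! ### Endomorphisms of an Ore extension -/

namespace IsOreExtension

variable {k : Type u} {A : Type v} {E : Type w} [CommRing k] [Ring A] [Algebra k A] [Ring E]
  [Algebra k E] {σ : A ≃ₐ[k] A} {δ : A →ₗ[k] A} {ι : A →ₐ[k] E} {x : E}

/-- An endomorphism of an Ore extension that extends an automorphism `τ` of `A` and maps `x` to
`u x + b` with a unit `u` is bijective. -/
lemma bijective_of_map_x (hE : IsOreExtension σ.toAlgHom δ ι x) {ρ : E →ₐ[k] E} {τ : A ≃ₐ[k] A}
    (hρ : ∀ a, ρ (ι a) = ι (τ a)) {u : Aˣ} {b : A} (hx : ρ x = ι u * x + ι b) :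
    Function.Bijective ρ := by
  -- The power `(u x + b)ⁿ` has degree at most `n` and a unit as coefficient of `xⁿ`: in each step
  -- the unit `v` becomes `u σ(v)`. So `ρ` is triangular in left coefficients.
  have key : ∀ n, ∃ v : Aˣ, hE.coords ((ι u * x + ι b) ^ n) n = v ∧
      ∀ m, n < m → hE.coords ((ι u * x + ι b) ^ n) m = 0 := by
    intro n
    induction n with
    | zero =>
      refine ⟨1, ?_, fun m hm => ?_⟩
      · simpa using congrArg (· 0) (hE.coords_ι 1)
      · have := congrArg (· m) (hE.coords_ι 1)
        simpa [hm.ne] using this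
    | succ n ih =>
      obtain ⟨v, hv, hv'⟩ := ih
      have h : ∀ m, hE.coords ((ι u * x + ι b) ^ (n + 1)) (m + 1) =
          u * (σ (hE.coords ((ι u * x + ι b) ^ n) m) +
            δ (hE.coords ((ι u * x + ι b) ^ n) (m + 1))) +
          b * hE.coords ((ι u * x + ι b) ^ n) (m + 1) := by
        intro m
        rw [pow_succ', add_mul, map_add hE.coords, Finsupp.add_apply, mul_assoc, coords_ι_mul,
          coords_ι_mul,           coords_x_mul_succ]
        rfl
      refine ⟨u * Units.map (σ : A →* A) v, ?_, fun m hm => ?_⟩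
      · rw [h, hv, hv' _ (Nat.lt_succ_self n)]
        simp
      · obtain ⟨m, rfl⟩ : ∃ l, m = l + 1 := ⟨m - 1, by omega⟩
        rw [h, hv' m (by omega), hv' (m + 1) (by omega)]
        simp
  choose v hv hv' using key
  have hterm : ∀ n a m, hE.coords (ρ (hE.coords.symm (Finsupp.single n a))) m =
      τ a * hE.coords ((ι u * x + ι b) ^ n) m := by
    intro n a m
    rw [coords_symm_single, map_mul, map_pow, hρ, hx, coords_ι_mul]
  have h := bijective_of_triangular
    ((hE.coords.toLinearMap ∘ₗ ρ.toLinearMap ∘ₗ hE.coords.symm.toLinearMap).toAddMonoidHom)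
    (fun n a => τ a * v n)
    (fun n => (Units.mulRight_bijective (v n)).comp τ.bijective)
    (fun n a => (hterm n a n).trans (by rw [hv]))
    (fun n a m hnm => (hterm n a m).trans (by rw [hv' n m hnm, mul_zero]))
  have h' : Function.Bijective (hE.coords ∘ (ρ ∘ hE.coords.symm)) := h
  exact (Function.Bijective.of_comp_iff _ hE.coords.symm.bijective).1
    ((Function.Bijective.of_comp_iff' hE.coords.bijective _).1 h')

/-- An endomorphism of an Ore extension that extends `τ` and maps `x` to `x u + c` becomes, after
conjugation by the unit `u`, an extension of `σ⁻¹ τ σ`. -/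
lemma unit_mul_eq (hE : IsOreExtension σ.toAlgHom δ ι x) {ρ : E →ₐ[k] E} {τ : A → A}
    (hρ : ∀ a, ρ (ι a) = ι (τ a)) {u c : A} (hx : ρ x = x * ι u + ι c) (b : A) :
    u * τ b = σ.symm (τ (σ b)) * u := by
  have h := congrArg ρ (hE.x_mul b)
  rw [map_mul, map_add, map_mul, hρ, hρ, hρ, hx, add_mul, mul_add] at h
  -- Coefficients of `x` are compared; the terms with `c` and `δ` have degree 0 and drop out.
  have h₁ := congrArg (fun z => hE.coords z 1) h
  simp only [map_add, Finsupp.add_apply, ← map_mul, mul_assoc, coords_ι_mul] at h₁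
  simp only [fun a => hE.coords_x_mul_succ (ι a) 0, coords_ι] at h₁
  simp at h₁
  apply σ.injective
  rw [map_mul, map_mul, AlgEquiv.apply_symm_apply]
  exact h₁

end IsOreExtension

end

/-! ### The main theorem -/

theorem mainTheorem1 {k : Type u} {A : Type v} {E : Type w} [CommRing k] [Ring A] [Algebra k A]
    [Module.Projective k A] [Ring E] [Algebra k E]
    (σ : A ≃ₐ[k] A) (δ : A →ₗ[k] A) (hδ : IsSkewDerivation σ.toAlgHom δ)
    (ι : A →ₐ[k] E) (x : E) (hE : IsOreExtension σ.toAlgHom δ ι x)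
    (ν : A ≃ₐ[k] A) (d : ℕ) (hA : IsTwistedCalabiYau k ν d) :
    ∃ ν' : E ≃ₐ[k] E, IsTwistedCalabiYau k ν' (d + 1) ∧
      (∀ a : A, ν' (ι a) = ι (σ.symm (ν a))) ∧
      ∃ (u : Aˣ) (b : A), ν' x = ι u * x + ι b := by
  obtain ⟨Q, N, hQ⟩ := hA.smooth.exists_matRes
  obtain ⟨t, ht⟩ := hA.exists_isDualGenerator Q
  obtain ⟨hvan, u, c, ψ, hψ, hψA, hψx⟩ := hE.exists_extEquiv hδ ht
  obtain ⟨ρ, hρ⟩ := ExtEnveloping.exists_algHom ψ hψ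
  have hρA : ∀ b, ρ (ι b) = ι (ν (σ.symm b)) := fun b => ψ.injective (by
    rw [← hψA, hρ, one_mul, one_mul])
  have hρx : ρ x = x * ι u + ι c := ψ.injective (by rw [← hψx, hρ, one_mul, one_mul])
  let U : Eˣ := Units.map (ι : A →* E) u
  -- `ρ` restricts to `ν σ⁻¹`; conjugation by `u` replaces this by `σ⁻¹ ν` and moves the unit in `ρ
  -- x` to the left of `x`.
  let γ : E →ₐ[k] E :=
    { (MulSemiringAction.toRingHom (ConjAct Eˣ) E (ConjAct.toConjAct U)).comp ρ.toRingHom with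
      commutes' := fun r => by
        change U * ρ (algebraMap k E r) * ↑U⁻¹ = _
        rw [AlgHom.commutes, ← Algebra.commutes, mul_assoc, Units.mul_inv, mul_one] }
  have hγ : ∀ z, γ z = ι u * ρ z * ι ↑u⁻¹ := fun z => rfl
  have hγA : ∀ a, γ (ι a) = ι ((ν.trans σ.symm) a) := fun a => by
    have h := hE.unit_mul_eq hρA hρx a
    rw [AlgEquiv.symm_apply_apply] at h
    rw [hγ, hρA, ← map_mul, ← map_mul, h, mul_assoc, Units.mul_inv, mul_one]
    rfl
  have hγx : γ x = ι u * x + ι (u * c * ↑u⁻¹) := by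
    rw [hγ, hρx, map_mul, map_mul, mul_add, add_mul, ← mul_assoc, mul_assoc (ι u * x), ← map_mul,
      Units.mul_inv, map_one, mul_one]
  -- Right multiplication by `u⁻¹` preserves the left structure and changes the right structure from
  -- `ρ` to its conjugate `γ`.
  refine ⟨AlgEquiv.ofBijective γ (hE.bijective_of_map_x hγA hγx), ⟨hE.isHomologicallySmooth hQ,
    hvan, ψ.symm.trans (AddAut.mulRight U⁻¹), fun a b ξ => ?_⟩, hγA, u, _, hγx⟩
  obtain ⟨e, rfl⟩ := ψ.surjective ξ
  change ψ.symm (ExtEnveloping.biact a b (ψ e)) * ι ↑u⁻¹ =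
    a * (ψ.symm (ψ e) * ι ↑u⁻¹) * (ι u * ρ b * ι ↑u⁻¹)
  rw [hρ, AddEquiv.symm_apply_apply, AddEquiv.symm_apply_apply]
  have hu : ι ↑u⁻¹ * ι u = 1 := by rw [← map_mul, Units.inv_mul, map_one]
  simp only [mul_assoc]
  rw [← mul_assoc (ι ↑u⁻¹) (ι u), hu, one_mul]
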